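/- Write $\mathbb H=\{z\in\mathbb C:\Im z>0\}$ and $\overline{\mathbb H}=\{z\in\mathbb C:\Im z\ge0\}$. Let $\kappa:\mathbb R\to\overline{\mathbb H}$ be an attenuation coefficient, that is, a non-zero smooth function all of whose derivatives are polynomially bounded, which satisfies $\kappa(-\omega)=-\overline{\kappa(\omega)}$ for all $\omega\in\mathbb R$, and which has a continuous extension $\tilde\kappa:\overline{\mathbb H}\to\overline{\mathbb H}$ that is holomorphic in $\mathbb H$ and satisfies $|\tilde\kappa(z)|\le C(1+|z|)^N$ on $\overline{\mathbb H}$ for some $C>0$, $N\in\mathbb N$. Let $\mathcal A_\kappa$ be the operator on $\mathcal S'(\mathbb R\times\mathbb R^3)$ with $$\langle\mathcal A_\kappa u,\phi\otimes\psi\rangle=-\langle u,(\mathcal F^{-1}\kappa^2\mathcal F\phi)\otimes\psi\rangle,\qquad \phi\in\mathcal S(\mathbb R),\ \psi\in\mathcal S(\mathbb R^3),$$ where $\mathcal F\phi(\omega)=\frac1{\sqrt{2\pi}}\int_{\mathbb R}\phi(t)e^{-i\omega t}\,dt$. For a real-valued $h\in L^2(\mathbb R^3)$ with compact essential support, let $p=p_h\in\mathcal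 S'(\mathbb R\times\mathbb R^3)$ with $\operatorname{supp}p\subset[0,\infty)\times\mathbb R^3$ be the causal solution of the attenuated wave equation $$\langle\mathcal A_\kappa p,\vartheta\rangle-\langle\Delta_x p,\vartheta\rangle=-\int_{\mathbb R^3}h(x)\,\partial_t\vartheta(0,x)\,dx\qquad\text{for all }\vartheta\in\mathcal S(\mathbb R\times\mathbb R^3).$$ For $c>0$ we say that the solution propagates with finite speed $c$ if for every such $h$ and every $R>0$ with $\operatorname{supp}h\subset B_R(0)$ we have $\operatorname{supp}p_h\subset\{(t,x)\in\mathbb R\times\mathbb R^3:|x|\le ct+R\}$. Then the limit $A=\lim_{\omega\to\infty}\frac{\tilde\kappa(i\omega)}{i\omega}$ exists and is real, and the solution of the attenuated wave equation propagates with finite speed $c$ for some $c>0$ if and only if $A>0$. In that case the limit $c=\lim_{\omega\to\infty}\frac{i\omega}{\tilde\kappa(i\omega)}$ exists and is real, the solution propagates with finite speed $c$, and $c$ is the smallest number with this property. -/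

import Mathlib

open MeasureTheory Filter Topology
open scoped SchwartzMap FourierTransform LineDeriv RealInnerProductSpace

noncomputable section

namespace AttenuatedWave

/-- The space `ℝ³` with its Euclidean norm. -/
abbrev Space : Type := EuclideanSpace ℝ (Fin 3)

/-- Space-time `ℝ × ℝ³`, with the Euclidean norm of `ℝ⁴`; a point is `z = (t, x)` with
`t = z.fst` and `x = z.snd`. -/
abbrev SpaceTime : Type := WithLp 2 (ℝ × Space)

/-- The point `(t, x)` of space-time. -/
def point (t : ℝ) (x : Space) : SpaceTime := WithLp.toLp 2 (t, x)

/-- The unit vector in the direction of time. -/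
def timeDir : SpaceTime := point 1 0

/-- The unit vectors in the three directions of space. -/
def spaceDir (i : Fin 3) : SpaceTime := point 0 (EuclideanSpace.single i 1)

/-- `κt` is a holomorphic extension of `κ` to the closed upper half plane: it is continuous there,
holomorphic in the open upper half plane, takes values in the closed upper half plane, is
polynomially bounded, and agrees with `κ` on the real line. Values of `κt` in the lower half plane
play no role. -/
structure IsHolomorphicExtension (κ : ℝ → ℂ) (κt : ℂ → ℂ) : Prop where
  continuousOn : ContinuousOn κt {z | 0 ≤ z.im}
  differentiableOn : DifferentiableOn ℂ κt {z | 0 < z.im}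
  im_nonneg : ∀ z : ℂ, 0 ≤ z.im → 0 ≤ (κt z).im
  bound : ∃ (C : ℝ) (N : ℕ), 0 < C ∧ ∀ z : ℂ, 0 ≤ z.im → ‖κt z‖ ≤ C * (1 + ‖z‖) ^ N
  eq_on_real : ∀ ω : ℝ, κt (ω : ℂ) = κ ω

/-- Attenuation coefficients. `Function.HasTemperateGrowth` says that `κ` is smooth and that each
of its derivatives is polynomially bounded. -/
structure IsAttenuationCoefficient (κ : ℝ → ℂ) : Prop where
  ne_zero : κ ≠ 0
  im_nonneg : ∀ ω : ℝ, 0 ≤ (κ ω).im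
  temperate : κ.HasTemperateGrowth
  extension : ∃ κt : ℂ → ℂ, IsHolomorphicExtension κ κt
  symm : ∀ ω : ℝ, κ (-ω) = -(starRingEnd ℂ) (κ ω)

/-- The attenuation operator `𝒜_κ` on tempered distributions on `ℝ × ℝ³`, which multiplies the
inverse Fourier transform in time (kernel `e^{iωt}`, angular frequency `ω`) by `-κ(ω)²`.
The Fourier transform of Mathlib has the kernel `e^{-2πi⟨z, w⟩}`, so that the angular frequency is
`ω = -2π w.fst`; the transform in space, which the multiplier does not see, cancels.
`attenuationOperator_tensor` is the description of the operator on tensor products. -/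
def attenuationOperator (κ : ℝ → ℂ) : 𝓢'(SpaceTime, ℂ) →L[ℂ] 𝓢'(SpaceTime, ℂ) :=
  -TemperedDistribution.fourierMultiplierCLM ℂ
    (fun w : SpaceTime => κ (-(2 * Real.pi * w.fst)) ^ 2)

/-- The Laplace operator in the space variables on tempered distributions on `ℝ × ℝ³`. -/
def spatialLaplacian (u : 𝓢'(SpaceTime, ℂ)) : 𝓢'(SpaceTime, ℂ) :=
  ∑ i : Fin 3, ∂_{spaceDir i} (∂_{spaceDir i} u)

/-- The essential support of a function on `ℝ³`: the points all of whose neighbourhoods `U` have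
the property that the function is not almost everywhere zero on `U`. -/
def essSupport (h : Space → ℝ) : Set Space :=
  {x | ∀ U ∈ 𝓝 x, ¬ (∀ᵐ y ∂(volume.restrict U), h y = 0)}

/-- `p` is a causal solution of the attenuated wave equation
`𝒜_κ p - Δ p = δ'(t) h(x)`, that is, a solution supported in `[0, ∞) × ℝ³`. -/
structure IsCausalSolution (κ : ℝ → ℂ) (h : Space → ℝ) (p : 𝓢'(SpaceTime, ℂ)) : Prop where
  equation : ∀ ϑ : 𝓢(SpaceTime, ℂ),
    attenuationOperator κ p ϑ - spatialLaplacian p ϑ =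
      -∫ x : Space, (h x : ℂ) * (∂_{timeDir} ϑ) (point 0 x)
  causal : Distribution.dsupport p ⊆ {z | 0 ≤ z.fst}

/-- The solution of the attenuated wave equation propagates with finite speed `c > 0`: for every
source `h ∈ L²(ℝ³)` with compact essential support, the causal solution `p` is supported in
`{(t, x) | |x| ≤ c t + R}` whenever `supp h ⊆ B_R(0)`. -/
def PropagatesWithSpeed (κ : ℝ → ℂ) (c : ℝ) : Prop :=
  0 < c ∧ ∀ h : Space → ℝ, MemLp h 2 volume → IsCompact (essSupport h) →
    ∀ p : 𝓢'(SpaceTime, ℂ), IsCausalSolution κ h p →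
      ∀ R : ℝ, 0 < R → essSupport h ⊆ Metric.ball 0 R →
        Distribution.dsupport p ⊆ {z | ‖z.snd‖ ≤ c * z.fst + R}

theorem fourierInv_tensor (φ : 𝓢(ℝ, ℂ)) (ψ : 𝓢(Space, ℂ)) (Θ : 𝓢(SpaceTime, ℂ))
    (hΘ : ∀ z, Θ z = φ z.fst * ψ z.snd) (w : SpaceTime) :
    (𝓕⁻ Θ) w = (𝓕⁻ φ) w.fst * (𝓕⁻ ψ) w.snd := by
  simp only [SchwartzMap.fourierInv_coe, Real.fourierInv_eq]
  rw [← integral_prod_mul, ← Measure.volume_eq_prod,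
    ← (WithLp.volume_preserving_symm_measurableEquiv_toLp_prod ℝ Space).integral_comp']
  refine integral_congr_ae (Eventually.of_forall fun z => ?_)
  change Real.fourierChar _ • Θ z =
    (Real.fourierChar (inner ℝ z.fst w.fst) • φ z.fst) *
      (Real.fourierChar (inner ℝ z.snd w.snd) • ψ z.snd)
  rw [hΘ, WithLp.prod_inner_apply, AddChar.map_add_eq_mul]
  simp only [Circle.smul_def, Circle.coe_mul, smul_eq_mul,
    WithLp.ofLp_fst, WithLp.ofLp_snd]
  ring

/-- On tensor products the attenuation operator is given by
`⟨𝒜_κ u, φ ⊗ ψ⟩ = -⟨u, (F⁻¹ κ² F φ) ⊗ ψ⟩`, where `F` is the Fourier transform with angular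
frequencies: with the transform `𝓕` of Mathlib, `F⁻¹ κ² F = 𝓕⁻¹ κ(2π ·)² 𝓕`. -/
theorem attenuationOperator_tensor (κ : ℝ → ℂ) (hκ : κ.HasTemperateGrowth)
    (u : 𝓢'(SpaceTime, ℂ)) (φ : 𝓢(ℝ, ℂ)) (ψ : 𝓢(Space, ℂ)) (Θ Θ' : 𝓢(SpaceTime, ℂ))
    (hΘ : ∀ z, Θ z = φ z.fst * ψ z.snd)
    (hΘ' : ∀ z, Θ' z =
      SchwartzMap.fourierMultiplierCLM ℂ (fun ω : ℝ => κ (2 * Real.pi * ω) ^ 2) φ z.fst * ψ z.snd) :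
    attenuationOperator κ u Θ = -u Θ' := by
  have h1 : (fun ω : ℝ => κ (2 * Real.pi * ω) ^ 2).HasTemperateGrowth := by
    have : (fun ω : ℝ => 2 * Real.pi * ω).HasTemperateGrowth := by fun_prop
    exact (hκ.comp this).pow 2
  have h2 : (fun w : SpaceTime => κ (-(2 * Real.pi * w.fst)) ^ 2).HasTemperateGrowth := by
    have : (fun w : SpaceTime => -(2 * Real.pi * (WithLp.fstL 2 ℝ ℝ Space w))).HasTemperateGrowth :=
      by fun_prop
    exact (hκ.comp this).pow 2
  have key : SchwartzMap.smulLeftCLM ℂ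
      (fun w : SpaceTime => κ (-(2 * Real.pi * w.fst)) ^ 2) (𝓕⁻ Θ) = 𝓕⁻ Θ' := by
    ext w
    rw [SchwartzMap.smulLeftCLM_apply_apply h2, fourierInv_tensor φ ψ Θ hΘ,
      fourierInv_tensor _ ψ Θ' hΘ', SchwartzMap.fourierMultiplierCLM_apply]
    have h3 : ∀ f : 𝓢(ℝ, ℂ), (𝓕⁻ f) w.fst = (𝓕 f) (-w.fst) := fun f => by
      rw [SchwartzMap.fourierInv_coe, SchwartzMap.fourier_coe, Real.fourierInv_eq_fourier_neg]
    rw [h3 (𝓕⁻ _), FourierTransform.fourier_fourierInv_eq,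
      SchwartzMap.smulLeftCLM_apply_apply h1, h3]
    simp only [smul_eq_mul, mul_neg, mul_assoc]
  change -(u (𝓕 (SchwartzMap.smulLeftCLM ℂ _ (𝓕⁻ Θ)))) = _
  rw [key, FourierTransform.fourier_fourierInv_eq]

end AttenuatedWave

end

/-! ### Holomorphic self-maps of the upper half plane. -/

namespace AttenuatedWave

/-! The extension κt maps the open upper half plane into itself, and the symmetry of κ makes κt(iy)
= iμ(y) with μ(y) > 0. The Schwarz-Pick lemma then shows that μ(y)/y decreases, so that A exists and
is real. If A > 0, its limiting form, Julia's lemma `mul_im_le_im`, gives Im κt(z) ≥ A Im z in the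
whole half plane.

Sufficiency. Since p is causal it may be tested after damping by e^{-ηt}, which moves the time
frequency to the line at height η (`apply_cutoffExp`). There the symbol 4π²|ξ|² - κt² is invertible,
and it remains so when ξ is moved by iT/(2π) in a unit direction e, as long as T stays below Im κt.
By Julia's lemma T = Aη - 1 is allowed. For a source in B_R and a test function supported in {t' ≤
t, ⟨e, x⟩ ≥ s} the two shifts bound p by a polynomial in η times e^{-(A(s - R) - t)η}. Letting η →
∞, p vanishes whenever t < A(s - R), and such wedges exhaust the complement of the cone of speed 1/A
(`apply_eq_zero_of_halfSpace`, `propagatesWithSpeed_inv`).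

Necessity. Tested against e^{-ηt}ψ(x), the equation becomes elliptic, and the value of p is exactly
η∫ h (μ(η)² - Δ)⁻¹ψ (`apply_tensor_timeExp`). For nonnegative h and ψ supported at distances at most
D from each other this is at least about e^{-μ(η)D}, because the resolvent is a positive
superposition of heat kernels (`le_norm_integral_mul_laplaceResolvent`). Finite speed c lets nothing
arrive at distance ρ before a time close to ρ/c, so the same number is at most about e^{-ηρ/c}.
Comparing exponents as η → ∞ and then ρ → ∞ gives 1/c ≤ A (`PropagatesWithSpeed.inv_le`), whence A >
0 and the minimality of 1/A.

The definition of finite speed quantifies over causal solutions, so necessity needs one to exist. It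
is obtained for smooth sources as a limit point of the solutions with the frequency in κt moved up
by η, as η decreases to 0 (`exists_isCausalSolution`). Compactness rests on `norm_integral_div_le`,
a resolvent bound that is uniform up to the real axis and comes from the integrable decay τ^{-3/2}
of Gaussians in dimension three. Uniqueness is never needed. -/

theorem normSq_sub_conj (z w : ℂ) :
    ‖z - (starRingEnd ℂ) w‖ ^ 2 = ‖z - w‖ ^ 2 + 4 * (z.im * w.im) := by
  rw [← Complex.normSq_eq_norm_sq, ← Complex.normSq_eq_norm_sq, Complex.normSq_apply,
    Complex.normSq_apply]
  simp only [Complex.sub_re, Complex.sub_im, Complex.conj_re, Complex.conj_im]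
  ring

/-- The **Schwarz-Pick lemma** in the upper half plane. -/
theorem schwarz_pick_upperHalfPlane {f : ℂ → ℂ} (hf : DifferentiableOn ℂ f {z | 0 < z.im})
    (him : ∀ z : ℂ, 0 < z.im → 0 < (f z).im) {z w : ℂ} (hz : 0 < z.im) (hw : 0 < w.im) :
    ‖f z - f w‖ ^ 2 * (z.im * w.im) ≤ ‖z - w‖ ^ 2 * ((f z).im * (f w).im) := by
  set a := f w with ha
  have ha0 : 0 < a.im := him w hw
  -- The Cayley map of the disc onto the half plane with φ 0 = w. Below, F is f read in disc
  -- coordinates centred at w and f w, so that the classical Schwarz lemma applies to it.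
  set φ : ℂ → ℂ := fun ζ => (w - (starRingEnd ℂ) w * ζ) / (1 - ζ) with hφ
  have hne : ∀ ζ ∈ Metric.ball (0 : ℂ) 1, (1 : ℂ) - ζ ≠ 0 := by
    intro ζ hζ h
    rw [sub_eq_zero] at h
    simp [← h] at hζ
  have hφim : ∀ ζ ∈ Metric.ball (0 : ℂ) 1, 0 < (φ ζ).im := by
    intro ζ hζ
    have h1 : 0 < Complex.normSq (1 - ζ) := Complex.normSq_pos.2 (hne ζ hζ)
    have h2 : Complex.normSq ζ < 1 := by
      rw [Complex.normSq_eq_norm_sq]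
      have := mem_ball_zero_iff.1 hζ
      nlinarith [norm_nonneg ζ]
    have h3 : (φ ζ).im = w.im * (1 - Complex.normSq ζ) / Complex.normSq (1 - ζ) := by
      simp only [hφ, Complex.div_im, Complex.normSq_apply, Complex.sub_re, Complex.sub_im,
        Complex.mul_re, Complex.mul_im, Complex.conj_re, Complex.conj_im, Complex.one_re,
        Complex.one_im]
      ring
    rw [h3]
    have : 0 < 1 - Complex.normSq ζ := by linarith
    positivity
  have hden : ∀ b : ℂ, 0 < b.im → b - (starRingEnd ℂ) a ≠ 0 := by
    intro b hb h
    have := congrArg Complex.im h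
    simp at this
    linarith
  set F : ℂ → ℂ := fun ζ => (f (φ ζ) - a) / (f (φ ζ) - (starRingEnd ℂ) a) with hF
  have hφd : DifferentiableOn ℂ φ (Metric.ball 0 1) := by
    apply DifferentiableOn.div (by fun_prop) (by fun_prop) hne
  have hfd : DifferentiableOn ℂ (fun ζ => f (φ ζ)) (Metric.ball 0 1) :=
    hf.comp hφd fun ζ hζ => hφim ζ hζ
  have hFd : DifferentiableOn ℂ F (Metric.ball 0 1) :=
    (hfd.sub_const _).div (hfd.sub_const _) fun ζ hζ => hden _ (him _ (hφim ζ hζ))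
  have hFm : Set.MapsTo F (Metric.ball 0 1) (Metric.closedBall 0 1) := by
    intro ζ hζ
    have hb := him _ (hφim ζ hζ)
    rw [mem_closedBall_zero_iff, hF, norm_div, div_le_one (norm_pos_iff.2 (hden _ hb))]
    refine abs_le_of_sq_le_sq' ?_ (norm_nonneg _) |>.2
    rw [normSq_sub_conj]
    nlinarith [mul_pos hb ha0]
  have hF0 : F 0 = 0 := by simp [hF, hφ, ha]
  have hzw : z - (starRingEnd ℂ) w ≠ 0 := by
    intro h
    have := congrArg Complex.im h
    simp at this
    linarith
  have hww : w - (starRingEnd ℂ) w ≠ 0 := by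
    intro h
    have := congrArg Complex.im h
    simp at this
    linarith
  set ζ := (z - w) / (z - (starRingEnd ℂ) w) with hζ
  have hφζ : φ ζ = z := by
    have h1 : 1 - ζ = (w - (starRingEnd ℂ) w) / (z - (starRingEnd ℂ) w) := by
      rw [hζ]; field_simp; ring
    simp only [hφ]
    rw [h1, hζ]
    field_simp
    ring
  have hpos : 0 < ‖z - (starRingEnd ℂ) w‖ := norm_pos_iff.2 hzw
  have hζ1 : ‖ζ‖ < 1 := by
    rw [hζ, norm_div, div_lt_one hpos]
    refine abs_lt_of_sq_lt_sq' ?_ (norm_nonneg _) |>.2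
    rw [normSq_sub_conj]
    nlinarith [mul_pos hz hw]
  have key := Complex.norm_le_norm_of_mapsTo_ball hFd hFm hF0 hζ1
  have hpos2 : 0 < ‖f z - (starRingEnd ℂ) a‖ := norm_pos_iff.2 (hden _ (him z hz))
  simp only [hF, hφζ] at key
  rw [hζ, norm_div, norm_div, div_le_div_iff₀ hpos2 hpos] at key
  have key2 := mul_self_le_mul_self (by positivity) key
  have e1 := normSq_sub_conj z w
  have e2 := normSq_sub_conj (f z) a
  have : ‖f z - a‖ ^ 2 * ‖z - (starRingEnd ℂ) w‖ ^ 2 ≤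
      ‖z - w‖ ^ 2 * ‖f z - (starRingEnd ℂ) a‖ ^ 2 := by nlinarith
  rw [e1, e2] at this
  nlinarith

namespace IsHolomorphicExtension

variable {κ : ℝ → ℂ} {κt : ℂ → ℂ}

/-- A real value at an interior point would, by the open mapping theorem, push nearby values below
the real axis, unless κt is constant. A real constant is excluded because the symmetry of κ would
make it equal to its own negative, hence zero. -/
theorem im_pos (hκ : IsAttenuationCoefficient κ) (hκt : IsHolomorphicExtension κ κt) {z : ℂ}
    (hz : 0 < z.im) : 0 < (κt z).im := by
  by_contra! hcon
  have hz0 : (κt z).im = 0 := le_antisymm hcon (hκt.im_nonneg z hz.le)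
  have hopen : IsOpen {z : ℂ | 0 < z.im} := isOpen_lt continuous_const Complex.continuous_im
  have hconv : Convex ℝ {z : ℂ | 0 < z.im} := convex_halfSpace_im_gt 0
  have han : AnalyticOnNhd ℂ κt {z | 0 < z.im} := hκt.differentiableOn.analyticOnNhd hopen
  have hconst : ∃ w, ∀ x ∈ {z : ℂ | 0 < z.im}, κt x = w := by
    refine (han.is_constant_or_isOpen hconv.isPreconnected).resolve_right fun h => ?_
    have h1 := h _ subset_rfl hopen
    obtain ⟨ε, hε, hball⟩ := Metric.isOpen_iff.1 h1 (κt z) ⟨z, hz, rfl⟩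
    have : κt z - (ε / 2 : ℝ) * Complex.I ∈ Metric.ball (κt z) ε := by
      rw [mem_ball_iff_norm]
      simp [abs_of_pos hε]
      linarith
    obtain ⟨y, hy, hy2⟩ := hball this
    have h3 := hκt.im_nonneg y (le_of_lt hy)
    rw [hy2] at h3
    simp [hz0] at h3
    linarith
  obtain ⟨w, hw⟩ := hconst
  have hwim : w.im = 0 := by rw [← hw z hz, hz0]
  have hreal : ∀ ω : ℝ, κ ω = w := by
    intro ω
    rw [← hκt.eq_on_real]
    have hc : Set.EqOn κt (fun _ => w) {z : ℂ | 0 ≤ z.im} := by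
      have hsub : {z : ℂ | 0 ≤ z.im} ⊆ closure {z : ℂ | 0 < z.im} := by
        rw [Complex.closure_setOfPred_lt_im]
      exact Set.EqOn.of_subset_closure (fun x hx => hw x hx) hκt.continuousOn continuousOn_const
        (fun x hx => le_of_lt (show 0 < x.im from hx)) hsub
    exact hc (by simp)
  apply hκ.ne_zero
  funext ω
  have h1 := hκ.symm ω
  rw [hreal, hreal, Complex.conj_eq_iff_im.2 hwim, eq_neg_iff_add_eq_zero, ← two_mul] at h1
  rw [hreal]
  simpa using h1

/-- The points iy are fixed by the reflection z ↦ -conj z. The function g measures the failure of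
the reflected symmetry of κt, in the coordinate z = iζ on the right half plane. It vanishes on the
boundary by the symmetry of κ, and Phragmén-Lindelöf carries this inside. -/
theorem re_mul_I_eq_zero (hκ : IsAttenuationCoefficient κ) (hκt : IsHolomorphicExtension κ κt)
    {y : ℝ} (hy : 0 ≤ y) : (κt (Complex.I * y)).re = 0 := by
  obtain ⟨C, N, hC, hb⟩ := hκt.bound
  set g : ℂ → ℂ := fun ζ => κt (Complex.I * ζ) +
    (starRingEnd ℂ) (κt (Complex.I * (starRingEnd ℂ) ζ)) with hg
  set f : ℂ → ℂ := fun ζ => g ζ / (1 + ζ) ^ N with hf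
  have hne : ∀ ζ : ℂ, 0 ≤ ζ.re → (1 + ζ) ≠ 0 := by
    intro ζ h h'
    have := congrArg Complex.re h'
    simp at this
    linarith
  have hgc : ContinuousOn g {ζ | 0 ≤ ζ.re} := by
    refine ContinuousOn.add (hκt.continuousOn.comp (by fun_prop) ?_)
      (Complex.continuous_conj.comp_continuousOn (hκt.continuousOn.comp (by fun_prop) ?_))
    · intro ζ hζ; simpa using hζ
    · intro ζ hζ; simpa using hζ
  have hgd : DifferentiableOn ℂ g {ζ | 0 < ζ.re} := by
    have hopen : IsOpen {z : ℂ | 0 < z.im} := isOpen_lt continuous_const Complex.continuous_im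
    intro ζ hζ
    have e1 : ∀ ζ : ℂ, 0 < ζ.re → DifferentiableAt ℂ (fun ζ => κt (Complex.I * ζ)) ζ := by
      intro ζ hζ
      have : DifferentiableAt ℂ κt (Complex.I * ζ) :=
        hκt.differentiableOn.differentiableAt (hopen.mem_nhds (by simpa using hζ))
      exact this.comp ζ (by fun_prop)
    refine ((e1 ζ hζ).add ?_).differentiableWithinAt
    have h2 := (e1 ((starRingEnd ℂ) ζ) (by simpa using hζ)).conj_conj
    simpa [Function.comp_def] using h2
  have hfc : ContinuousOn f {ζ | 0 ≤ ζ.re} :=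
    hgc.div (by fun_prop) fun ζ hζ => pow_ne_zero _ (hne ζ hζ)
  have hfd : DiffContOnCl ℂ f {ζ | 0 < ζ.re} := by
    refine ⟨hgd.div (by fun_prop) fun ζ hζ => pow_ne_zero _ (hne ζ (le_of_lt hζ)), ?_⟩
    rwa [Complex.closure_setOfPred_lt_re]
  have hle : ∀ ζ : ℂ, 0 ≤ ζ.re → ‖f ζ‖ ≤ 2 * C * 2 ^ N := by
    intro ζ hζ
    have h1 : ‖g ζ‖ ≤ 2 * C * (1 + ‖ζ‖) ^ N := by
      have a1 := hb (Complex.I * ζ) (by simpa using hζ)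
      have a2 := hb (Complex.I * (starRingEnd ℂ) ζ) (by simpa using hζ)
      simp only [norm_mul, Complex.norm_I, one_mul, RCLike.norm_conj] at a1 a2
      refine (norm_add_le _ _).trans ?_
      rw [RCLike.norm_conj]
      linarith
    have h2 : 1 + ‖ζ‖ ≤ 2 * ‖1 + ζ‖ := by
      have b1 : 1 ≤ ‖1 + ζ‖ := by
        refine le_trans ?_ (Complex.re_le_norm _)
        simp [hζ]
      have b2 : ‖ζ‖ ≤ ‖1 + ζ‖ := by
        refine abs_le_of_sq_le_sq' ?_ (norm_nonneg _) |>.2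
        rw [← Complex.normSq_eq_norm_sq, ← Complex.normSq_eq_norm_sq, Complex.normSq_apply,
          Complex.normSq_apply]
        simp
        nlinarith
      linarith
    rw [hf, norm_div, norm_pow, div_le_iff₀ (pow_pos (norm_pos_iff.2 (hne ζ hζ)) _)]
    calc ‖g ζ‖ ≤ 2 * C * (1 + ‖ζ‖) ^ N := h1
      _ ≤ 2 * C * (2 * ‖1 + ζ‖) ^ N := by gcongr
      _ = _ := by rw [mul_pow]; ring
  have h0 : ‖f y‖ ≤ 0 := by
    refine PhragmenLindelof.right_half_plane_of_bounded_on_real hfd ⟨1, by norm_num, 0, ?_⟩ ?_ ?_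
      (by simpa using hy)
    · refine Asymptotics.IsBigO.of_bound (2 * C * 2 ^ N) ?_
      refine (eventually_inf_principal.2 (Eventually.of_forall fun ζ hζ => ?_))
      simpa using hle ζ (le_of_lt hζ)
    · refine isBoundedUnder_of_eventually_le (a := 2 * C * 2 ^ N) ?_
      filter_upwards [eventually_ge_atTop 0] with x hx
      exact hle x (by simpa using hx)
    · intro x
      have e1 : Complex.I * (x * Complex.I) = ((-x : ℝ) : ℂ) := by
        push_cast; linear_combination (x : ℂ) * Complex.I_mul_I
      have e2 : Complex.I * (starRingEnd ℂ) (x * Complex.I) = (x : ℂ) := by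
        simp only [map_mul, Complex.conj_ofReal, Complex.conj_I]
        linear_combination (-x : ℂ) * Complex.I_mul_I
      simp only [hf, hg]
      rw [e1, e2, hκt.eq_on_real, hκt.eq_on_real, hκ.symm]
      simp
  have h1 : g y = 0 := by
    have : f y = 0 := norm_le_zero_iff.1 h0
    rw [hf] at this
    exact (div_eq_zero_iff.1 this).resolve_right (pow_ne_zero _ (hne _ (by simpa using hy)))
  have h2 := congrArg Complex.re h1
  simp [hg] at h2
  linarith

theorem apply_I_mul (hκ : IsAttenuationCoefficient κ) (hκt : IsHolomorphicExtension κ κt)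
    {y : ℝ} (hy : 0 ≤ y) : κt (Complex.I * y) = Complex.I * ((κt (Complex.I * y)).im : ℂ) := by
  apply Complex.ext
  · simp [hκt.re_mul_I_eq_zero hκ hy]
  · simp

theorem schwarz_pick (hκ : IsAttenuationCoefficient κ) (hκt : IsHolomorphicExtension κ κt)
    {z w : ℂ} (hz : 0 < z.im) (hw : 0 < w.im) :
    ‖κt z - κt w‖ ^ 2 * (z.im * w.im) ≤ ‖z - w‖ ^ 2 * ((κt z).im * (κt w).im) :=
  schwarz_pick_upperHalfPlane hκt.differentiableOn (fun _ h => hκt.im_pos hκ h) hz hw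

/-- On the imaginary axis `y ↦ κt (i y) / (i y)` is antitone. -/
theorem im_div_antitoneOn (hκ : IsAttenuationCoefficient κ) (hκt : IsHolomorphicExtension κ κt)
    {x y : ℝ} (hx : 0 < x) (hxy : x ≤ y) :
    (κt (Complex.I * y)).im / y ≤ (κt (Complex.I * x)).im / x := by
  have hy : 0 < y := hx.trans_le hxy
  have h := hκt.schwarz_pick hκ (z := Complex.I * y) (w := Complex.I * x) (by simpa using hy)
    (by simpa using hx)
  have px := hκt.im_pos hκ (z := Complex.I * x) (by simpa using hx)
  have py := hκt.im_pos hκ (z := Complex.I * y) (by simpa using hy)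
  rw [hκt.apply_I_mul hκ hx.le, hκt.apply_I_mul hκ hy.le, ← mul_sub, ← mul_sub, norm_mul, norm_mul,
    ← Complex.ofReal_sub, ← Complex.ofReal_sub, Complex.norm_real, Complex.norm_real] at h
  simp only [Complex.norm_I, one_mul, Real.norm_eq_abs, sq_abs, Complex.mul_im, Complex.I_re,
    Complex.I_im, Complex.ofReal_re, Complex.ofReal_im, zero_mul, zero_add] at h
  set a := (κt (Complex.I * x)).im
  set b := (κt (Complex.I * y)).im
  rw [div_le_div_iff₀ hy hx]
  by_contra! hcon
  have hba : a ≤ b := by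
    by_contra! h'
    nlinarith
  -- The Schwarz-Pick inequality (b - a)²xy ≤ (y - x)²ab is equivalent to this factored form.
  have : (b * x - a * y) * (b * y - a * x) ≤ 0 := by nlinarith
  have h1 : 0 < b * y - a * x := by
    nlinarith
  nlinarith

theorem exists_tendsto_im_div (hκ : IsAttenuationCoefficient κ)
    (hκt : IsHolomorphicExtension κ κt) :
    ∃ A : ℝ, 0 ≤ A ∧ Tendsto (fun y : ℝ => (κt (Complex.I * y)).im / y) atTop (𝓝 A) ∧
      ∀ y : ℝ, 0 < y → A * y ≤ (κt (Complex.I * y)).im := by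
  set q : ℝ → ℝ := fun y => (κt (Complex.I * y)).im / y
  have hq : ∀ y, 0 < y → 0 ≤ q y := fun y hy =>
    div_nonneg (hκt.im_nonneg _ (by simpa using hy.le)) hy.le
  -- Monotonicity of q is known only for positive arguments. Truncation at 1 gives a function that
  -- is antitone on all of ℝ and has the same tail.
  set r : ℝ → ℝ := fun y => q (max y 1)
  have hr : Antitone r := fun x y hxy => hκt.im_div_antitoneOn hκ
    (lt_of_lt_of_le one_pos (le_max_right _ _)) (max_le_max_right _ hxy)
  have hbdd : BddBelow (Set.range r) := ⟨0, by
    rintro _ ⟨y, rfl⟩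
    exact hq _ (lt_of_lt_of_le one_pos (le_max_right _ _))⟩
  have hlim := tendsto_atTop_ciInf hr hbdd
  have hlim2 : Tendsto q atTop (𝓝 (⨅ i, r i)) := by
    refine hlim.congr' ?_
    filter_upwards [eventually_ge_atTop 1] with y hy
    simp [r, max_eq_left hy]
  refine ⟨⨅ i, r i, le_ciInf fun y => hq _ (lt_of_lt_of_le one_pos (le_max_right _ _)), hlim2, ?_⟩
  intro y hy
  rw [← le_div_iff₀ hy]
  refine le_of_tendsto hlim2 ?_
  filter_upwards [eventually_ge_atTop y] with x hx
  exact hκt.im_div_antitoneOn hκ hy hx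

theorem tendsto_div (hκ : IsAttenuationCoefficient κ) (hκt : IsHolomorphicExtension κ κt) {A : ℝ}
    (hA : Tendsto (fun y : ℝ => (κt (Complex.I * y)).im / y) atTop (𝓝 A)) :
    Tendsto (fun ω : ℝ => κt (Complex.I * ω) / (Complex.I * ω)) atTop (𝓝 (A : ℂ)) := by
  refine ((Complex.continuous_ofReal.tendsto A).comp hA).congr' ?_
  filter_upwards [eventually_gt_atTop 0] with y hy
  rw [hκt.apply_I_mul hκ hy.le, mul_div_mul_left _ _ Complex.I_ne_zero]
  simp

/-- Julia's lemma: the angular derivative at infinity bounds the imaginary part from below. -/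
theorem mul_im_le_im (hκ : IsAttenuationCoefficient κ) (hκt : IsHolomorphicExtension κ κt) {A : ℝ}
    (hA0 : 0 < A) (hA : Tendsto (fun y : ℝ => (κt (Complex.I * y)).im / y) atTop (𝓝 A))
    {z : ℂ} (hz : 0 < z.im) : A * z.im ≤ (κt z).im := by
  have hfz := hκt.im_pos hκ hz
  set q : ℝ → ℝ := fun y => (κt (Complex.I * y)).im / y
  have hinv : ∀ b : ℝ, Tendsto (fun y : ℝ => b / y) atTop (𝓝 0) := fun b =>
    tendsto_id.const_div_atTop b
  have hl : Tendsto (fun y : ℝ => (q y - ‖κt z‖ / y) ^ 2 * z.im) atTop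
      (𝓝 ((A - 0) ^ 2 * z.im)) := ((hA.sub (hinv _)).pow 2).mul_const _
  have hr : Tendsto (fun y : ℝ => (1 + ‖z‖ / y) ^ 2 * ((κt z).im * q y)) atTop
      (𝓝 ((1 + 0) ^ 2 * ((κt z).im * A))) :=
    ((tendsto_const_nhds.add (hinv _)).pow 2).mul (hA.const_mul _)
  -- This is Schwarz-Pick for z and iy, divided by y³. In the limit it reads A² Im z ≤ A Im κt(z).
  have hle : ∀ᶠ y : ℝ in atTop,
      (q y - ‖κt z‖ / y) ^ 2 * z.im ≤ (1 + ‖z‖ / y) ^ 2 * ((κt z).im * q y) := by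
    have hpos : ∀ᶠ y : ℝ in atTop, 0 < q y - ‖κt z‖ / y :=
      (hA.sub (hinv _)).eventually_const_lt (by simpa using hA0)
    filter_upwards [hpos, eventually_gt_atTop 0] with y hy hy0
    have h := hκt.schwarz_pick hκ (z := z) (w := Complex.I * y) hz (by simpa using hy0)
    set g := (κt (Complex.I * y)).im with hg
    have hgpos : 0 < g := hκt.im_pos hκ (by simpa using hy0)
    have h1 : g - ‖κt z‖ ≤ ‖κt z - κt (Complex.I * y)‖ := by
      have := norm_sub_norm_le (κt (Complex.I * y)) (κt z)
      rw [norm_sub_rev] at this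
      refine le_trans ?_ this
      gcongr
      exact Complex.im_le_norm _
    have h2 : ‖z - Complex.I * y‖ ≤ y + ‖z‖ := by
      refine (norm_sub_le _ _).trans ?_
      rw [norm_mul, Complex.norm_I, one_mul, Complex.norm_real, Real.norm_of_nonneg hy0.le, add_comm]
    have h3 : 0 < g - ‖κt z‖ := by
      have : q y - ‖κt z‖ / y = (g - ‖κt z‖) / y := by simp only [q, ← hg]; ring
      rw [this] at hy
      exact (div_pos_iff_of_pos_right hy0).1 hy
    have h4 : (g - ‖κt z‖) ^ 2 * (z.im * y) ≤ (y + ‖z‖) ^ 2 * ((κt z).im * g) := by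
      have him : (Complex.I * (y : ℂ)).im = y := by simp
      rw [him] at h
      refine le_trans ?_ (h.trans ?_)
      · gcongr
      · gcongr
    have e1 : (q y - ‖κt z‖ / y) ^ 2 * z.im = (g - ‖κt z‖) ^ 2 * (z.im * y) / y ^ 3 := by
      simp only [q, ← hg]; field_simp
    have e2 : (1 + ‖z‖ / y) ^ 2 * ((κt z).im * q y) =
        (y + ‖z‖) ^ 2 * ((κt z).im * g) / y ^ 3 := by
      simp only [q, ← hg]; field_simp
    rw [e1, e2]
    gcongr
  have := le_of_tendsto_of_tendsto hl hr hle
  nlinarith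

/-- On a half plane inside the upper half plane the imaginary part decays at most quadratically. -/
theorem exists_le_im_mul (hκ : IsAttenuationCoefficient κ) (hκt : IsHolomorphicExtension κ κt)
    {η : ℝ} (hη : 0 < η) :
    ∃ c : ℝ, 0 < c ∧ ∀ z : ℂ, η ≤ z.im → c ≤ (κt z).im * (1 + ‖z‖) ^ 2 := by
  set α := (κt Complex.I).im with hα
  have hα0 : 0 < α := hκt.im_pos hκ (by simp)
  refine ⟨min (α * η / 4) (α / 2), by positivity, fun z hz => ?_⟩
  have hz0 : 0 < z.im := hη.trans_le hz
  have hf := hκt.im_pos hκ hz0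
  -- Either κt z is far from κt i, and Schwarz-Pick against i bounds Im κt(z) from below, or it is
  -- near, and Im κt(z) exceeds α/2.
  by_cases hc : α / 2 ≤ ‖κt z - κt Complex.I‖
  · refine (min_le_left _ _).trans ?_
    have h := hκt.schwarz_pick hκ (z := z) (w := Complex.I) hz0 (by simp)
    rw [Complex.I_im, mul_one, ← hα] at h
    have h1 : ‖z - Complex.I‖ ≤ 1 + ‖z‖ := by
      refine (norm_sub_le _ _).trans ?_
      rw [Complex.norm_I, add_comm]
    have h2 : (α / 2) ^ 2 * η ≤ (1 + ‖z‖) ^ 2 * ((κt z).im * α) := by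
      refine le_trans ?_ (h.trans ?_)
      · gcongr
      · gcongr
    nlinarith
  · refine (min_le_right _ _).trans ?_
    push Not at hc
    have h1 := (abs_le.1 ((Complex.abs_im_le_norm (κt z - κt Complex.I)).trans hc.le)).1
    rw [Complex.sub_im, ← hα] at h1
    have h2 : 1 ≤ (1 + ‖z‖) ^ 2 := one_le_pow₀ (by linarith [norm_nonneg z])
    nlinarith

end IsHolomorphicExtension
end AttenuatedWave

/-! ### Schwartz norms under exponential weights. -/

noncomputable section

namespace AttenuatedWave

section Schwartz

variable {V : Type*} [NormedAddCommGroup V] [NormedSpace ℝ V]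

/-- The sum of the Schwartz seminorms with indices at most `n`. -/
def schwartzNorm (n : ℕ) (f : 𝓢(V, ℂ)) : ℝ :=
  ∑ k ∈ Finset.range (n + 1), ∑ j ∈ Finset.range (n + 1), SchwartzMap.seminorm ℂ k j f

theorem schwartzNorm_nonneg (n : ℕ) (f : 𝓢(V, ℂ)) : 0 ≤ schwartzNorm n f :=
  Finset.sum_nonneg fun _ _ => Finset.sum_nonneg fun _ _ => apply_nonneg _ _

theorem seminorm_le_schwartzNorm {n k j : ℕ} (hk : k ≤ n) (hj : j ≤ n) (f : 𝓢(V, ℂ)) :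
    SchwartzMap.seminorm ℂ k j f ≤ schwartzNorm n f := by
  refine le_trans ?_ (Finset.single_le_sum (f := fun k => ∑ j ∈ Finset.range (n + 1),
    SchwartzMap.seminorm ℂ k j f) (fun _ _ => Finset.sum_nonneg fun _ _ => apply_nonneg _ _)
    (Finset.mem_range.2 (Nat.lt_succ_of_le hk)))
  exact Finset.single_le_sum (f := fun j => SchwartzMap.seminorm ℂ k j f)
    (fun _ _ => apply_nonneg _ _) (Finset.mem_range.2 (Nat.lt_succ_of_le hj))

theorem exists_le_schwartzNorm (q : Seminorm ℂ 𝓢(V, ℂ)) (hq : Continuous q) :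
    ∃ (n : ℕ) (C : ℝ), 0 ≤ C ∧ ∀ f, q f ≤ C * schwartzNorm n f := by
  obtain ⟨s, C, -, hC⟩ := Seminorm.bound_of_continuous (schwartz_withSeminorms ℂ V ℂ) q hq
  set n := s.sup Prod.fst + s.sup Prod.snd with hn
  refine ⟨n, C, C.coe_nonneg, fun f => (hC f).trans ?_⟩
  rw [smul_apply, NNReal.smul_def, smul_eq_mul]
  refine mul_le_mul_of_nonneg_left ?_ C.coe_nonneg
  refine Seminorm.finset_sup_apply_le (schwartzNorm_nonneg n f) fun i hi => ?_
  refine seminorm_le_schwartzNorm ?_ ?_ f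
  · exact (Finset.le_sup (f := Prod.fst) hi).trans (Nat.le_add_right _ _)
  · exact (Finset.le_sup (f := Prod.snd) hi).trans (Nat.le_add_left _ _)

theorem exists_norm_apply_le {F : Type*} [NormedAddCommGroup F] [NormedSpace ℂ F]
    (p : 𝓢(V, ℂ) →L[ℂ] F) :
    ∃ (n : ℕ) (C : ℝ), 0 ≤ C ∧ ∀ f, ‖p f‖ ≤ C * schwartzNorm n f :=
  exists_le_schwartzNorm ((normSeminorm ℂ F).comp p.toLinearMap)
    (continuous_norm.comp p.continuous)

theorem norm_iteratedFDeriv_exp_le (L : V →L[ℝ] ℝ) (n : ℕ) (x : V) :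
    ‖iteratedFDeriv ℝ n (fun z => Real.exp (L z)) x‖ ≤ ‖L‖ ^ n * Real.exp (L x) := by
  have h := L.iteratedFDeriv_comp_right (Real.contDiff_exp (n := ⊤)) x (i := n)
    (mod_cast le_top)
  have e : (Real.exp ∘ L) = fun z => Real.exp (L z) := rfl
  rw [← e, h]
  refine (ContinuousMultilinearMap.norm_compContinuousLinearMap_le _ _).trans ?_
  rw [norm_iteratedFDeriv_eq_norm_iteratedDeriv, iteratedDeriv_eq_iterate, Real.iter_deriv_exp,
    Real.norm_of_nonneg (Real.exp_pos _).le]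
  simp [mul_comm]

/-- Derivatives live on the closed support of f, where L ≤ b persists by continuity. -/
theorem exp_mul_norm_iteratedFDeriv_le (L : V →L[ℝ] ℝ) {b : ℝ} (f : 𝓢(V, ℂ))
    (hf : ∀ z, f z ≠ 0 → L z ≤ b) (j : ℕ) (x : V) :
    Real.exp (L x) * ‖iteratedFDeriv ℝ j f x‖ ≤ Real.exp b * ‖iteratedFDeriv ℝ j f x‖ := by
  by_cases h : iteratedFDeriv ℝ j f x = 0
  · simp [h]
  · have h1 : x ∈ tsupport f := support_iteratedFDeriv_subset j h
    have h2 : tsupport f ⊆ {z | L z ≤ b} :=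
      closure_minimal (fun z hz => hf z hz) (isClosed_le L.continuous continuous_const)
    have := h2 h1
    gcongr
    exact this

theorem norm_iteratedFDeriv_exp_mul_le (L : V →L[ℝ] ℝ) {b : ℝ} (f : 𝓢(V, ℂ))
    (hf : ∀ z, f z ≠ 0 → L z ≤ b) (k n : ℕ) (x : V) :
    ‖x‖ ^ k * ‖iteratedFDeriv ℝ n (fun z => (Real.exp (L z) : ℂ) * f z) x‖ ≤
      Real.exp b * (1 + ‖L‖) ^ n * ∑ i ∈ Finset.range (n + 1),
        (n.choose i : ℝ) * SchwartzMap.seminorm ℂ k (n - i) f := by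
  have e : (fun z => (Real.exp (L z) : ℂ) * f z) = fun z => Real.exp (L z) • f z := by
    funext z; simp
  rw [e]
  have h := norm_iteratedFDeriv_smul_le (𝕜 := ℝ) (f := fun z => Real.exp (L z)) (g := f)
    (Real.contDiff_exp.comp L.contDiff (n := (⊤ : ℕ∞))) (f.smooth ⊤) x (n := n)
    (mod_cast le_top)
  refine (mul_le_mul_of_nonneg_left h (by positivity)).trans ?_
  rw [Finset.mul_sum, Finset.mul_sum]
  refine Finset.sum_le_sum fun i hi => ?_
  have hi' : i ≤ n := Nat.lt_succ_iff.1 (Finset.mem_range.1 hi)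
  have h1 := exp_mul_norm_iteratedFDeriv_le L f hf (n - i) x
  have h2 := SchwartzMap.le_seminorm ℂ k (n - i) f x
  have h3 : ‖L‖ ^ i ≤ (1 + ‖L‖) ^ n :=
    (pow_le_pow_left₀ (norm_nonneg _) (by linarith) i).trans
      (pow_le_pow_right₀ (by linarith [norm_nonneg L]) hi')
  calc ‖x‖ ^ k * (n.choose i * ‖iteratedFDeriv ℝ i (fun z => Real.exp (L z)) x‖ *
        ‖iteratedFDeriv ℝ (n - i) f x‖)
      ≤ ‖x‖ ^ k * (n.choose i * (‖L‖ ^ i * Real.exp (L x)) * ‖iteratedFDeriv ℝ (n - i) f x‖) := by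
        gcongr
        exact norm_iteratedFDeriv_exp_le L i x
    _ = n.choose i * ‖L‖ ^ i * ‖x‖ ^ k * (Real.exp (L x) * ‖iteratedFDeriv ℝ (n - i) f x‖) := by
        ring
    _ ≤ n.choose i * ‖L‖ ^ i * ‖x‖ ^ k * (Real.exp b * ‖iteratedFDeriv ℝ (n - i) f x‖) := by
        gcongr
    _ = Real.exp b * ‖L‖ ^ i * (n.choose i * (‖x‖ ^ k * ‖iteratedFDeriv ℝ (n - i) f x‖)) := by
        ring
    _ ≤ Real.exp b * (1 + ‖L‖) ^ n * (n.choose i * SchwartzMap.seminorm ℂ k (n - i) f) := by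
        gcongr

/-- The product of a Schwartz function with an exponential `e^L` that is bounded on its support. -/
def expMul (L : V →L[ℝ] ℝ) (b : ℝ) (f : 𝓢(V, ℂ)) (hf : ∀ z, f z ≠ 0 → L z ≤ b) : 𝓢(V, ℂ) where
  toFun z := (Real.exp (L z) : ℂ) * f z
  smooth' := (Complex.ofRealCLM.contDiff.comp (Real.contDiff_exp.comp L.contDiff)).mul (f.smooth ⊤)
  decay' k n := ⟨_, fun x => norm_iteratedFDeriv_exp_mul_le L f hf k n x⟩

@[simp]
theorem expMul_apply (L : V →L[ℝ] ℝ) (b : ℝ) (f : 𝓢(V, ℂ)) (hf : ∀ z, f z ≠ 0 → L z ≤ b) (z : V) :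
    expMul L b f hf z = (Real.exp (L z) : ℂ) * f z := rfl

/-- The constant depends on n and f alone. When L later goes to infinity along a ray, only the
exponent b decides, since the rest is polynomial in ‖L‖. -/
theorem schwartzNorm_expMul_le (n : ℕ) (f : 𝓢(V, ℂ)) :
    ∃ C : ℝ, 0 ≤ C ∧ ∀ (L : V →L[ℝ] ℝ) (b : ℝ) (hf : ∀ z, f z ≠ 0 → L z ≤ b),
      schwartzNorm n (expMul L b f hf) ≤ C * (1 + ‖L‖) ^ n * Real.exp b := by
  set S : ℕ → ℕ → ℝ := fun k j => ∑ i ∈ Finset.range (j + 1),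
        (j.choose i : ℝ) * SchwartzMap.seminorm ℂ k (j - i) f with hS
  have hS0 : ∀ k j, 0 ≤ S k j := fun k j => Finset.sum_nonneg fun _ _ =>
    mul_nonneg (Nat.cast_nonneg _) (apply_nonneg _ _)
  refine ⟨∑ k ∈ Finset.range (n + 1), ∑ j ∈ Finset.range (n + 1), S k j,
    Finset.sum_nonneg fun _ _ => Finset.sum_nonneg fun _ _ => hS0 _ _, fun L b hf => ?_⟩
  rw [schwartzNorm, Finset.sum_mul, Finset.sum_mul]
  refine Finset.sum_le_sum fun k hk => ?_
  rw [Finset.sum_mul, Finset.sum_mul]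
  refine Finset.sum_le_sum fun j hj => ?_
  have hj' : j ≤ n := Nat.lt_succ_iff.1 (Finset.mem_range.1 hj)
  have h0 := hS0 k j
  refine SchwartzMap.seminorm_le_bound ℂ k j _ (by positivity) fun x => ?_
  refine (norm_iteratedFDeriv_exp_mul_le L f hf k j x).trans ?_
  have : (1 + ‖L‖) ^ j ≤ (1 + ‖L‖) ^ n := pow_le_pow_right₀ (by linarith [norm_nonneg L]) hj'
  calc Real.exp b * (1 + ‖L‖) ^ j * S k j ≤ Real.exp b * (1 + ‖L‖) ^ n * S k j := by gcongr
    _ = _ := by ring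

end Schwartz

/-! ### Contour shifts in one direction of V. -/

section Fourier

variable {V : Type*} [NormedAddCommGroup V] [InnerProductSpace ℝ V] [FiniteDimensional ℝ V]
  [MeasurableSpace V] [BorelSpace V]

theorem exists_pow_mul_norm_fourierInv_le (K : ℕ) :
    ∃ (n : ℕ) (C : ℝ), 0 ≤ C ∧ ∀ (f : 𝓢(V, ℂ)) (w : V),
      (1 + ‖w‖) ^ K * ‖(𝓕⁻ f) w‖ ≤ C * schwartzNorm n f := by
  set P : Seminorm ℂ 𝓢(V, ℂ) :=
    (Finset.Iic (K, 0)).sup fun m : ℕ × ℕ => SchwartzMap.seminorm ℂ m.1 m.2 with hP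
  set q : Seminorm ℂ 𝓢(V, ℂ) := P.comp
    (FourierTransform.fourierInvCLM ℂ 𝓢(V, ℂ)).toLinearMap with hq
  have hqc : Continuous q := by
    have h1 : Continuous P := by
      refine Finset.sup_induction (p := fun s : Seminorm ℂ 𝓢(V, ℂ) => Continuous s)
        continuous_const (fun s hs t ht => ?_)
        fun i _ => (schwartz_withSeminorms ℂ V ℂ).continuous_seminorm i
      rw [Seminorm.coe_sup]
      exact hs.sup ht
    exact h1.comp (FourierTransform.fourierInvCLM ℂ 𝓢(V, ℂ)).continuous
  obtain ⟨n, C, hC, h⟩ := exists_le_schwartzNorm q hqc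
  refine ⟨n, 2 ^ K * C, by positivity, fun f w => ?_⟩
  have h1 := SchwartzMap.one_add_le_sup_seminorm_apply (𝕜 := ℂ) (m := (K, 0)) (k := K) (n := 0)
    le_rfl le_rfl (𝓕⁻ f) w
  rw [norm_iteratedFDeriv_zero] at h1
  refine h1.trans ?_
  rw [mul_assoc]
  gcongr
  exact h f

theorem exists_pow_mul_norm_fourierInv_expMul_le (K : ℕ) (f : 𝓢(V, ℂ)) :
    ∃ (n : ℕ) (C : ℝ), 0 ≤ C ∧ ∀ (L : V →L[ℝ] ℝ) (b : ℝ) (hf : ∀ z, f z ≠ 0 → L z ≤ b) (w : V),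
      (1 + ‖w‖) ^ K * ‖(𝓕⁻ (expMul L b f hf)) w‖ ≤ C * (1 + ‖L‖) ^ n * Real.exp b := by
  obtain ⟨n, C, hC, h⟩ := exists_pow_mul_norm_fourierInv_le (V := V) K
  obtain ⟨C', hC', h'⟩ := schwartzNorm_expMul_le n f
  refine ⟨n, C * C', by positivity, fun L b hf w => (h _ w).trans ?_⟩
  rw [mul_assoc C C', mul_assoc C]
  gcongr
  exact h' L b hf

/-- Contour shift in a direction `v` for a function holomorphic in a strip with values dominated by
an integrable function. -/
theorem integral_eq_of_holomorphic_strip (v : V) {T : ℝ} (hT : 0 ≤ T) {N : V → ℝ → ℂ} {g : V → ℝ}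
    (hg : Integrable g) (hb : ∀ w, ∀ y ∈ Set.Icc 0 T, ‖N w y‖ ≤ g w)
    (h0 : Continuous fun w => N w 0) (h1 : Continuous fun w => N w T)
    (hc : ∀ w, ContinuousOn (fun ζ : ℂ => N (w + ζ.re • v) ζ.im) {ζ | ζ.im ∈ Set.Icc 0 T})
    (hd : ∀ w, DifferentiableOn ℂ (fun ζ : ℂ => N (w + ζ.re • v) ζ.im) {ζ | ζ.im ∈ Set.Ioo 0 T}) :
    ∫ w, N w 0 = ∫ w, N w T := by
  have hT' : T ∈ Set.Icc 0 T := ⟨hT, le_rfl⟩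
  have h0' : (0 : ℝ) ∈ Set.Icc 0 T := ⟨le_rfl, hT⟩
  have i0 : Integrable fun w => N w 0 :=
    hg.mono' h0.aestronglyMeasurable (Eventually.of_forall fun w => hb w 0 h0')
  have i1 : Integrable fun w => N w T :=
    hg.mono' h1.aestronglyMeasurable (Eventually.of_forall fun w => hb w T hT')
  set D : V → ℂ := fun w => N w 0 - N w T with hD
  have iD : Integrable D := i0.sub i1
  have cD : Continuous D := h0.sub h1
  have hg0 : ∀ w, 0 ≤ g w := fun w => (norm_nonneg _).trans (hb w 0 h0')
  -- By Cauchy's theorem on the rectangle [0, S] × [0, T], the integral of D along a segment equals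
  -- the contribution of the two vertical sides. No decay of N along individual lines is used.
  have side : ∀ S : ℝ, 0 < S → ∀ w,
      ‖∫ s in (0 : ℝ)..S, D (w + s • v)‖ ≤ T * (g (w + S • v) + g w) := by
    intro S hS w
    have hrect := Complex.integral_boundary_rect_eq_zero_of_continuousOn_of_differentiableOn
      (fun ζ : ℂ => N (w + ζ.re • v) ζ.im) 0 ⟨S, T⟩
      ((hc w).mono fun ζ hζ => by
        have := (Complex.mem_reProdIm.1 hζ).2
        simpa [Set.uIcc_of_le hT] using this)
      ((hd w).mono fun ζ hζ => by
        have := (Complex.mem_reProdIm.1 hζ).2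
        simpa [min_eq_left hT, max_eq_right hT] using this)
    simp only [Complex.zero_re, Complex.zero_im, Complex.add_re, Complex.ofReal_re, Complex.mul_re,
      Complex.I_re, mul_zero, Complex.ofReal_im, Complex.I_im, mul_one, sub_self, add_zero,
      Complex.add_im, Complex.mul_im, zero_add, smul_eq_mul, zero_smul] at hrect
    have iN : ∀ y ∈ Set.Icc 0 T, IntervalIntegrable (fun s : ℝ => N (w + s • v) y) volume 0 S := by
      intro y hy
      refine ContinuousOn.intervalIntegrable ?_
      have := (hc w).comp (t := {ζ | ζ.im ∈ Set.Icc 0 T}) (s := Set.univ)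
        (f := fun s : ℝ => (s : ℂ) + y * Complex.I) (by fun_prop) (fun s _ => by simpa using hy)
      simp only [Function.comp_def, Complex.add_re, Complex.ofReal_re, Complex.mul_re,
        Complex.I_re, mul_zero, Complex.ofReal_im, Complex.I_im, mul_one, sub_self, add_zero,
        Complex.add_im, Complex.mul_im, zero_add] at this
      exact this.mono (Set.subset_univ _)
    have hsplit : ∫ s in (0 : ℝ)..S, D (w + s • v) =
        (∫ s in (0 : ℝ)..S, N (w + s • v) 0) - ∫ s in (0 : ℝ)..S, N (w + s • v) T :=
      intervalIntegral.integral_sub (iN 0 h0') (iN T hT')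
    have e : ∫ s in (0 : ℝ)..S, D (w + s • v) =
        Complex.I * (∫ y in (0 : ℝ)..T, N w y) -
          Complex.I * ∫ y in (0 : ℝ)..T, N (w + S • v) y := by
      rw [hsplit]
      linear_combination hrect
    have bound : ∀ u, ‖Complex.I * ∫ y in (0 : ℝ)..T, N u y‖ ≤ T * g u := by
      intro u
      rw [norm_mul, Complex.norm_I, one_mul]
      have := intervalIntegral.norm_integral_le_of_norm_le_const (a := 0) (b := T) (C := g u)
        (f := fun y => N u y) (fun y hy => by
          rw [Set.uIoc_of_le hT] at hy
          exact hb u y ⟨hy.1.le, hy.2⟩)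
      rw [sub_zero, abs_of_nonneg hT] at this
      linarith
    rw [e]
    refine (norm_sub_le _ _).trans ?_
    have b1 := bound w
    have b2 := bound (w + S • v)
    linarith
  -- After integration over w, translation invariance turns the segment integral into S ∫ D, while
  -- the bound on the sides does not depend on S. Large S then forces ∫ D = 0.
  have main : ∀ S : ℝ, 0 < S → S * ‖∫ w, D w‖ ≤ 2 * T * ∫ w, g w := by
    intro S hS
    have iprod : Integrable (Function.uncurry fun (w : V) (s : ℝ) => D (w + s • v))
        (volume.prod (volume.restrict (Set.Ioc 0 S))) := by
      rw [integrable_prod_iff' (by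
        refine Continuous.aestronglyMeasurable ?_
        exact cD.comp (by fun_prop))]
      refine ⟨Eventually.of_forall fun s => ?_, ?_⟩
      · exact iD.comp_add_right (s • v)
      have : (fun s : ℝ => ∫ w, ‖Function.uncurry (fun (w : V) (s : ℝ) => D (w + s • v)) (w, s)‖) =
          fun _ => ∫ w, ‖D w‖ := by
        funext s
        exact integral_add_right_eq_self (fun w => ‖D w‖) (s • v)
      rw [this]
      exact integrable_const _
    have hswap := integral_integral_swap iprod
    have e1 : ∫ s in Set.Ioc 0 S, ∫ w, D (w + s • v) = S • ∫ w, D w := by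
      have : (fun s : ℝ => ∫ w, D (w + s • v)) = fun _ => ∫ w, D w := by
        funext s
        exact integral_add_right_eq_self D (s • v)
      rw [this, setIntegral_const]
      simp [hS.le]
    rw [e1] at hswap
    have ig : Integrable fun w => T * (g (w + S • v) + g w) :=
      ((hg.comp_add_right _).add hg).const_mul T
    calc S * ‖∫ w, D w‖ = ‖S • ∫ w, D w‖ := by rw [norm_smul, Real.norm_of_nonneg hS.le]
      _ = ‖∫ w, ∫ s in Set.Ioc 0 S, D (w + s • v)‖ := by rw [hswap]
      _ ≤ ∫ w, T * (g (w + S • v) + g w) := by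
          refine norm_integral_le_of_norm_le ig (Eventually.of_forall fun w => ?_)
          rw [← intervalIntegral.integral_of_le hS.le]
          exact side S hS w
      _ = 2 * T * ∫ w, g w := by
          rw [integral_const_mul, integral_add (hg.comp_add_right _) hg,
            integral_add_right_eq_self g]
          ring
  have hzero : ‖∫ w, D w‖ = 0 := by
    by_contra hne
    have hpos : 0 < ‖∫ w, D w‖ := lt_of_le_of_ne (norm_nonneg _) (Ne.symm hne)
    have hG : 0 ≤ ∫ w, g w := integral_nonneg hg0
    have := main ((2 * T * (∫ w, g w) + 1) / ‖∫ w, D w‖) (by positivity)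
    rw [div_mul_cancel₀ _ hne] at this
    linarith
  have h := norm_eq_zero.1 hzero
  rw [hD, integral_sub i0 i1, sub_eq_zero] at h
  exact h

end Fourier
end AttenuatedWave
end

/-! ### Fourier-Laplace transforms and a Paley-Wiener vanishing theorem. -/

noncomputable section

namespace AttenuatedWave

section ShiftFunctional

variable {V : Type*} [NormedAddCommGroup V] [InnerProductSpace ℝ V]

/-- The linear functional `z ↦ -2π y ⟪v, z⟫`. -/
def shiftFunctional (v : V) (y : ℝ) : V →L[ℝ] ℝ := (-(2 * Real.pi * y)) • innerSL ℝ v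

@[simp]
theorem shiftFunctional_apply (v : V) (y : ℝ) (z : V) :
    shiftFunctional v y z = -(2 * Real.pi * y) * ⟪v, z⟫ := rfl

theorem norm_shiftFunctional_le (v : V) {y : ℝ} (hy : 0 ≤ y) :
    ‖shiftFunctional v y‖ ≤ 2 * Real.pi * y * ‖v‖ := by
  have := Real.pi_pos
  rw [shiftFunctional, norm_smul, norm_neg, Real.norm_of_nonneg (by positivity), innerSL_apply_norm]

/-- The exponent is linear in y, so between 0 and T it is at most the larger of its end values. A
bound at T alone therefore controls the whole strip. -/
theorem shiftFunctional_le {v z : V} {T y b : ℝ} (h : shiftFunctional v T z ≤ b) (hy : 0 ≤ y)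
    (hyT : y ≤ T) : shiftFunctional v y z ≤ max 0 b := by
  have hpi := Real.pi_pos
  simp only [shiftFunctional_apply] at *
  by_cases hv : 0 ≤ ⟪v, z⟫
  · exact le_max_of_le_left (by nlinarith [mul_nonneg (mul_nonneg hpi.le hy) hv])
  · push Not at hv
    refine le_max_of_le_right (le_trans ?_ h)
    have : Real.pi * y ≤ Real.pi * T := by gcongr
    nlinarith

theorem norm_exp_fourierLaplace (v w z : V) (ζ : ℂ) :
    ‖Complex.exp (2 * Real.pi * Complex.I * (⟪z, w⟫ + ζ * ⟪z, v⟫))‖ =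
      Real.exp (shiftFunctional v ζ.im z) := by
  rw [Complex.norm_exp]
  congr 1
  rw [shiftFunctional_apply, real_inner_comm v z]
  simp [Complex.mul_re, Complex.mul_im]
  ring

end ShiftFunctional

section Shift

variable {V : Type*} [NormedAddCommGroup V] [InnerProductSpace ℝ V] [FiniteDimensional ℝ V]
  [MeasurableSpace V] [BorelSpace V]

/-- The weight e^{-2πy⟨v, z⟩} amounts to moving the frequency w to w + iyv. The right-hand side
makes the holomorphic dependence on ζ visible. -/
theorem fourierLaplace_eq (v w : V) (f : V → ℂ) (ζ : ℂ) :
    𝓕⁻ (fun z => (Real.exp (shiftFunctional v ζ.im z) : ℂ) * f z) (w + ζ.re • v) =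
      ∫ z, Complex.exp (2 * Real.pi * Complex.I * (⟪z, w⟫ + ζ * ⟪z, v⟫)) * f z := by
  rw [Real.fourierInv_eq']
  congr 1
  funext z
  rw [smul_eq_mul, ← mul_assoc, Complex.ofReal_exp, ← Complex.exp_add]
  congr 2
  have hζ : ζ = ζ.re + ζ.im * Complex.I := (Complex.re_add_im ζ).symm
  rw [shiftFunctional_apply, inner_add_right, inner_smul_right, real_inner_comm z v]
  conv_rhs => rw [hζ]
  push_cast
  linear_combination (-2 * Real.pi * ζ.im * (⟪z, v⟫ : ℂ)) * Complex.I_mul_I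

theorem continuousOn_fourierLaplace (v w : V) {T b : ℝ} (f : 𝓢(V, ℂ))
    (hf : ∀ z, f z ≠ 0 → shiftFunctional v T z ≤ b) :
    ContinuousOn (fun ζ : ℂ =>
      ∫ z, Complex.exp (2 * Real.pi * Complex.I * (⟪z, w⟫ + ζ * ⟪z, v⟫)) * f z)
      {ζ | ζ.im ∈ Set.Icc 0 T} := by
  refine continuousOn_of_dominated (bound := fun z => Real.exp (max 0 b) * ‖f z‖) ?_ ?_ ?_ ?_
  · intro ζ _
    refine Continuous.aestronglyMeasurable ?_
    exact Continuous.mul (by fun_prop) f.continuous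
  · intro ζ hζ
    refine Eventually.of_forall fun z => ?_
    rw [norm_mul, norm_exp_fourierLaplace]
    by_cases hz : f z = 0
    · simp [hz]
    · gcongr
      exact shiftFunctional_le (hf z hz) hζ.1 hζ.2
  · exact f.integrable.norm.const_mul _
  · refine Eventually.of_forall fun z => ?_
    fun_prop

theorem differentiableOn_fourierLaplace (v w : V) {T b : ℝ} (f : 𝓢(V, ℂ))
    (hf : ∀ z, f z ≠ 0 → shiftFunctional v T z ≤ b) :
    DifferentiableOn ℂ (fun ζ : ℂ =>
      ∫ z, Complex.exp (2 * Real.pi * Complex.I * (⟪z, w⟫ + ζ * ⟪z, v⟫)) * f z)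
      {ζ | ζ.im ∈ Set.Ioo 0 T} := by
  intro ζ₀ hζ₀
  have hpi := Real.pi_pos
  have hopen : IsOpen {ζ : ℂ | ζ.im ∈ Set.Ioo 0 T} := isOpen_Ioo.preimage Complex.continuous_im
  have hbd : ∀ z, ∀ ζ ∈ {ζ : ℂ | ζ.im ∈ Set.Ioo 0 T},
      ‖Complex.exp (2 * Real.pi * Complex.I * (⟪z, w⟫ + ζ * ⟪z, v⟫)) * f z‖ ≤
        Real.exp (max 0 b) * ‖f z‖ := by
    intro z ζ hζ
    rw [norm_mul, norm_exp_fourierLaplace]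
    by_cases hz : f z = 0
    · simp [hz]
    · gcongr
      exact shiftFunctional_le (hf z hz) hζ.1.le hζ.2.le
  have key := hasDerivAt_integral_of_dominated_loc_of_deriv_le (𝕜 := ℂ) (μ := (volume : Measure V))
    (s := {ζ : ℂ | ζ.im ∈ Set.Ioo 0 T}) (x₀ := ζ₀)
    (F := fun ζ z => Complex.exp (2 * Real.pi * Complex.I * (⟪z, w⟫ + ζ * ⟪z, v⟫)) * f z)
    (F' := fun ζ z => 2 * Real.pi * Complex.I * ⟪z, v⟫ *
      (Complex.exp (2 * Real.pi * Complex.I * (⟪z, w⟫ + ζ * ⟪z, v⟫)) * f z))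
    (bound := fun z => 2 * Real.pi * ‖v‖ * Real.exp (max 0 b) * (‖z‖ ^ 1 * ‖f z‖))
    (hopen.mem_nhds hζ₀) ?_ ?_ ?_ ?_ ?_ ?_
  · exact key.2.differentiableAt.differentiableWithinAt
  · refine Eventually.of_forall fun ζ => Continuous.aestronglyMeasurable ?_
    exact Continuous.mul (by fun_prop) f.continuous
  · refine (f.integrable.norm.const_mul (Real.exp (max 0 b))).mono' ?_
      (Eventually.of_forall fun z => hbd z ζ₀ hζ₀)
    refine Continuous.aestronglyMeasurable ?_
    exact Continuous.mul (by fun_prop) f.continuous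
  · refine Continuous.aestronglyMeasurable ?_
    exact Continuous.mul (by fun_prop) (Continuous.mul (by fun_prop) f.continuous)
  · refine Eventually.of_forall fun z ζ hζ => ?_
    rw [norm_mul]
    have h1 := hbd z ζ hζ
    have h2 : ‖2 * (Real.pi : ℂ) * Complex.I * ⟪z, v⟫‖ ≤ 2 * Real.pi * (‖z‖ * ‖v‖) := by
      rw [norm_mul, norm_mul, norm_mul, Complex.norm_I, Complex.norm_real, Complex.norm_real,
        Real.norm_of_nonneg hpi.le, mul_one]
      have := norm_inner_le_norm (𝕜 := ℝ) z v
      simp only [Complex.norm_ofNat]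
      gcongr
    calc _ ≤ 2 * Real.pi * (‖z‖ * ‖v‖) * (Real.exp (max 0 b) * ‖f z‖) := by gcongr
      _ = _ := by ring
  · exact (f.integrable_pow_mul volume 1).const_mul _
  · refine Eventually.of_forall fun z ζ _ => ?_
    have h1 : HasDerivAt (fun ζ : ℂ => 2 * Real.pi * Complex.I * (⟪z, w⟫ + ζ * ⟪z, v⟫))
        (2 * Real.pi * Complex.I * ⟪z, v⟫) ζ := by
      have := (((hasDerivAt_id ζ).mul_const (⟪z, v⟫ : ℂ)).const_add (⟪z, w⟫ : ℂ)).const_mul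
        (2 * Real.pi * Complex.I)
      simpa using this
    have h2 := (h1.cexp).mul_const (f z)
    exact h2.congr_deriv (by ring)

/-- Contour shift for a multiplier that is holomorphic in the direction `v`. -/
theorem integral_mul_fourierInv_eq_shift (v : V) {T : ℝ} (hT : 0 ≤ T) {M : V → ℝ → ℂ}
    (h0 : Continuous fun w => M w 0) (h1 : Continuous fun w => M w T)
    (hc : ∀ w, ContinuousOn (fun ζ : ℂ => M (w + ζ.re • v) ζ.im) {ζ | ζ.im ∈ Set.Icc 0 T})
    (hd : ∀ w, DifferentiableOn ℂ (fun ζ : ℂ => M (w + ζ.re • v) ζ.im) {ζ | ζ.im ∈ Set.Ioo 0 T})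
    {C : ℝ} {k : ℕ} (hb : ∀ w, ∀ y ∈ Set.Icc 0 T, ‖M w y‖ ≤ C * (1 + ‖w‖) ^ k)
    (f : 𝓢(V, ℂ)) {b : ℝ} (hf : ∀ z, f z ≠ 0 → shiftFunctional v T z ≤ b) :
    ∫ w, M w 0 * (𝓕⁻ f) w = ∫ w, M w T * (𝓕⁻ (expMul (shiftFunctional v T) b f hf)) w := by
  have hfy : ∀ y ∈ Set.Icc 0 T, ∀ z, f z ≠ 0 → shiftFunctional v y z ≤ max 0 b :=
    fun y hy z hz => shiftFunctional_le (hf z hz) hy.1 hy.2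
  set Φ : V → ℝ → ℂ := fun w y =>
    𝓕⁻ (fun z => (Real.exp (shiftFunctional v y z) : ℂ) * f z) w with hΦ
  have hΦy : ∀ y (hy : y ∈ Set.Icc 0 T) w,
      Φ w y = (𝓕⁻ (expMul (shiftFunctional v y) (max 0 b) f (hfy y hy))) w := fun y hy w => by
    rw [SchwartzMap.fourierInv_coe]; rfl
  have hΦT : ∀ w, Φ w T = (𝓕⁻ (expMul (shiftFunctional v T) b f hf)) w := fun w => by
    rw [SchwartzMap.fourierInv_coe]; rfl
  have hΦ0 : ∀ w, Φ w 0 = (𝓕⁻ f) w := fun w => by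
    rw [SchwartzMap.fourierInv_coe]; simp [hΦ]
  simp_rw [← hΦ0, ← hΦT]
  set d := Module.finrank ℝ V
  -- Of these powers of decay, k absorb the growth of M and d + 1 make the product integrable over
  -- V.
  obtain ⟨n, D, hD, hdec⟩ := exists_pow_mul_norm_fourierInv_expMul_le (k + (d + 1)) f
  have hC : 0 ≤ C := by
    have := (norm_nonneg _).trans (hb 0 0 ⟨le_rfl, hT⟩)
    simpa using this
  set K : ℝ := C * (D * (1 + 2 * Real.pi * T * ‖v‖) ^ n * Real.exp (max 0 b))
  refine integral_eq_of_holomorphic_strip v hT (N := fun w y => M w y * Φ w y)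
    (g := fun w => K * (1 + ‖w‖) ^ (-((d : ℝ) + 1))) ?_ ?_ ?_ ?_ ?_ ?_
  · exact (integrable_one_add_norm (by linarith)).const_mul K
  · intro w y hy
    rw [norm_mul, hΦy y hy]
    have e1 := hdec (shiftFunctional v y) (max 0 b) (hfy y hy) w
    have e2 : ‖shiftFunctional v y‖ ≤ 2 * Real.pi * T * ‖v‖ := by
      refine (norm_shiftFunctional_le v hy.1).trans ?_
      have := Real.pi_pos
      gcongr
      exact hy.2
    set a := ‖(𝓕⁻ (expMul (shiftFunctional v y) (max 0 b) f (hfy y hy))) w‖ with ha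
    have hw : 0 < 1 + ‖w‖ := by positivity
    have e3 : (1 + ‖w‖) ^ (-((d : ℝ) + 1)) = ((1 + ‖w‖) ^ (d + 1))⁻¹ := by
      rw [Real.rpow_neg hw.le, ← Real.rpow_natCast]; norm_cast
    rw [e3, ← div_eq_mul_inv, le_div_iff₀ (by positivity)]
    calc ‖M w y‖ * a * (1 + ‖w‖) ^ (d + 1)
        ≤ C * (1 + ‖w‖) ^ k * a * (1 + ‖w‖) ^ (d + 1) := by
          gcongr
          exact hb w y hy
      _ = C * ((1 + ‖w‖) ^ (k + (d + 1)) * a) := by rw [pow_add]; ring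
      _ ≤ C * (D * (1 + ‖shiftFunctional v y‖) ^ n * Real.exp (max 0 b)) := by gcongr
      _ ≤ K := by simp only [K]; gcongr
  · refine h0.mul ?_
    simp_rw [hΦ0]
    exact (𝓕⁻ f).continuous
  · refine h1.mul ?_
    simp_rw [hΦT]
    exact (𝓕⁻ (expMul (shiftFunctional v T) b f hf)).continuous
  · intro w
    refine (hc w).mul ?_
    simp_rw [hΦ, fourierLaplace_eq]
    exact continuousOn_fourierLaplace v w f hf
  · intro w
    refine (hd w).mul ?_
    simp_rw [hΦ, fourierLaplace_eq]
    exact differentiableOn_fourierLaplace v w f hf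

/-- Both n and D are fixed before M, L and b are chosen, so that a single estimate serves all shifts
at once. -/
theorem norm_integral_mul_fourierInv_expMul_le (f : 𝓢(V, ℂ)) (k : ℕ) :
    ∃ (n : ℕ) (D : ℝ), 0 ≤ D ∧ ∀ (M : V → ℂ) (C : ℝ), (∀ w, ‖M w‖ ≤ C * (1 + ‖w‖) ^ k) →
      ∀ (L : V →L[ℝ] ℝ) (b : ℝ) (hf : ∀ z, f z ≠ 0 → L z ≤ b),
        ‖∫ w, M w * (𝓕⁻ (expMul L b f hf)) w‖ ≤ C * D * (1 + ‖L‖) ^ n * Real.exp b := by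
  set d := Module.finrank ℝ V
  obtain ⟨n, D, hD, hdec⟩ := exists_pow_mul_norm_fourierInv_expMul_le (k + (d + 1)) f
  have hint : Integrable fun w : V => (1 + ‖w‖) ^ (-((d : ℝ) + 1)) :=
    integrable_one_add_norm (by linarith)
  set J := ∫ w : V, (1 + ‖w‖) ^ (-((d : ℝ) + 1)) with hJdef
  have hJ : 0 ≤ J := by
    refine integral_nonneg fun w => ?_
    exact Real.rpow_nonneg (by positivity) _
  refine ⟨n, D * J, by positivity, fun M C hM L b hf => ?_⟩
  have hC : 0 ≤ C := by
    have := (norm_nonneg _).trans (hM 0)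
    simpa using this
  have : ‖∫ w, M w * (𝓕⁻ (expMul L b f hf)) w‖ ≤
      ∫ w : V, (C * (D * (1 + ‖L‖) ^ n * Real.exp b)) * (1 + ‖w‖) ^ (-((d : ℝ) + 1)) := by
    refine norm_integral_le_of_norm_le (hint.const_mul _) (Eventually.of_forall fun w => ?_)
    rw [norm_mul]
    have hw : 0 < 1 + ‖w‖ := by positivity
    have e3 : (1 + ‖w‖) ^ (-((d : ℝ) + 1)) = ((1 + ‖w‖) ^ (d + 1))⁻¹ := by
      rw [Real.rpow_neg hw.le, ← Real.rpow_natCast]; norm_cast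
    rw [e3, ← div_eq_mul_inv, le_div_iff₀ (by positivity)]
    calc ‖M w‖ * ‖(𝓕⁻ (expMul L b f hf)) w‖ * (1 + ‖w‖) ^ (d + 1)
        ≤ C * (1 + ‖w‖) ^ k * ‖(𝓕⁻ (expMul L b f hf)) w‖ * (1 + ‖w‖) ^ (d + 1) := by
          gcongr
          exact hM w
      _ = C * ((1 + ‖w‖) ^ (k + (d + 1)) * ‖(𝓕⁻ (expMul L b f hf)) w‖) := by rw [pow_add]; ring
      _ ≤ C * (D * (1 + ‖L‖) ^ n * Real.exp b) :=
          mul_le_mul_of_nonneg_left (hdec L b hf w) hC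
  refine this.trans (le_of_eq ?_)
  rw [integral_const_mul]
  ring

/-- A Paley-Wiener type vanishing theorem: the multiplier is holomorphic and polynomially bounded in
a half space and the function is supported in the opposite one. -/
theorem integral_mul_fourierInv_eq_zero (v : V) {M : V → ℝ → ℂ}
    (hM : ∀ y, 0 ≤ y → Continuous fun w => M w y)
    (hc : ∀ w, ContinuousOn (fun ζ : ℂ => M (w + ζ.re • v) ζ.im) {ζ | 0 ≤ ζ.im})
    (hd : ∀ w, DifferentiableOn ℂ (fun ζ : ℂ => M (w + ζ.re • v) ζ.im) {ζ | 0 < ζ.im})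
    {C a δ : ℝ} {k : ℕ} (had : a < δ)
    (hb : ∀ w y, 0 ≤ y → ‖M w y‖ ≤
      C * (1 + ‖w‖) ^ k * (1 + y) ^ k * Real.exp (2 * Real.pi * y * a))
    (f : 𝓢(V, ℂ)) (hf : ∀ z, f z ≠ 0 → δ ≤ ⟪v, z⟫) :
    ∫ w, M w 0 * (𝓕⁻ f) w = 0 := by
  have hpi := Real.pi_pos
  obtain ⟨n, D, hD, hdec⟩ := norm_integral_mul_fourierInv_expMul_le f k
  have hC : 0 ≤ C := by
    have := (norm_nonneg _).trans (hb 0 0 le_rfl)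
    simpa using this
  have hfT : ∀ T : ℝ, 0 ≤ T → ∀ z, f z ≠ 0 → shiftFunctional v T z ≤ -(2 * Real.pi * T) * δ := by
    intro T hT z hz
    rw [shiftFunctional_apply]
    have := hf z hz
    have h2 : 0 ≤ 2 * Real.pi * T := by positivity
    nlinarith
  set K : ℝ := C * D * (1 + 2 * Real.pi * ‖v‖) ^ n with hK
  -- After a shift by T the multiplier costs e^{2πTa} and the weight on the support of f gains
  -- e^{-2πTδ}. Everything else is polynomial in T, so a < δ makes the bound tend to 0.
  have main : ∀ T : ℝ, 0 ≤ T → ‖∫ w, M w 0 * (𝓕⁻ f) w‖ ≤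
      K * ((1 + T) ^ (k + n) * Real.exp (-(2 * Real.pi * (δ - a)) * (1 + T))) *
        Real.exp (2 * Real.pi * (δ - a)) := by
    intro T hT
    have hbT : ∀ w, ∀ y ∈ Set.Icc 0 T, ‖M w y‖ ≤
        (C * (1 + T) ^ k * Real.exp (2 * Real.pi * T * |a|)) * (1 + ‖w‖) ^ k := by
      intro w y hy
      refine (hb w y hy.1).trans ?_
      have e1 : 2 * Real.pi * y * a ≤ 2 * Real.pi * T * |a| := by
        have h3 := le_abs_self a
        have h4 : 2 * Real.pi * y ≤ 2 * Real.pi * T := by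
          have := hy.2
          gcongr
        have h5 : 0 ≤ 2 * Real.pi * y := by have := hy.1; positivity
        calc 2 * Real.pi * y * a ≤ 2 * Real.pi * y * |a| := by gcongr
          _ ≤ _ := by gcongr
      have hy1 := hy.1
      have hy2 := hy.2
      calc C * (1 + ‖w‖) ^ k * (1 + y) ^ k * Real.exp (2 * Real.pi * y * a)
          ≤ C * (1 + ‖w‖) ^ k * (1 + T) ^ k * Real.exp (2 * Real.pi * T * |a|) := by gcongr
        _ = _ := by ring
    rw [integral_mul_fourierInv_eq_shift v hT (hM 0 le_rfl) (hM T hT)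
      (fun w => (hc w).mono fun ζ hζ => hζ.1) (fun w => (hd w).mono fun ζ hζ => hζ.1) hbT f
      (hfT T hT)]
    have h1 := hdec (fun w => M w T) (C * (1 + T) ^ k * Real.exp (2 * Real.pi * T * a))
      (fun w => (hb w T hT).trans (le_of_eq (by ring))) (shiftFunctional v T) _ (hfT T hT)
    refine h1.trans ?_
    have h2 : 1 + ‖shiftFunctional v T‖ ≤ (1 + 2 * Real.pi * ‖v‖) * (1 + T) := by
      have := norm_shiftFunctional_le v hT
      have h3 : 0 ≤ 2 * Real.pi * ‖v‖ := by positivity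
      nlinarith
    have h3 : Real.exp (2 * Real.pi * T * a) * Real.exp (-(2 * Real.pi * T) * δ) =
        Real.exp (-(2 * Real.pi * (δ - a)) * (1 + T)) * Real.exp (2 * Real.pi * (δ - a)) := by
      rw [← Real.exp_add, ← Real.exp_add]
      congr 1
      ring
    calc C * (1 + T) ^ k * Real.exp (2 * Real.pi * T * a) * D * (1 + ‖shiftFunctional v T‖) ^ n *
          Real.exp (-(2 * Real.pi * T) * δ)
        = C * D * (1 + T) ^ k * (1 + ‖shiftFunctional v T‖) ^ n *
          (Real.exp (2 * Real.pi * T * a) * Real.exp (-(2 * Real.pi * T) * δ)) := by ring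
      _ ≤ C * D * (1 + T) ^ k * ((1 + 2 * Real.pi * ‖v‖) * (1 + T)) ^ n *
          (Real.exp (2 * Real.pi * T * a) * Real.exp (-(2 * Real.pi * T) * δ)) := by gcongr
      _ = _ := by rw [h3, hK, mul_pow, pow_add]; ring
  have hlim : Tendsto (fun T : ℝ => K * ((1 + T) ^ (k + n) *
      Real.exp (-(2 * Real.pi * (δ - a)) * (1 + T))) * Real.exp (2 * Real.pi * (δ - a))) atTop
      (𝓝 (K * 0 * Real.exp (2 * Real.pi * (δ - a)))) := by
    refine Tendsto.mul_const _ (Tendsto.const_mul _ ?_)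
    have h := tendsto_rpow_mul_exp_neg_mul_atTop_nhds_zero (k + n : ℕ) (2 * Real.pi * (δ - a))
      (by have : 0 < δ - a := by linarith
          positivity)
    have h' := h.comp (tendsto_atTop_add_const_left atTop (1 : ℝ) tendsto_id)
    refine h'.congr fun T => ?_
    simp only [Function.comp_apply, id, Real.rpow_natCast]
  have := ge_of_tendsto hlim (by
    filter_upwards [eventually_ge_atTop 0] with T hT
    exact main T hT)
  simpa using this

end Shift
end AttenuatedWave
end

/-! ### Temperate growth of reciprocals and of holomorphic functions on horizontal lines. -/

noncomputable section

namespace AttenuatedWave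

/-- On the open half-line (c/2, ∞), which contains the range of f, inversion has bounded derivatives
of every order. -/
theorem hasTemperateGrowth_real_inv {V : Type*} [NormedAddCommGroup V] [NormedSpace ℝ V]
    {f : V → ℝ} (hf : f.HasTemperateGrowth) {c : ℝ} (hc : 0 < c) (hfc : ∀ x, c ≤ f x) :
    (fun x => (f x)⁻¹).HasTemperateGrowth := by
  have hopen : IsOpen (Set.Ioi (c / 2)) := isOpen_Ioi
  have hne : ∀ x ∈ Set.Ioi (c / 2), x ≠ 0 := fun x hx => by
    have : c / 2 < x := hx
    linarith
  refine Function.HasTemperateGrowth.comp' (g := fun x : ℝ => x⁻¹) (t := Set.Ioi (c / 2)) ?_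
    hopen.uniqueDiffOn (contDiffOn_id.inv hne) (fun N => ?_) hf
  · rintro _ ⟨x, rfl⟩
    have := hfc x
    change c / 2 < f x
    linarith
  · set m : ℝ := max 1 (2 / c)
    have hm : 1 ≤ m := le_max_left _ _
    refine ⟨0, N.factorial * m ^ (N + 1), by positivity, fun n hn x hx => ?_⟩
    have hx' : c / 2 < x := hx
    have hx0 : 0 < x := by linarith
    rw [norm_iteratedFDerivWithin_eq_norm_iteratedDerivWithin,
      iteratedDerivWithin_of_isOpen hopen hx, iteratedDeriv_eq_iterate, iter_deriv_inv']
    have h1 : ‖(-1 : ℝ) ^ n * n.factorial * x ^ (-1 - n : ℤ)‖ = n.factorial * (x⁻¹) ^ (n + 1) := by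
      rw [norm_mul, norm_mul, norm_pow, norm_neg, norm_one, one_pow, one_mul, Real.norm_natCast,
        norm_zpow, Real.norm_of_nonneg hx0.le, inv_pow, ← zpow_natCast, ← zpow_neg]
      congr 2
      push_cast
      ring
    rw [h1, pow_zero, mul_one]
    have h2 : x⁻¹ ≤ m := by
      refine le_trans ?_ (le_max_right _ _)
      rw [inv_le_comm₀ hx0 (by positivity), inv_div]
      exact hx'.le
    have h3 : (n.factorial : ℝ) ≤ N.factorial := by exact_mod_cast Nat.factorial_le hn
    calc (n.factorial : ℝ) * x⁻¹ ^ (n + 1) ≤ N.factorial * m ^ (n + 1) := by gcongr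
      _ ≤ _ := by gcongr

/-- The identity 1/f = conj f / |f|² reduces this to the real case. -/
theorem hasTemperateGrowth_inv {V : Type*} [NormedAddCommGroup V] [NormedSpace ℝ V]
    {f : V → ℂ} (hf : f.HasTemperateGrowth) {c : ℝ} (hc : 0 < c) (hfc : ∀ x, c ≤ ‖f x‖) :
    (fun x => (f x)⁻¹).HasTemperateGrowth := by
  have hre : (fun x => (f x).re).HasTemperateGrowth :=
    Complex.reCLM.hasTemperateGrowth.comp hf
  have him : (fun x => (f x).im).HasTemperateGrowth :=
    Complex.imCLM.hasTemperateGrowth.comp hf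
  have hconj : (fun x => (starRingEnd ℂ) (f x)).HasTemperateGrowth :=
    (Complex.conjCLE.toContinuousLinearMap).hasTemperateGrowth.comp hf
  have hsq : (fun x => (f x).re ^ 2 + (f x).im ^ 2).HasTemperateGrowth :=
    (hre.pow 2).add (him.pow 2)
  have h := hasTemperateGrowth_real_inv hsq (c := c ^ 2) (by positivity) (fun x => by
    have := hfc x
    have h2 : (f x).re ^ 2 + (f x).im ^ 2 = ‖f x‖ ^ 2 := by
      rw [← Complex.normSq_eq_norm_sq, Complex.normSq_apply]; ring
    rw [h2]
    gcongr)
  have h' := Complex.ofRealCLM.hasTemperateGrowth.comp h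
  have e : (fun x => (f x)⁻¹) = (fun x => (starRingEnd ℂ) (f x)) *
      (Complex.ofRealCLM ∘ fun x => ((f x).re ^ 2 + (f x).im ^ 2)⁻¹) := by
    funext x
    simp only [Pi.mul_apply, Function.comp_apply]
    rw [Complex.inv_def, Complex.normSq_apply, sq, sq]
    rfl
  rw [e]
  exact hconj.mul h'

/-- Cauchy's estimates on discs of radius η/2 centred on the line Im z = η, which stay inside the
half plane. The assumption on κ controls derivatives only on the real line; this supplies the lines
above it. -/
theorem hasTemperateGrowth_of_holomorphic {F : ℂ → ℂ} (hd : DifferentiableOn ℂ F {z | 0 < z.im})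
    {C : ℝ} {N : ℕ} (hC : 0 ≤ C) (hb : ∀ z : ℂ, 0 ≤ z.im → ‖F z‖ ≤ C * (1 + ‖z‖) ^ N) {η : ℝ}
    (hη : 0 < η) : (fun ω : ℝ => F (ω + η * Complex.I)).HasTemperateGrowth := by
  have hopen : IsOpen {z : ℂ | 0 < z.im} := isOpen_lt continuous_const Complex.continuous_im
  have hda : ∀ n : ℕ, ∀ z : ℂ, 0 < z.im → DifferentiableAt ℂ (iteratedDeriv n F) z := by
    intro n z hz
    have h1 : AnalyticAt ℂ F z := hd.analyticAt (hopen.mem_nhds hz)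
    have h2 : AnalyticAt ℂ (deriv^[n] F) z := h1.iterated_deriv n
    rw [iteratedDeriv_eq_iterate]
    exact h2.differentiableAt
  have him : ∀ ω : ℝ, 0 < ((ω : ℂ) + η * Complex.I).im := fun ω => by simpa using hη
  have hder : ∀ (n : ℕ) (ω : ℝ), HasDerivAt
      (fun ω : ℝ => iteratedDeriv n F (ω + η * Complex.I))
      (iteratedDeriv (n + 1) F (ω + η * Complex.I)) ω := by
    intro n ω
    have h1 := (hda n _ (him ω)).hasDerivAt
    rw [← iteratedDeriv_succ] at h1
    have h2 : HasDerivAt (fun ω : ℝ => (ω : ℂ) + η * Complex.I) 1 ω :=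
      (Complex.ofRealCLM.hasDerivAt (x := ω)).add_const _
    have := h1.comp ω h2
    simpa [Function.comp_def] using this
  have hit : ∀ n : ℕ, iteratedDeriv n (fun ω : ℝ => F (ω + η * Complex.I)) =
      fun ω : ℝ => iteratedDeriv n F (ω + η * Complex.I) := by
    intro n
    induction n with
    | zero => funext ω; simp
    | succ n ih =>
      rw [iteratedDeriv_succ, ih]
      funext ω
      exact (hder n ω).deriv
  refine ⟨?_, fun n => ?_⟩
  · refine contDiff_of_differentiable_iteratedDeriv fun n _ => ?_
    rw [hit]
    exact fun ω => (hder n ω).differentiableAt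
  · refine ⟨N, n.factorial * (C * (1 + 2 * η) ^ N) / (η / 2) ^ n, fun ω => ?_⟩
    rw [norm_iteratedFDeriv_eq_norm_iteratedDeriv, hit]
    set c : ℂ := (ω : ℂ) + η * Complex.I with hcdef
    have hball : ∀ z ∈ Metric.closedBall c (η / 2), 0 < z.im := by
      intro z hz
      have h1 := (Complex.abs_im_le_norm (z - c)).trans (mem_closedBall_iff_norm.1 hz)
      have h2 : c.im = η := by simp [hcdef]
      rw [Complex.sub_im, h2, abs_le] at h1
      linarith [h1.1]
    have hdc : DiffContOnCl ℂ F (Metric.ball c (η / 2)) := by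
      refine DifferentiableOn.diffContOnCl ?_
      rw [closure_ball _ (by positivity)]
      exact hd.mono hball
    have hbd : ∀ z ∈ Metric.sphere c (η / 2), ‖F z‖ ≤ C * ((1 + 2 * η) * (1 + ‖ω‖)) ^ N := by
      intro z hz
      have hz' := Metric.sphere_subset_closedBall hz
      refine (hb z (hball z hz').le).trans ?_
      have h1 : ‖z‖ ≤ ‖ω‖ + 2 * η := by
        have a1 := mem_closedBall_iff_norm.1 hz'
        have a2 : ‖c‖ ≤ ‖ω‖ + η := by
          refine (norm_add_le _ _).trans ?_
          rw [norm_mul, Complex.norm_I, mul_one, Complex.norm_real, Complex.norm_real,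
            Real.norm_of_nonneg hη.le]
        have a3 : ‖z‖ ≤ ‖z - c‖ + ‖c‖ := by simpa using norm_add_le (z - c) c
        linarith
      have h2 : 1 + ‖z‖ ≤ (1 + 2 * η) * (1 + ‖ω‖) := by
        nlinarith [norm_nonneg ω]
      gcongr
    have := Complex.norm_iteratedDeriv_le_of_forall_mem_sphere_norm_le n (by positivity) hdc hbd
    refine this.trans (le_of_eq ?_)
    rw [mul_pow]
    ring

end AttenuatedWave
end

/-! ### Vanishing of a tempered distribution off its support. -/

noncomputable section

namespace AttenuatedWave

section Support

variable {V : Type*} [NormedAddCommGroup V] [InnerProductSpace ℝ V] [FiniteDimensional ℝ V]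

/-- A smooth bump function as a Schwartz function. -/
def bumpSchwartz {x : V} (f : ContDiffBump x) : 𝓢(V, ℂ) :=
  (f.hasCompactSupport.comp_left (g := Complex.ofReal) rfl).toSchwartzMap
    (Complex.ofRealCLM.contDiff.comp f.contDiff)

@[simp]
theorem bumpSchwartz_apply {x : V} (f : ContDiffBump x) (z : V) :
    bumpSchwartz f z = (f z : ℂ) := rfl

/-- Finitely many balls on which p vanishes cover the support of θ. Multiplying by 1 minus a bump,
ball after ball, erases θ without changing p θ. -/
theorem apply_eq_zero_of_hasCompactSupport {p : 𝓢'(V, ℂ)} {θ : 𝓢(V, ℂ)}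
    (hθ : HasCompactSupport θ) (hd : Disjoint (tsupport θ) (Distribution.dsupport p)) :
    p θ = 0 := by
  have hex : ∀ x ∈ tsupport θ, ∃ ε : ℝ, 0 < ε ∧
      Distribution.IsVanishingOn p (Metric.ball x ε) := by
    intro x hx
    have h1 : x ∉ Distribution.dsupport p := Set.disjoint_left.1 hd hx
    rw [Distribution.notMem_dsupport_iff] at h1
    obtain ⟨s, hs, hso, hxs⟩ := h1
    obtain ⟨ε, hε, hball⟩ := Metric.isOpen_iff.1 hso x hxs
    exact ⟨ε, hε, hs.mono hball⟩
  choose! ε hε hvan using hex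
  obtain ⟨t, ht, hcover⟩ := hθ.isCompact.elim_nhds_subcover (fun x => Metric.ball x (ε x / 3))
    (fun x hx => Metric.ball_mem_nhds x (by have := hε x hx; positivity))
  have key : ∀ s : Finset V, s ⊆ t → ∃ θ' : 𝓢(V, ℂ), p θ' = p θ ∧
      (∀ z, θ z = 0 → θ' z = 0) ∧ ∀ x ∈ s, ∀ z ∈ Metric.ball x (ε x / 3), θ' z = 0 := by
    classical
    intro s
    induction s using Finset.induction_on with
    | empty => exact fun _ => ⟨θ, rfl, fun _ h => h, by simp⟩
    | insert a s ha ih =>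
      intro hst
      obtain ⟨θ', hp, h0, hs⟩ := ih ((Finset.subset_insert a s).trans hst)
      have hεa := hε a (ht a (hst (Finset.mem_insert_self a s)))
      -- The bump is 1 on the covering ball of radius ε/3, and its closed support lies in the ball
      -- of radius ε where p vanishes.
      let f : ContDiffBump a := ⟨ε a / 3, ε a / 2, by positivity, by linarith⟩
      set g := SchwartzMap.smulLeftCLM ℂ (bumpSchwartz f) θ' with hg
      have hgz : ∀ z, g z = (f z : ℂ) * θ' z := fun z =>
        SchwartzMap.smulLeftCLM_apply_apply (bumpSchwartz f).hasTemperateGrowth θ' z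
      refine ⟨θ' - g, ?_, ?_, ?_⟩
      · have : p g = 0 := by
          refine hvan a (ht a (hst (Finset.mem_insert_self a s))) g ?_
          have h1 : tsupport g ⊆ tsupport f := by
            refine closure_mono fun z hz => ?_
            intro hfz
            apply hz
            rw [hgz, hfz]
            simp
          refine h1.trans ?_
          rw [f.tsupport_eq]
          exact Metric.closedBall_subset_ball (by change ε a / 2 < ε a; linarith)
        rw [map_sub, this, sub_zero, hp]
      · intro z hz
        rw [sub_apply, hgz, h0 z hz]
        simp
      · intro x hx z hz
        rw [sub_apply, hgz]
        rcases Finset.mem_insert.1 hx with rfl | hx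
        · rw [f.one_of_mem_closedBall (Metric.ball_subset_closedBall hz)]
          simp
        · rw [hs x hx z hz]
          simp
  obtain ⟨θ', hp, h0, hs⟩ := key t subset_rfl
  have : θ' = 0 := by
    ext z
    by_cases hz : θ z = 0
    · simpa using h0 z hz
    · have hz' : z ∈ tsupport θ := subset_tsupport _ hz
      obtain ⟨x, hx, hzx⟩ := Set.mem_iUnion₂.1 (hcover hz')
      simpa using hs x hx z hzx
  rw [← hp, this, map_zero]

/-- The error lives where ‖x‖ ≥ R, and there one additional power of ‖x‖ in the seminorms is worth a
factor 1/R. Dilation by R ≥ 1 does not enlarge the derivatives of the cutoff. -/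
theorem exists_cutoff_schwartzNorm_le (θ : 𝓢(V, ℂ)) (N : ℕ) :
    ∃ C : ℝ, ∀ R : ℝ, 1 ≤ R → ∃ θ' : 𝓢(V, ℂ), HasCompactSupport θ' ∧ tsupport θ' ⊆ tsupport θ ∧
      schwartzNorm N (θ - θ') ≤ C / R := by
  let φ : ContDiffBump (0 : V) := ⟨1, 2, one_pos, one_lt_two⟩
  set φS := bumpSchwartz φ with hφS
  set B : ℕ → ℕ → ℝ := fun k j => SchwartzMap.seminorm ℂ (k + 1) j θ +
    ∑ i ∈ Finset.range (j + 1), (j.choose i : ℝ) * SchwartzMap.seminorm ℂ 0 i φS *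
      SchwartzMap.seminorm ℂ (k + 1) (j - i) θ with hB
  have hB0 : ∀ k j, 0 ≤ B k j := fun k j => add_nonneg (apply_nonneg _ _) <|
    Finset.sum_nonneg fun _ _ => mul_nonneg (mul_nonneg (Nat.cast_nonneg _) (apply_nonneg _ _))
      (apply_nonneg _ _)
  refine ⟨∑ k ∈ Finset.range (N + 1), ∑ j ∈ Finset.range (N + 1), B k j, fun R hR => ?_⟩
  have hR0 : 0 < R := by linarith
  set L : V →L[ℝ] V := R⁻¹ • ContinuousLinearMap.id ℝ V with hL
  have hLz : ∀ z, L z = R⁻¹ • z := fun z => rfl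
  have hLn : ‖L‖ ≤ 1 := by
    rw [hL, norm_smul, norm_inv, Real.norm_of_nonneg hR0.le]
    have h1 := ContinuousLinearMap.norm_id_le (𝕜 := ℝ) (E := V)
    have h2 : R⁻¹ ≤ 1 := inv_le_one_of_one_le₀ hR
    have h3 : 0 ≤ R⁻¹ := by positivity
    nlinarith [norm_nonneg (ContinuousLinearMap.id ℝ V)]
  have hχ : (fun z => φS (L z)).HasTemperateGrowth :=
    φS.hasTemperateGrowth.comp L.hasTemperateGrowth
  set θ' := SchwartzMap.smulLeftCLM ℂ (fun z => φS (L z)) θ with hθ'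
  have hθ'z : ∀ z, θ' z = φS (L z) * θ z := fun z =>
    SchwartzMap.smulLeftCLM_apply_apply hχ θ z
  refine ⟨θ', ?_, ?_, ?_⟩
  · refine HasCompactSupport.intro (isCompact_closedBall (0 : V) (2 * R)) fun z hz => ?_
    rw [hθ'z, bumpSchwartz_apply, φ.zero_of_le_dist, Complex.ofReal_zero, zero_mul]
    rw [mem_closedBall_zero_iff, not_le] at hz
    rw [dist_zero_right, hLz, norm_smul, norm_inv, Real.norm_of_nonneg hR0.le, inv_mul_eq_div,
      le_div_iff₀ hR0]
    exact hz.le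
  · refine closure_mono fun z hz hz' => hz ?_
    rw [hθ'z, hz', mul_zero]
  · rw [schwartzNorm, Finset.sum_div]
    refine Finset.sum_le_sum fun k _ => ?_
    rw [Finset.sum_div]
    refine Finset.sum_le_sum fun j _ => ?_
    have hBkj := hB0 k j
    refine SchwartzMap.seminorm_le_bound ℂ k j _ (by positivity) fun x => ?_
    rcases lt_or_ge ‖x‖ R with hx | hx
    · have hev : (⇑(θ - θ')) =ᶠ[𝓝 x] fun _ => 0 := by
        have : ∀ᶠ y in 𝓝 x, ‖y‖ < R := continuous_norm.continuousAt.eventually_lt_const hx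
        filter_upwards [this] with y hy
        rw [sub_apply, hθ'z, bumpSchwartz_apply, φ.one_of_mem_closedBall]
        · simp
        · rw [mem_closedBall_zero_iff, hLz, norm_smul, norm_inv, Real.norm_of_nonneg hR0.le,
            inv_mul_eq_div, div_le_one hR0]
          exact hy.le
      rw [(hev.iteratedFDeriv ℝ j).eq_of_nhds]
      have : iteratedFDeriv ℝ j (fun _ : V => (0 : ℂ)) x = 0 := by
        have := iteratedFDeriv_fun_zero (𝕜 := ℝ) (E := V) (F := ℂ) (n := j)
        rw [this]; rfl
      rw [this, norm_zero, mul_zero]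
      positivity
    · have hdecay : ∀ i, ‖x‖ ^ k * ‖iteratedFDeriv ℝ i θ x‖ ≤
          SchwartzMap.seminorm ℂ (k + 1) i θ / R := by
        intro i
        rw [le_div_iff₀ hR0]
        refine le_trans ?_ (SchwartzMap.le_seminorm ℂ (k + 1) i θ x)
        rw [pow_succ]
        calc ‖x‖ ^ k * ‖iteratedFDeriv ℝ i θ x‖ * R = ‖x‖ ^ k * R * ‖iteratedFDeriv ℝ i θ x‖ := by
              ring
          _ ≤ _ := by gcongr
      have hsub : iteratedFDeriv ℝ j (⇑(θ - θ')) x =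
          iteratedFDeriv ℝ j θ x - iteratedFDeriv ℝ j θ' x := by
        have e : (⇑(θ - θ')) = ⇑θ - ⇑θ' := by ext; simp
        rw [e]
        exact iteratedFDeriv_sub_apply ((θ.smooth j).contDiffAt) ((θ'.smooth j).contDiffAt)
      have hprod := norm_iteratedFDeriv_smul_le (𝕜 := ℝ) (f := fun z => φS (L z)) (g := θ)
        ((φS.smooth (⊤ : ℕ∞)).comp L.contDiff) (θ.smooth ⊤) x (n := j) (mod_cast le_top)
      have hχi : ∀ i, ‖iteratedFDeriv ℝ i (fun z => φS (L z)) x‖ ≤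
          SchwartzMap.seminorm ℂ 0 i φS := by
        intro i
        have h := L.iteratedFDeriv_comp_right (φS.smooth (⊤ : ℕ∞)) x (i := i) (mod_cast le_top)
        have e : (φS ∘ L) = fun z => φS (L z) := rfl
        rw [← e, h]
        refine (ContinuousMultilinearMap.norm_compContinuousLinearMap_le _ _).trans ?_
        refine (mul_le_of_le_one_right (norm_nonneg _) ?_).trans
          (SchwartzMap.norm_iteratedFDeriv_le_seminorm ℂ φS i (L x))
        exact Finset.prod_le_one (fun _ _ => norm_nonneg _) fun _ _ => hLn
      have eθ' : (⇑θ') = fun z => φS (L z) • θ z := by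
        funext z; rw [hθ'z, smul_eq_mul]
      rw [hsub, eθ']
      calc ‖x‖ ^ k * ‖iteratedFDeriv ℝ j θ x - iteratedFDeriv ℝ j (fun z => φS (L z) • θ z) x‖
          ≤ ‖x‖ ^ k * (‖iteratedFDeriv ℝ j θ x‖ + ∑ i ∈ Finset.range (j + 1), (j.choose i : ℝ) *
            SchwartzMap.seminorm ℂ 0 i φS * ‖iteratedFDeriv ℝ (j - i) θ x‖) := by
            refine mul_le_mul_of_nonneg_left ((norm_sub_le _ _).trans ?_) (by positivity)
            refine add_le_add_right (hprod.trans (Finset.sum_le_sum fun i _ => ?_)) _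
            gcongr
            exact hχi i
        _ = ‖x‖ ^ k * ‖iteratedFDeriv ℝ j θ x‖ + ∑ i ∈ Finset.range (j + 1), (j.choose i : ℝ) *
            SchwartzMap.seminorm ℂ 0 i φS * (‖x‖ ^ k * ‖iteratedFDeriv ℝ (j - i) θ x‖) := by
            rw [mul_add, Finset.mul_sum]
            congr 1
            refine Finset.sum_congr rfl fun i _ => by ring
        _ ≤ SchwartzMap.seminorm ℂ (k + 1) j θ / R + ∑ i ∈ Finset.range (j + 1), (j.choose i : ℝ) *
            SchwartzMap.seminorm ℂ 0 i φS * (SchwartzMap.seminorm ℂ (k + 1) (j - i) θ / R) := by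
            refine add_le_add (hdecay j) (Finset.sum_le_sum fun i _ => ?_)
            refine mul_le_mul_of_nonneg_left (hdecay _)
              (mul_nonneg (Nat.cast_nonneg _) (apply_nonneg _ _))
        _ = B k j / R := by
            rw [hB, add_div, Finset.sum_div]
            congr 1
            refine Finset.sum_congr rfl fun i _ => by ring

/-- Cutoffs keep the closed support inside that of θ, so disjointness suffices and no positive
distance is required, even though both sets may be unbounded. -/
theorem apply_eq_zero_of_disjoint_dsupport {p : 𝓢'(V, ℂ)} {θ : 𝓢(V, ℂ)}
    (hd : Disjoint (tsupport θ) (Distribution.dsupport p)) : p θ = 0 := by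
  obtain ⟨N, C, hC, hp⟩ : ∃ (n : ℕ) (C : ℝ), 0 ≤ C ∧ ∀ f, ‖p f‖ ≤ C * schwartzNorm n f :=
    exists_norm_apply_le (F := ℂ) p
  obtain ⟨D, hD⟩ := exists_cutoff_schwartzNorm_le θ N
  have main : ∀ R : ℝ, 1 ≤ R → ‖p θ‖ ≤ C * (D / R) := by
    intro R hR
    obtain ⟨θ', hc, hs, hle⟩ := hD R hR
    have h0 : p θ' = 0 := apply_eq_zero_of_hasCompactSupport hc (hd.mono_left hs)
    have h1 : p θ = p (θ - θ') := by rw [map_sub, h0, sub_zero]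
    rw [h1]
    refine (hp _).trans ?_
    gcongr
  have hlim : Tendsto (fun R : ℝ => C * (D / R)) atTop (𝓝 (C * 0)) :=
    (tendsto_id.const_div_atTop D).const_mul C
  have := ge_of_tendsto hlim (by
    filter_upwards [eventually_ge_atTop 1] with R hR using main R hR)
  rw [mul_zero] at this
  exact norm_le_zero_iff.1 this

end Support

end AttenuatedWave
end

/-! ### Causal symbols and their multipliers. -/

noncomputable section

namespace AttenuatedWave

@[simp] theorem point_fst (t : ℝ) (x : Space) : (point t x).fst = t := rfl
@[simp] theorem point_snd (t : ℝ) (x : Space) : (point t x).snd = x := rfl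

theorem spaceTime_inner (z w : SpaceTime) : ⟪z, w⟫ = z.fst * w.fst + ⟪z.snd, w.snd⟫ := by
  rw [WithLp.prod_inner_apply]
  change w.fst * z.fst + ⟪z.snd, w.snd⟫ = _
  ring

theorem abs_fst_le_norm (z : SpaceTime) : |z.fst| ≤ ‖z‖ :=
  WithLp.norm_fst_le (p := 2) _ z

theorem norm_snd_le_norm (z : SpaceTime) : ‖z.snd‖ ≤ ‖z‖ :=
  WithLp.norm_snd_le (p := 2) _ z

theorem continuous_fst_spaceTime : Continuous fun z : SpaceTime => z.fst :=
  (WithLp.fstL 2 ℝ ℝ Space).continuous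

theorem continuous_snd_spaceTime : Continuous fun z : SpaceTime => z.snd :=
  (WithLp.sndL 2 ℝ ℝ Space).continuous

/-- A symbol `G z ξ`, continuous on `Im z ≥ 0`, holomorphic in `z` on `Im z > 0` and polynomially
bounded. -/
structure IsCausalSymbol (G : ℂ → Space → ℂ) : Prop where
  continuousOn : ContinuousOn (fun q : ℂ × Space => G q.1 q.2) {q | 0 ≤ q.1.im}
  differentiableOn : ∀ ξ, DifferentiableOn ℂ (fun z => G z ξ) {z | 0 < z.im}
  bound : ∃ (C : ℝ) (k : ℕ), 0 ≤ C ∧ ∀ z ξ, 0 ≤ z.im →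
    ‖G z ξ‖ ≤ C * (1 + ‖z‖) ^ k * (1 + ‖ξ‖) ^ k

/-- The symbol as a function of the frequency `w`, at the complex angular frequency
`-2π w.fst + i y`. -/
def symbolAt (G : ℂ → Space → ℂ) (y : ℝ) (w : SpaceTime) : ℂ :=
  G (((-(2 * Real.pi * w.fst) : ℝ) : ℂ) + y * Complex.I) w.snd

namespace IsCausalSymbol

variable {G : ℂ → Space → ℂ}

theorem continuous_symbolAt (hG : IsCausalSymbol G) {y : ℝ} (hy : 0 ≤ y) :
    Continuous (symbolAt G y) := by
  have h := hG.continuousOn.comp_continuous (f := fun w : SpaceTime =>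
    ((((-(2 * Real.pi * w.fst) : ℝ) : ℂ) + y * Complex.I), w.snd)) ?_ (fun w => by simpa using hy)
  · exact h
  · have h1 := continuous_fst_spaceTime
    have h2 := continuous_snd_spaceTime
    fun_prop

theorem norm_symbolAt_le (hG : IsCausalSymbol G) :
    ∃ (C : ℝ) (k : ℕ), 0 ≤ C ∧ ∀ y, 0 ≤ y → ∀ w,
      ‖symbolAt G y w‖ ≤ C * (1 + ‖w‖) ^ k * (1 + y) ^ k := by
  obtain ⟨C, k, hC, hb⟩ := hG.bound
  have hpi := Real.pi_pos
  refine ⟨C * (1 + 2 * Real.pi) ^ k, 2 * k, by positivity, fun y hy w => ?_⟩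
  refine (hb _ _ (by simpa using hy)).trans ?_
  have h1 := abs_fst_le_norm w
  have h2 := norm_snd_le_norm w
  have h3 : ‖((-(2 * Real.pi * w.fst) : ℝ) : ℂ) + y * Complex.I‖ ≤ 2 * Real.pi * ‖w‖ + y := by
    refine (norm_add_le _ _).trans ?_
    rw [norm_mul, Complex.norm_I, mul_one, Complex.norm_real, Complex.norm_real,
      Real.norm_of_nonneg hy, norm_neg, norm_mul, Real.norm_of_nonneg (by positivity),
      Real.norm_eq_abs]
    gcongr
  set a := ‖((-(2 * Real.pi * w.fst) : ℝ) : ℂ) + y * Complex.I‖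
  have h4 : 1 + a ≤ (1 + 2 * Real.pi) * ((1 + ‖w‖) * (1 + y)) := by
    have e1 : 0 ≤ 2 * Real.pi * y := by positivity
    have e2 : 0 ≤ ‖w‖ * y := by positivity
    have e3 : 0 ≤ 2 * Real.pi * (‖w‖ * y) := by positivity
    nlinarith [norm_nonneg w]
  have h5 : (1 + y) ^ k ≤ (1 + y) ^ (2 * k) := pow_le_pow_right₀ (by linarith) (by omega)
  calc C * (1 + a) ^ k * (1 + ‖w.snd‖) ^ k
      ≤ C * ((1 + 2 * Real.pi) * ((1 + ‖w‖) * (1 + y))) ^ k * (1 + ‖w‖) ^ k := by gcongr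
    _ = C * (1 + 2 * Real.pi) ^ k * (1 + ‖w‖) ^ (2 * k) * (1 + y) ^ k := by
        rw [mul_pow, mul_pow, two_mul k, pow_add]; ring
    _ ≤ _ := by gcongr

theorem shift (hG : IsCausalSymbol G) {η : ℝ} (hη : 0 ≤ η) :
    IsCausalSymbol fun z ξ => G (z + η * Complex.I) ξ where
  continuousOn := hG.continuousOn.comp (f := fun q : ℂ × Space => (q.1 + η * Complex.I, q.2))
    (by fun_prop) (fun q hq => by
      have : 0 ≤ q.1.im := hq
      simpa using add_nonneg this hη)
  differentiableOn ξ := (hG.differentiableOn ξ).comp (f := fun z : ℂ => z + η * Complex.I)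
    (by fun_prop) (fun z hz => by
      have : 0 < z.im := hz
      simpa using add_pos_of_pos_of_nonneg this hη)
  bound := by
    obtain ⟨C, k, hC, hb⟩ := hG.bound
    refine ⟨C * (1 + η) ^ k, k, by positivity, fun z ξ hz => ?_⟩
    refine (hb _ _ (by simpa using add_nonneg hz hη)).trans ?_
    have h1 : 1 + ‖z + η * Complex.I‖ ≤ (1 + η) * (1 + ‖z‖) := by
      have := norm_add_le z (η * Complex.I)
      rw [norm_mul, Complex.norm_I, mul_one, Complex.norm_real, Real.norm_of_nonneg hη] at this
      nlinarith [norm_nonneg z, mul_nonneg hη (norm_nonneg z)]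
    calc C * (1 + ‖z + η * Complex.I‖) ^ k * (1 + ‖ξ‖) ^ k
        ≤ C * ((1 + η) * (1 + ‖z‖)) ^ k * (1 + ‖ξ‖) ^ k := by gcongr
      _ = _ := by rw [mul_pow]; ring

theorem symbolAt_shift (G : ℂ → Space → ℂ) (η y : ℝ) :
    symbolAt (fun z ξ => G (z + η * Complex.I) ξ) y = symbolAt G (y + η) := by
  funext w
  simp only [symbolAt]
  congr 1
  push_cast
  ring

/-- The direction is normalized so that the complex angular frequency moves by exactly ζ; its sign
and the factor 1/(2π) undo the convention ω = -2π w.fst. Going up in ζ is going up in the half plane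
of holomorphy. -/
theorem symbolAt_neg_line (G : ℂ → Space → ℂ) (w : SpaceTime) (ζ : ℂ) :
    symbolAt G ζ.im (w + ζ.re • point (-(1 / (2 * Real.pi))) 0) =
      G (((-(2 * Real.pi * w.fst) : ℝ) : ℂ) + ζ) w.snd := by
  have hpi := Real.pi_ne_zero
  simp only [symbolAt]
  congr 1
  · rw [show (w + ζ.re • point (-(1 / (2 * Real.pi))) 0).fst =
      w.fst + ζ.re * (-(1 / (2 * Real.pi))) from rfl]
    conv_rhs => rw [← Complex.re_add_im ζ]
    rw [← add_assoc, ← Complex.ofReal_add]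
    congr 2
    field_simp
    ring
  · change w.snd + ζ.re • (0 : Space) = w.snd
    simp

/-- The opposite direction starts at height η and comes down to the real line as Im ζ runs from 0 to
η. -/
theorem symbolAt_pos_line (G : ℂ → Space → ℂ) (η : ℝ) (w : SpaceTime) (ζ : ℂ) :
    symbolAt G (η - ζ.im) (w + ζ.re • point (1 / (2 * Real.pi)) 0) =
      G (((-(2 * Real.pi * w.fst) : ℝ) : ℂ) + η * Complex.I - ζ) w.snd := by
  have hpi := Real.pi_ne_zero
  simp only [symbolAt]
  congr 1
  · rw [show (w + ζ.re • point (1 / (2 * Real.pi)) 0).fst =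
      w.fst + ζ.re * (1 / (2 * Real.pi)) from rfl]
    have e : -(2 * Real.pi * (w.fst + ζ.re * (1 / (2 * Real.pi)))) =
        -(2 * Real.pi * w.fst) - ζ.re := by
      field_simp
      ring
    rw [e]
    conv_rhs => rw [← Complex.re_add_im ζ]
    push_cast
    ring
  · change w.snd + ζ.re • (0 : Space) = w.snd
    simp

theorem phase_line (w z v : SpaceTime) (ζ : ℂ) :
    Complex.exp (-2 * Real.pi * Complex.I * ⟪w + ζ.re • v, z⟫) *
      (Real.exp (2 * Real.pi * ζ.im * ⟪v, z⟫) : ℂ) =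
      Complex.exp (-2 * Real.pi * Complex.I * (⟪w, z⟫ + ζ * ⟪v, z⟫)) := by
  rw [Complex.ofReal_exp, ← Complex.exp_add]
  congr 1
  rw [inner_add_left, inner_smul_left]
  conv_rhs => rw [← Complex.re_add_im ζ]
  simp only [conj_trivial]
  push_cast
  linear_combination (2 * Real.pi * ζ.im * (⟪v, z⟫ : ℂ)) * Complex.I_mul_I

theorem norm_phase (w z : SpaceTime) :
    ‖Complex.exp (-2 * Real.pi * Complex.I * ⟪w, z⟫)‖ = 1 := by
  rw [Complex.norm_exp]
  simp

/-- The multiplier with a causal symbol maps functions supported in the past of `-ε` to functions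
supported in the past of `-ε`. -/
theorem integral_eq_zero (hG : IsCausalSymbol G) {ε : ℝ} (ϕ : 𝓢(SpaceTime, ℂ))
    (hϕ : ∀ z, -ε < z.fst → ϕ z = 0) {z₀ : SpaceTime} (hz₀ : -ε < z₀.fst) :
    ∫ w, (symbolAt G 0 w * Complex.exp (-2 * Real.pi * Complex.I * ⟪w, z₀⟫)) * (𝓕⁻ ϕ) w = 0 := by
  have hpi := Real.pi_pos
  set v : SpaceTime := point (-(1 / (2 * Real.pi))) 0 with hv
  have hvz : ∀ z, ⟪v, z⟫ = -z.fst / (2 * Real.pi) := fun z => by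
    rw [spaceTime_inner, hv]
    simp only [point_fst, point_snd, inner_zero_left]
    ring
  set M : SpaceTime → ℝ → ℂ := fun w y => symbolAt G y w *
    (Complex.exp (-2 * Real.pi * Complex.I * ⟪w, z₀⟫) *
      (Real.exp (2 * Real.pi * y * ⟪v, z₀⟫) : ℂ)) with hM
  obtain ⟨C, k, hC, hb⟩ := hG.norm_symbolAt_le
  have hline : ∀ w (ζ : ℂ), M (w + ζ.re • v) ζ.im =
      G (((-(2 * Real.pi * w.fst) : ℝ) : ℂ) + ζ) w.snd *
        Complex.exp (-2 * Real.pi * Complex.I * (⟪w, z₀⟫ + ζ * ⟪v, z₀⟫)) := fun w ζ => by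
    simp only [hM]
    rw [phase_line, hv, symbolAt_neg_line]
  -- Since v points backwards in time, ⟨v, z₀⟩ < ε/(2π) ≤ ⟨v, z⟩ for z in the support of ϕ. This is
  -- the gap a < δ.
  have key := integral_mul_fourierInv_eq_zero v (M := M) (a := ⟪v, z₀⟫) (δ := ε / (2 * Real.pi))
    (C := C) (k := k) ?_ ?_ ?_ ?_ ?_ ϕ ?_
  · simpa [hM] using key
  · intro y hy
    exact (hG.continuous_symbolAt hy).mul (by fun_prop)
  · intro w
    simp_rw [hline]
    refine ContinuousOn.mul ?_ (by fun_prop)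
    exact hG.continuousOn.comp (f := fun ζ : ℂ =>
      ((((-(2 * Real.pi * w.fst) : ℝ) : ℂ) + ζ), w.snd)) (by fun_prop) (fun ζ hζ => by
        simpa using hζ)
  · intro w
    simp_rw [hline]
    refine DifferentiableOn.mul ?_ (by fun_prop)
    exact (hG.differentiableOn w.snd).comp (f := fun ζ : ℂ =>
      (((-(2 * Real.pi * w.fst) : ℝ) : ℂ) + ζ)) (by fun_prop) (fun ζ hζ => by
        simpa using hζ)
  · rw [hvz]
    gcongr
    linarith
  · intro w y hy
    simp only [hM]
    rw [norm_mul, norm_mul, norm_phase, one_mul, Complex.norm_real,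
      Real.norm_of_nonneg (Real.exp_pos _).le]
    gcongr
    exact hb y hy w
  · intro z hz
    have : z.fst ≤ -ε := by
      by_contra! h
      exact hz (hϕ z h)
    rw [hvz]
    gcongr
    linarith

/-- Conjugation of a multiplier with a causal symbol by an exponential in time. -/
theorem integral_eq_exp_mul (hG : IsCausalSymbol G) {η : ℝ} (hη : 0 ≤ η) (ϕ : 𝓢(SpaceTime, ℂ))
    {b : ℝ} {L : SpaceTime →L[ℝ] ℝ} (hL : ∀ z, L z = -η * z.fst)
    (hϕ : ∀ z, ϕ z ≠ 0 → L z ≤ b) (z₀ : SpaceTime) :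
    ∫ w, (symbolAt G 0 w * Complex.exp (-2 * Real.pi * Complex.I * ⟪w, z₀⟫)) *
        (𝓕⁻ (expMul L b ϕ hϕ)) w =
      (Real.exp (-η * z₀.fst) : ℂ) *
        ∫ w, (symbolAt G η w * Complex.exp (-2 * Real.pi * Complex.I * ⟪w, z₀⟫)) *
          (𝓕⁻ ϕ) w := by
  have hpi := Real.pi_pos
  set v : SpaceTime := point (1 / (2 * Real.pi)) 0 with hv
  have hvz : ∀ z, ⟪v, z⟫ = z.fst / (2 * Real.pi) := fun z => by
    rw [spaceTime_inner, hv]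
    simp only [point_fst, point_snd, inner_zero_left]
    ring
  have hLv : shiftFunctional v η = L := by
    ext z
    rw [shiftFunctional_apply, hvz, hL]
    field_simp
  -- At y = 0 this is the multiplier at height η, at y = η the one on the real line. The last factor
  -- is what the complex shift of w adds to the phase at z₀.
  set M : SpaceTime → ℝ → ℂ := fun w y => symbolAt G (η - y) w *
    (Complex.exp (-2 * Real.pi * Complex.I * ⟪w, z₀⟫) *
      (Real.exp (2 * Real.pi * y * ⟪v, z₀⟫) : ℂ)) with hM
  obtain ⟨C, k, hC, hb⟩ := hG.norm_symbolAt_le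
  have hline : ∀ w (ζ : ℂ), M (w + ζ.re • v) ζ.im =
      G (((-(2 * Real.pi * w.fst) : ℝ) : ℂ) + η * Complex.I - ζ) w.snd *
        Complex.exp (-2 * Real.pi * Complex.I * (⟪w, z₀⟫ + ζ * ⟪v, z₀⟫)) := fun w ζ => by
    simp only [hM]
    rw [phase_line, hv, symbolAt_pos_line]
  have hϕ' : ∀ z, ϕ z ≠ 0 → shiftFunctional v η z ≤ b := fun z hz => by
    rw [hLv]; exact hϕ z hz
  have key := integral_mul_fourierInv_eq_shift v hη (M := M)
    (C := C * (1 + η) ^ k * Real.exp (2 * Real.pi * η * |⟪v, z₀⟫|)) (k := k) ?_ ?_ ?_ ?_ ?_ ϕ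
    (b := b) hϕ'
  · have e1 : (∫ w, M w 0 * (𝓕⁻ ϕ) w) =
        ∫ w, (symbolAt G η w * Complex.exp (-2 * Real.pi * Complex.I * ⟪w, z₀⟫)) * (𝓕⁻ ϕ) w := by
      simp [hM]
    have e2 : (∫ w, M w η * (𝓕⁻ (expMul (shiftFunctional v η) b ϕ hϕ')) w) =
        (Real.exp (η * z₀.fst) : ℂ) *
        ∫ w, (symbolAt G 0 w * Complex.exp (-2 * Real.pi * Complex.I * ⟪w, z₀⟫)) *
          (𝓕⁻ (expMul L b ϕ hϕ)) w := by
      have e3 : expMul (shiftFunctional v η) b ϕ hϕ' = expMul L b ϕ hϕ := by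
        ext z; simp only [expMul_apply, hLv]
      rw [e3, ← integral_const_mul]
      congr 1
      funext w
      have e4 : 2 * Real.pi * η * ⟪v, z₀⟫ = η * z₀.fst := by
        rw [hvz]; field_simp
      simp only [hM, sub_self, e4]
      ring
    rw [← e1, key, e2, ← mul_assoc, ← Complex.ofReal_mul, ← Real.exp_add]
    simp
  · exact (hG.continuous_symbolAt (by linarith)).mul (by fun_prop)
  · exact (hG.continuous_symbolAt (by linarith)).mul (by fun_prop)
  · intro w
    simp_rw [hline]
    refine ContinuousOn.mul ?_ (by fun_prop)
    exact hG.continuousOn.comp (f := fun ζ : ℂ =>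
      ((((-(2 * Real.pi * w.fst) : ℝ) : ℂ) + η * Complex.I - ζ), w.snd)) (by fun_prop)
      (fun ζ hζ => by
        have : ζ.im ≤ η := hζ.2
        simpa using this)
  · intro w
    simp_rw [hline]
    refine DifferentiableOn.mul ?_ (by fun_prop)
    exact (hG.differentiableOn w.snd).comp (f := fun ζ : ℂ =>
      (((-(2 * Real.pi * w.fst) : ℝ) : ℂ) + η * Complex.I - ζ)) (by fun_prop) (fun ζ hζ => by
        have : ζ.im < η := hζ.2
        simpa using this)
  · intro w y hy
    simp only [hM]
    rw [norm_mul, norm_mul, norm_phase, one_mul, Complex.norm_real,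
      Real.norm_of_nonneg (Real.exp_pos _).le]
    have h1 := hb (η - y) (by linarith [hy.2]) w
    have h2 : 2 * Real.pi * y * ⟪v, z₀⟫ ≤ 2 * Real.pi * η * |⟪v, z₀⟫| := by
      have h3 := le_abs_self ⟪v, z₀⟫
      have h5 : 0 ≤ 2 * Real.pi * y := by have := hy.1; positivity
      have hy2 := hy.2
      calc 2 * Real.pi * y * ⟪v, z₀⟫ ≤ 2 * Real.pi * y * |⟪v, z₀⟫| := by gcongr
        _ ≤ _ := by gcongr
    have h6 : 1 + (η - y) ≤ 1 + η := by linarith [hy.1]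
    have h7 : 0 ≤ 1 + (η - y) := by linarith [hy.2]
    calc ‖symbolAt G (η - y) w‖ * Real.exp (2 * Real.pi * y * ⟪v, z₀⟫)
        ≤ (C * (1 + ‖w‖) ^ k * (1 + η) ^ k) * Real.exp (2 * Real.pi * η * |⟪v, z₀⟫|) := by
          gcongr
          exact h1.trans (by gcongr)
      _ = _ := by ring

end IsCausalSymbol

end AttenuatedWave
end

/-! ### The transposed wave operator and the damping of causal solutions. -/

noncomputable section

namespace AttenuatedWave

section Multiplier

variable {V : Type*} [NormedAddCommGroup V] [InnerProductSpace ℝ V] [FiniteDimensional ℝ V]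
  [MeasurableSpace V] [BorelSpace V]

/-- The operator `𝓕 g 𝓕⁻` on Schwartz functions. -/
def dualMultiplier (g : V → ℂ) (f : 𝓢(V, ℂ)) : 𝓢(V, ℂ) :=
  𝓕 (SchwartzMap.smulLeftCLM ℂ g (𝓕⁻ f))

theorem dualMultiplier_apply {g : V → ℂ} (hg : g.HasTemperateGrowth) (f : 𝓢(V, ℂ)) (z : V) :
    dualMultiplier g f z =
      ∫ w, (g w * Complex.exp (-2 * Real.pi * Complex.I * ⟪w, z⟫)) * (𝓕⁻ f) w := by
  rw [dualMultiplier, SchwartzMap.fourier_coe, Real.fourier_eq']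
  congr 1
  funext w
  rw [SchwartzMap.smulLeftCLM_apply_apply hg, smul_eq_mul, smul_eq_mul, ← mul_assoc,
    mul_comm (g w)]
  congr 3
  push_cast
  ring

theorem dualMultiplier_sub (g : V → ℂ) (f₁ f₂ : 𝓢(V, ℂ)) :
    dualMultiplier g (f₁ - f₂) = dualMultiplier g f₁ - dualMultiplier g f₂ := by
  simp only [dualMultiplier, sub_eq_add_neg, FourierTransform.fourierInv_add,
    FourierTransform.fourierInv_neg, map_add, map_neg, FourierTransform.fourier_add,
    FourierTransform.fourier_neg]

theorem dualMultiplier_dualMultiplier {g₁ g₂ : V → ℂ} (h₁ : g₁.HasTemperateGrowth)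
    (h₂ : g₂.HasTemperateGrowth) (f : 𝓢(V, ℂ)) :
    dualMultiplier g₁ (dualMultiplier g₂ f) = dualMultiplier (g₁ * g₂) f := by
  simp only [dualMultiplier, FourierTransform.fourierInv_fourier_eq]
  rw [SchwartzMap.smulLeftCLM_smulLeftCLM_apply h₁ h₂]

theorem lineDerivOp_dualMultiplier {g : V → ℂ} (hg : g.HasTemperateGrowth) (f : 𝓢(V, ℂ)) (m : V) :
    ∂_{m} (dualMultiplier g f) = dualMultiplier g (∂_{m} f) := by
  simp only [dualMultiplier]
  rw [SchwartzMap.lineDerivOp_fourier_eq, SchwartzMap.fourierInv_lineDerivOp_eq]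
  have hin : (fun w : V => (inner ℝ w m : ℝ)).HasTemperateGrowth := by fun_prop
  congr 1
  ext w
  simp only [map_smul, smul_apply, SchwartzMap.smulLeftCLM_apply_apply hg,
    SchwartzMap.smulLeftCLM_apply_apply hin, smul_eq_mul, Complex.real_smul]
  ring

end Multiplier

/-- The symbol of the transposed attenuated wave operator. -/
def waveSymbol (κt : ℂ → ℂ) (z : ℂ) (ξ : Space) : ℂ :=
  ((4 * Real.pi ^ 2 * ‖ξ‖ ^ 2 : ℝ) : ℂ) - κt z ^ 2

variable {κ : ℝ → ℂ} {κt : ℂ → ℂ}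

namespace IsHolomorphicExtension

theorem isCausalSymbol_waveSymbol (hκt : IsHolomorphicExtension κ κt) :
    IsCausalSymbol (waveSymbol κt) where
  continuousOn := by
    refine ContinuousOn.sub (by fun_prop) ?_
    refine (hκt.continuousOn.comp (f := fun q : ℂ × Space => q.1) (by fun_prop)
      (fun q hq => hq)).pow 2
  differentiableOn ξ := (differentiableOn_const _).sub (hκt.differentiableOn.pow 2)
  bound := by
    obtain ⟨C, N, hC, hb⟩ := hκt.bound
    refine ⟨4 * Real.pi ^ 2 + C ^ 2, 2 * N + 2, by positivity, fun z ξ hz => ?_⟩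
    rw [waveSymbol]
    refine (norm_sub_le _ _).trans ?_
    rw [Complex.norm_real, Real.norm_of_nonneg (by positivity), norm_pow]
    have h1 : ‖κt z‖ ^ 2 ≤ C ^ 2 * (1 + ‖z‖) ^ (2 * N) := by
      calc ‖κt z‖ ^ 2 ≤ (C * (1 + ‖z‖) ^ N) ^ 2 := by gcongr; exact hb z hz
        _ = _ := by rw [mul_pow, ← pow_mul, mul_comm N]
    have hz1 : 1 ≤ 1 + ‖z‖ := by linarith [norm_nonneg z]
    have hξ1 : 1 ≤ 1 + ‖ξ‖ := by linarith [norm_nonneg ξ]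
    have h2 : (1 + ‖z‖) ^ (2 * N) ≤ (1 + ‖z‖) ^ (2 * N + 2) * (1 + ‖ξ‖) ^ (2 * N + 2) := by
      refine (pow_le_pow_right₀ hz1 (show 2 * N ≤ 2 * N + 2 by omega)).trans ?_
      exact le_mul_of_one_le_right (by positivity) (one_le_pow₀ hξ1)
    have h3 : ‖ξ‖ ^ 2 ≤ (1 + ‖z‖) ^ (2 * N + 2) * (1 + ‖ξ‖) ^ (2 * N + 2) := by
      refine le_trans ?_ (le_mul_of_one_le_left (by positivity) (one_le_pow₀ hz1))
      calc ‖ξ‖ ^ 2 ≤ (1 + ‖ξ‖) ^ 2 := by gcongr; linarith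
        _ ≤ _ := pow_le_pow_right₀ hξ1 (by omega)
    calc 4 * Real.pi ^ 2 * ‖ξ‖ ^ 2 + ‖κt z‖ ^ 2
        ≤ 4 * Real.pi ^ 2 * ((1 + ‖z‖) ^ (2 * N + 2) * (1 + ‖ξ‖) ^ (2 * N + 2)) +
          C ^ 2 * ((1 + ‖z‖) ^ (2 * N + 2) * (1 + ‖ξ‖) ^ (2 * N + 2)) := by
          refine add_le_add ?_ (h1.trans ?_) <;> gcongr
      _ = _ := by ring

theorem symbolAt_waveSymbol_zero (hκt : IsHolomorphicExtension κ κt) (w : SpaceTime) :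
    symbolAt (waveSymbol κt) 0 w =
      ((4 * Real.pi ^ 2 * ‖w.snd‖ ^ 2 : ℝ) : ℂ) - κ (-(2 * Real.pi * w.fst)) ^ 2 := by
  rw [symbolAt, waveSymbol, Complex.ofReal_zero, zero_mul, add_zero, hκt.eq_on_real]

end IsHolomorphicExtension

theorem hasTemperateGrowth_norm_snd_sq :
    (fun w : SpaceTime => ((4 * Real.pi ^ 2 * ‖w.snd‖ ^ 2 : ℝ) : ℂ)).HasTemperateGrowth := by
  have h1 : (fun w : SpaceTime => ‖WithLp.sndL 2 ℝ ℝ Space w‖ ^ 2).HasTemperateGrowth :=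
    (Function.hasTemperateGrowth_norm_sq Space).comp (WithLp.sndL 2 ℝ ℝ Space).hasTemperateGrowth
  have h2 : (fun w : SpaceTime => 4 * Real.pi ^ 2 * ‖WithLp.sndL 2 ℝ ℝ Space w‖ ^ 2).HasTemperateGrowth :=
    (Function.HasTemperateGrowth.const (4 * Real.pi ^ 2)).mul h1
  exact Complex.ofRealCLM.hasTemperateGrowth.comp h2

theorem hasTemperateGrowth_attenuation (hκ : κ.HasTemperateGrowth) :
    (fun w : SpaceTime => κ (-(2 * Real.pi * w.fst)) ^ 2).HasTemperateGrowth := by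
  have : (fun w : SpaceTime => -(2 * Real.pi * (WithLp.fstL 2 ℝ ℝ Space w))).HasTemperateGrowth :=
    by fun_prop
  exact (hκ.comp this).pow 2

namespace IsHolomorphicExtension

theorem hasTemperateGrowth_symbolAt_zero (hκ : κ.HasTemperateGrowth)
    (hκt : IsHolomorphicExtension κ κt) :
    (symbolAt (waveSymbol κt) 0).HasTemperateGrowth := by
  have e : symbolAt (waveSymbol κt) 0 = (fun w : SpaceTime =>
      ((4 * Real.pi ^ 2 * ‖w.snd‖ ^ 2 : ℝ) : ℂ)) -
      fun w : SpaceTime => κ (-(2 * Real.pi * w.fst)) ^ 2 := by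
    funext w; exact hκt.symbolAt_waveSymbol_zero w
  rw [e]
  exact hasTemperateGrowth_norm_snd_sq.sub (hasTemperateGrowth_attenuation hκ)

theorem hasTemperateGrowth_symbolAt (hκt : IsHolomorphicExtension κ κt) {η : ℝ} (hη : 0 < η) :
    (symbolAt (waveSymbol κt) η).HasTemperateGrowth := by
  obtain ⟨C, N, hC, hb⟩ := hκt.bound
  have h1 := hasTemperateGrowth_of_holomorphic hκt.differentiableOn hC.le hb hη
  have h2 := hasTemperateGrowth_attenuation h1
  exact hasTemperateGrowth_norm_snd_sq.sub h2

end IsHolomorphicExtension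

theorem dualMultiplier_norm_snd_sq (ϑ : 𝓢(SpaceTime, ℂ)) :
    dualMultiplier (fun w : SpaceTime => ((4 * Real.pi ^ 2 * ‖w.snd‖ ^ 2 : ℝ) : ℂ)) ϑ =
      -∑ i : Fin 3, ∂_{spaceDir i} (∂_{spaceDir i} ϑ) := by
  have hin : ∀ m : SpaceTime, (fun w : SpaceTime => (inner ℝ w m : ℝ)).HasTemperateGrowth :=
    fun m => by fun_prop
  have h2 : ∀ m : SpaceTime, ∂_{m} (∂_{m} ϑ) =
      𝓕 (-(2 * Real.pi * Complex.I) • SchwartzMap.smulLeftCLM ℂ (inner ℝ · m)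
        (-(2 * Real.pi * Complex.I) • SchwartzMap.smulLeftCLM ℂ (inner ℝ · m) (𝓕⁻ ϑ))) := by
    intro m
    rw [← SchwartzMap.lineDerivOp_fourier_eq, ← SchwartzMap.lineDerivOp_fourier_eq,
      FourierTransform.fourier_fourierInv_eq]
  simp_rw [h2]
  have h4 : ∀ F : Fin 3 → 𝓢(SpaceTime, ℂ), ∑ i, 𝓕 (F i) = 𝓕 (∑ i, F i) := fun F =>
    (map_sum (FourierTransform.fourierCLM ℂ 𝓢(SpaceTime, ℂ)) F Finset.univ).symm
  rw [h4, ← FourierTransform.fourier_neg, dualMultiplier]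
  congr 1
  ext w
  rw [SchwartzMap.smulLeftCLM_apply_apply hasTemperateGrowth_norm_snd_sq, neg_apply, sum_apply]
  simp only [smul_apply, SchwartzMap.smulLeftCLM_apply_apply (hin _), smul_eq_mul,
    Complex.real_smul]
  have h3 : ∀ i, inner ℝ w (spaceDir i) = w.snd i := by
    intro i
    rw [spaceTime_inner, spaceDir, point_fst, point_snd, EuclideanSpace.inner_single_right]
    simp
  simp_rw [h3]
  rw [EuclideanSpace.norm_sq_eq, Fin.sum_univ_three, Fin.sum_univ_three]
  simp only [Real.norm_eq_abs, sq_abs]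
  push_cast
  linear_combination (4 * (Real.pi : ℂ) ^ 2 * (𝓕⁻ ϑ) w * ((w.snd 0 : ℂ) ^ 2 + (w.snd 1 : ℂ) ^ 2
    + (w.snd 2 : ℂ) ^ 2)) * Complex.I_mul_I

/-- Both operators pass to the test function and combine there into one multiplier with a causal
symbol. From here on only the transposed equation is studied. -/
theorem apply_dualMultiplier_waveSymbol (hκ : κ.HasTemperateGrowth)
    (hκt : IsHolomorphicExtension κ κt) (p : 𝓢'(SpaceTime, ℂ)) (ϑ : 𝓢(SpaceTime, ℂ)) :
    p (dualMultiplier (symbolAt (waveSymbol κt) 0) ϑ) =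
      attenuationOperator κ p ϑ - spatialLaplacian p ϑ := by
  have e : symbolAt (waveSymbol κt) 0 = (fun w : SpaceTime =>
      ((4 * Real.pi ^ 2 * ‖w.snd‖ ^ 2 : ℝ) : ℂ)) -
      fun w : SpaceTime => κ (-(2 * Real.pi * w.fst)) ^ 2 := by
    funext w; exact hκt.symbolAt_waveSymbol_zero w
  have e1 : dualMultiplier (symbolAt (waveSymbol κt) 0) ϑ =
      dualMultiplier (fun w : SpaceTime => ((4 * Real.pi ^ 2 * ‖w.snd‖ ^ 2 : ℝ) : ℂ)) ϑ -
      dualMultiplier (fun w : SpaceTime => κ (-(2 * Real.pi * w.fst)) ^ 2) ϑ := by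
    simp only [dualMultiplier]
    rw [e, SchwartzMap.smulLeftCLM_sub hasTemperateGrowth_norm_snd_sq
      (hasTemperateGrowth_attenuation hκ), sub_apply, sub_eq_add_neg,
      FourierTransform.fourier_add, FourierTransform.fourier_neg, ← sub_eq_add_neg]
  have e2 : spatialLaplacian p ϑ = p (∑ i : Fin 3, ∂_{spaceDir i} (∂_{spaceDir i} ϑ)) := by
    rw [spatialLaplacian, sum_apply, map_sum]
    refine Finset.sum_congr rfl fun i _ => ?_
    simp only [TemperedDistribution.lineDerivOp_apply_apply, LineDeriv.lineDerivOp_neg, neg_neg]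
  have e3 : attenuationOperator κ p ϑ =
      -p (dualMultiplier (fun w : SpaceTime => κ (-(2 * Real.pi * w.fst)) ^ 2) ϑ) := rfl
  rw [e1, dualMultiplier_norm_snd_sq, map_sub, map_neg, e2, e3]
  ring

theorem IsCausalSolution.apply_dualMultiplier (hκ : κ.HasTemperateGrowth)
    (hκt : IsHolomorphicExtension κ κt) {h : Space → ℝ} {p : 𝓢'(SpaceTime, ℂ)}
    (hp : IsCausalSolution κ h p) (ϑ : 𝓢(SpaceTime, ℂ)) :
    p (dualMultiplier (symbolAt (waveSymbol κt) 0) ϑ) =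
      -∫ x : Space, (h x : ℂ) * (∂_{timeDir} ϑ) (point 0 x) := by
  rw [apply_dualMultiplier_waveSymbol hκ hκt, hp.equation ϑ]

theorem IsCausalSolution.apply_eq_zero {h : Space → ℝ} {p : 𝓢'(SpaceTime, ℂ)}
    (hp : IsCausalSolution κ h p) {ε : ℝ} (hε : 0 < ε) {θ : 𝓢(SpaceTime, ℂ)}
    (hθ : ∀ z, -ε < z.fst → θ z = 0) : p θ = 0 := by
  refine apply_eq_zero_of_disjoint_dsupport (Set.disjoint_left.2 fun z hz hz' => ?_)
  have h1 : tsupport θ ⊆ {z | z.fst ≤ -ε} := by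
    refine closure_minimal (fun z hz => ?_) (isClosed_le continuous_fst_spaceTime continuous_const)
    by_contra hcon
    exact hz (hθ z (not_le.1 hcon))
  have h2 := h1 hz
  have h3 := hp.causal hz'
  simp only [Set.mem_ofPred_eq] at h2 h3
  linarith

/-- Since p does not see t ≤ -ε, the transposed equation has to be solved only for t > -ε. This
freedom admits functions such as e^{-ηt}, cut off in the past where they grow. -/
theorem IsCausalSolution.apply_eq (hκ : κ.HasTemperateGrowth)
    (hκt : IsHolomorphicExtension κ κt) {h : Space → ℝ} {p : 𝓢'(SpaceTime, ℂ)}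
    (hp : IsCausalSolution κ h p) {ϑ θ : 𝓢(SpaceTime, ℂ)} {ε : ℝ} (hε : 0 < ε)
    (hϑ : ∀ z, -ε < z.fst → dualMultiplier (symbolAt (waveSymbol κt) 0) ϑ z = θ z) :
    p θ = -∫ x : Space, (h x : ℂ) * (∂_{timeDir} ϑ) (point 0 x) := by
  rw [← hp.apply_dualMultiplier hκ hκt, ← sub_eq_zero, ← map_sub]
  refine hp.apply_eq_zero hε fun z hz => ?_
  rw [sub_apply, hϑ z hz, sub_self]

/-- A smooth function of time that is `0` before `-2` and `1` after `-1`. -/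
def timeCutoff (z : SpaceTime) : ℂ := (Real.smoothTransition (z.fst + 2) : ℂ)

theorem timeCutoff_eq_one {z : SpaceTime} (hz : -1 ≤ z.fst) : timeCutoff z = 1 := by
  rw [timeCutoff, Real.smoothTransition.one_of_one_le (by linarith), Complex.ofReal_one]

theorem timeCutoff_eq_zero {z : SpaceTime} (hz : z.fst ≤ -2) : timeCutoff z = 0 := by
  rw [timeCutoff, Real.smoothTransition.zero_of_nonpos (by linarith), Complex.ofReal_zero]

theorem hasTemperateGrowth_smoothTransition : Real.smoothTransition.HasTemperateGrowth := by
  have hsm : ContDiff ℝ (⊤ : ℕ∞) Real.smoothTransition := Real.smoothTransition.contDiff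
  have hc : HasCompactSupport (fderiv ℝ Real.smoothTransition) := by
    refine HasCompactSupport.intro (isCompact_Icc (a := (0 : ℝ)) (b := 1)) fun x hx => ?_
    rw [Set.mem_Icc, not_and_or, not_le, not_le] at hx
    rcases hx with hx | hx
    · have : Real.smoothTransition =ᶠ[𝓝 x] fun _ => 0 := by
        filter_upwards [eventually_lt_nhds hx] with y hy
        exact Real.smoothTransition.zero_of_nonpos hy.le
      rw [this.fderiv_eq]
      simp
    · have : Real.smoothTransition =ᶠ[𝓝 x] fun _ => 1 := by
        filter_upwards [eventually_gt_nhds hx] with y hy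
        exact Real.smoothTransition.one_of_one_le hy.le
      rw [this.fderiv_eq]
      simp
  refine Function.HasTemperateGrowth.of_fderiv (k := 0) (C := 1)
    (hc.hasTemperateGrowth (hsm.fderiv_right (by simp))) (hsm.differentiable (by simp)) fun x => ?_
  rw [Real.norm_of_nonneg (Real.smoothTransition.nonneg x)]
  simpa using Real.smoothTransition.le_one x

theorem hasTemperateGrowth_timeCutoff : timeCutoff.HasTemperateGrowth := by
  have h1 : (fun w : SpaceTime => WithLp.fstL 2 ℝ ℝ Space w + 2).HasTemperateGrowth := by fun_prop
  exact Complex.ofRealCLM.hasTemperateGrowth.comp (hasTemperateGrowth_smoothTransition.comp h1)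

/-- The product of a Schwartz function with the cutoff in time. -/
def cutoffMul (f : 𝓢(SpaceTime, ℂ)) : 𝓢(SpaceTime, ℂ) := SchwartzMap.smulLeftCLM ℂ timeCutoff f

theorem cutoffMul_apply (f : 𝓢(SpaceTime, ℂ)) (z : SpaceTime) :
    cutoffMul f z = timeCutoff z * f z :=
  SchwartzMap.smulLeftCLM_apply_apply hasTemperateGrowth_timeCutoff f z

/-- The functional `z ↦ a z.fst`. -/
def timeFunctional (a : ℝ) : SpaceTime →L[ℝ] ℝ := a • WithLp.fstL 2 ℝ ℝ Space

@[simp]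
theorem timeFunctional_apply (a : ℝ) (z : SpaceTime) : timeFunctional a z = a * z.fst := rfl

theorem timeFunctional_le {η : ℝ} (hη : 0 ≤ η) (f : 𝓢(SpaceTime, ℂ)) (z : SpaceTime)
    (hz : cutoffMul f z ≠ 0) : timeFunctional (-η) z ≤ 2 * η := by
  have : -2 ≤ z.fst := by
    by_contra! hcon
    rw [cutoffMul_apply, timeCutoff_eq_zero hcon.le, zero_mul] at hz
    exact hz rfl
  rw [timeFunctional_apply]
  nlinarith

/-- The function `χ(t) e^{-ηt} f`. -/
def cutoffExp (η : ℝ) (hη : 0 ≤ η) (f : 𝓢(SpaceTime, ℂ)) : 𝓢(SpaceTime, ℂ) :=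
  expMul (timeFunctional (-η)) (2 * η) (cutoffMul f) (timeFunctional_le hη f)

theorem cutoffExp_apply (η : ℝ) (hη : 0 ≤ η) (f : 𝓢(SpaceTime, ℂ)) (z : SpaceTime) :
    cutoffExp η hη f z = (Real.exp (-η * z.fst) : ℂ) * (timeCutoff z * f z) := by
  rw [cutoffExp, expMul_apply, cutoffMul_apply, timeFunctional_apply]

theorem point_add_smul_timeDir (x : Space) (t : ℝ) : (point 0 x + t • timeDir) = point t x := by
  apply (WithLp.equiv 2 (ℝ × Space)).injective
  refine Prod.ext ?_ ?_
  · change 0 + t * 1 = t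
    ring
  · change x + t • (0 : Space) = x
    simp

theorem hasDerivAt_point (q : 𝓢(SpaceTime, ℂ)) (x : Space) :
    HasDerivAt (fun t : ℝ => q (point t x)) ((∂_{timeDir} q) (point 0 x)) 0 := by
  have h1 := (q.differentiableAt (x := point 0 x)).lineDifferentiableAt (v := timeDir)
  have h2 := h1.hasLineDerivAt
  rw [SchwartzMap.lineDerivOp_apply]
  simpa [HasLineDerivAt, point_add_smul_timeDir] using h2

theorem lineDerivOp_cutoffExp (η : ℝ) (hη : 0 ≤ η) (q : 𝓢(SpaceTime, ℂ)) (x : Space) :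
    (∂_{timeDir} (cutoffExp η hη q)) (point 0 x) =
      (∂_{timeDir} q) (point 0 x) - η * q (point 0 x) := by
  have h1 := hasDerivAt_point (cutoffExp η hη q) x
  have h2 : HasDerivAt (fun t : ℝ => (Real.exp (-η * t) : ℂ)) (-η : ℂ) 0 := by
    have : HasDerivAt (fun t : ℝ => Real.exp (-η * t)) (-η) 0 := by
      have := ((hasDerivAt_id (0 : ℝ)).const_mul (-η)).exp
      simpa using this
    simpa using this.ofReal_comp
  have h3 := h2.mul (hasDerivAt_point q x)
  have h4 : (fun t : ℝ => cutoffExp η hη q (point t x)) =ᶠ[𝓝 0]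
      fun t : ℝ => (Real.exp (-η * t) : ℂ) * q (point t x) := by
    filter_upwards [eventually_gt_nhds (show (-1 : ℝ) < 0 by norm_num)] with t ht
    rw [cutoffExp_apply, timeCutoff_eq_one (by simpa using ht.le), one_mul, point_fst]
  rw [h1.unique (h3.congr_of_eventuallyEq h4)]
  simp
  ring

/-- This is the equation after damping: conjugation by e^{-ηt} replaces the symbol on the real line
by the one at height η. The cutoff alters functions only for t < -1, and a causal multiplier does
not carry that change to later times. -/
theorem IsCausalSolution.apply_cutoffExp (hκ : κ.HasTemperateGrowth)
    (hκt : IsHolomorphicExtension κ κt) {h : Space → ℝ} {p : 𝓢'(SpaceTime, ℂ)}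
    (hp : IsCausalSolution κ h p) {η : ℝ} (hη : 0 < η) (q : 𝓢(SpaceTime, ℂ)) :
    p (cutoffExp η hη.le (dualMultiplier (symbolAt (waveSymbol κt) η) q)) =
      -∫ x : Space, (h x : ℂ) * ((∂_{timeDir} q) (point 0 x) - η * q (point 0 x)) := by
  have hG := hκt.isCausalSymbol_waveSymbol
  rw [hp.apply_eq hκ hκt one_pos (ϑ := cutoffExp η hη.le q) ?_]
  · simp_rw [lineDerivOp_cutoffExp]
  · intro z hz
    have hg0 := hκt.hasTemperateGrowth_symbolAt_zero hκ
    have hgη := hκt.hasTemperateGrowth_symbolAt hη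
    rw [dualMultiplier_apply hg0, cutoffExp, hG.integral_eq_exp_mul hη.le (cutoffMul q)
      (L := timeFunctional (-η)) (fun z => rfl), ← dualMultiplier_apply hgη]
    have h0 : dualMultiplier (symbolAt (waveSymbol κt) η) (q - cutoffMul q) z = 0 := by
      rw [dualMultiplier_apply hgη]
      have := (hG.shift hη.le).integral_eq_zero (ε := 1) (q - cutoffMul q) (fun z hz => by
        rw [sub_apply, cutoffMul_apply, timeCutoff_eq_one hz.le, one_mul, sub_self]) hz
      rwa [IsCausalSymbol.symbolAt_shift, zero_add] at this
    rw [dualMultiplier_sub, sub_apply, sub_eq_zero] at h0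
    rw [← h0, cutoffExp_apply, timeCutoff_eq_one hz.le, one_mul]

end AttenuatedWave
end

/-! ### Sufficiency: propagation with speed 1/A when A is positive. -/

noncomputable section

namespace AttenuatedWave

section EssSupport

variable {h : Space → ℝ} {R : ℝ}

/-- Local vanishing almost everywhere becomes global because ℝ³ is second countable. -/
theorem ae_eq_zero_of_notMem_essSupport (h : Space → ℝ) :
    ∀ᵐ x, x ∉ essSupport h → h x = 0 := by
  rw [ae_iff]
  refine measure_null_of_locally_null _ fun x hx => ?_
  simp only [Set.mem_ofPred_eq, Classical.not_imp] at hx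
  have h1 := hx.1
  simp only [essSupport, Set.mem_ofPred_eq, not_forall, not_not] at h1
  obtain ⟨U, hU, hae⟩ := h1
  obtain ⟨V, hVU, hVo, hxV⟩ := mem_nhds_iff.1 hU
  have h2 := ae_restrict_of_ae_restrict_of_subset hVU hae
  rw [ae_restrict_iff' hVo.measurableSet, ae_iff] at h2
  refine ⟨V ∩ {a | ¬(a ∉ essSupport h → h a = 0)}, ?_, measure_mono_null (fun y hy => ?_) h2⟩
  · rw [Set.inter_comm]
    exact inter_mem_nhdsWithin _ (hVo.mem_nhds hxV)
  · have := hy.2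
    simp only [Set.mem_ofPred_eq, Classical.not_imp] at this ⊢
    exact ⟨hy.1, this.2⟩

theorem ae_eq_zero_of_le_norm (hR : essSupport h ⊆ Metric.ball 0 R) :
    ∀ᵐ x, x ∉ Metric.ball (0 : Space) R → h x = 0 := by
  filter_upwards [ae_eq_zero_of_notMem_essSupport h] with x hx hxR
  exact hx fun hmem => hxR (hR hmem)

theorem integrable_of_essSupport_subset_ball (hh : MemLp h 2 volume)
    (hR : essSupport h ⊆ Metric.ball 0 R) : Integrable h := by
  have : IsFiniteMeasure (volume.restrict (Metric.ball (0 : Space) R)) :=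
    ⟨by simpa using measure_ball_lt_top (μ := (volume : Measure Space)) (x := 0) (r := R)⟩
  have h1 : IntegrableOn h (Metric.ball 0 R) :=
    (hh.restrict _).integrable (by norm_num)
  exact h1.integrable_of_ae_notMem_eq_zero (ae_eq_zero_of_le_norm hR)

end EssSupport

variable {κ : ℝ → ℂ} {κt : ℂ → ℂ}

theorem dualMultiplier_smul (g : SpaceTime → ℂ) (c : ℂ) (f : 𝓢(SpaceTime, ℂ)) :
    dualMultiplier g (c • f) = c • dualMultiplier g f := by
  simp only [dualMultiplier, FourierTransform.fourierInv_smul, map_smul,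
    FourierTransform.fourier_smul]

theorem dualMultiplier_dualMultiplier_inv {g : SpaceTime → ℂ} (hg : g.HasTemperateGrowth)
    (hg' : (fun w => (g w)⁻¹).HasTemperateGrowth) (h0 : ∀ w, g w ≠ 0) (f : 𝓢(SpaceTime, ℂ)) :
    dualMultiplier g (dualMultiplier (fun w => (g w)⁻¹) f) = f := by
  rw [dualMultiplier_dualMultiplier hg hg', dualMultiplier]
  have : SchwartzMap.smulLeftCLM ℂ (g * fun w => (g w)⁻¹) (𝓕⁻ f) = 𝓕⁻ f := by
    ext w
    rw [SchwartzMap.smulLeftCLM_apply_apply (hg.mul hg'), Pi.mul_apply, mul_inv_cancel₀ (h0 w),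
      one_smul]
  rw [this, FourierTransform.fourier_fourierInv_eq]

theorem lineDerivOp_ne_zero_imp_le {V : Type*} [NormedAddCommGroup V] [NormedSpace ℝ V]
    {f : 𝓢(V, ℂ)} {L : V →L[ℝ] ℝ} {b : ℝ} (hf : ∀ z, f z ≠ 0 → L z ≤ b) (m : V) (z : V)
    (hz : (∂_{m} f) z ≠ 0) : L z ≤ b := by
  have h1 : tsupport f ⊆ {z | L z ≤ b} :=
    closure_minimal hf (isClosed_le L.continuous continuous_const)
  have h2 : tsupport (∂_{m} f : 𝓢(V, ℂ)) ⊆ tsupport f := SchwartzMap.tsupport_lineDerivOp_subset m f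
  exact h1 (h2 (subset_tsupport _ hz))

theorem lineDerivOp_expMul {V : Type*} [NormedAddCommGroup V] [NormedSpace ℝ V]
    {f : 𝓢(V, ℂ)} {L : V →L[ℝ] ℝ} {b : ℝ} (hf : ∀ z, f z ≠ 0 → L z ≤ b) (m : V) :
    ∂_{m} (expMul L b f hf) = (L m : ℂ) • expMul L b f hf +
      expMul L b (∂_{m} f) (lineDerivOp_ne_zero_imp_le hf m) := by
  ext z
  have h1 : HasDerivAt (fun t : ℝ => f (z + t • m)) ((∂_{m} f) z) 0 := by
    have := ((f.differentiableAt (x := z)).lineDifferentiableAt (v := m)).hasLineDerivAt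
    rwa [← SchwartzMap.lineDerivOp_apply] at this
  have h2 : HasDerivAt (fun t : ℝ => expMul L b f hf (z + t • m))
      ((∂_{m} (expMul L b f hf)) z) 0 := by
    have := (((expMul L b f hf).differentiableAt (x := z)).lineDifferentiableAt
      (v := m)).hasLineDerivAt
    rwa [← SchwartzMap.lineDerivOp_apply] at this
  have h3 : HasDerivAt (fun t : ℝ => (Real.exp (L (z + t • m)) : ℂ))
      (Real.exp (L z) * L m : ℝ) 0 := by
    have : HasDerivAt (fun t : ℝ => L (z + t • m)) (L m) 0 := by
      simp only [map_add, map_smul, smul_eq_mul]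
      simpa using ((hasDerivAt_id (0 : ℝ)).mul_const (L m)).const_add (L z)
    simpa using this.exp.ofReal_comp
  rw [h2.unique (h3.mul h1)]
  simp only [add_apply, smul_apply, expMul_apply, smul_eq_mul, zero_smul, add_zero]
  push_cast
  ring

/-- The causal solution, tested against a function supported in bounded time. -/
theorem IsCausalSolution.apply_eq_integral (hκ : κ.HasTemperateGrowth)
    (hκt : IsHolomorphicExtension κ κt) {h : Space → ℝ} {p : 𝓢'(SpaceTime, ℂ)}
    (hp : IsCausalSolution κ h p) {η : ℝ} (hη : 0 < η) {c : ℝ} (hc : 0 < c)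
    (hle : ∀ w, c ≤ ‖symbolAt (waveSymbol κt) η w‖) {θ : 𝓢(SpaceTime, ℂ)} {b : ℝ}
    (hθ : ∀ z, θ z ≠ 0 → timeFunctional η z ≤ b) :
    p θ = -∫ x : Space, (h x : ℂ) *
      dualMultiplier (fun w => (symbolAt (waveSymbol κt) η w)⁻¹)
        (expMul (timeFunctional η) b (∂_{timeDir} θ) (lineDerivOp_ne_zero_imp_le hθ timeDir))
        (point 0 x) := by
  have hg := hκt.hasTemperateGrowth_symbolAt hη
  have hg' := hasTemperateGrowth_inv hg hc hle
  set g := symbolAt (waveSymbol κt) η with hgdef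
  set Θ := expMul (timeFunctional η) b θ hθ with hΘ
  -- The function e^{ηt}θ is Schwartz because ηt is bounded above on the support of θ. Division by
  -- the symbol at height η, bounded away from zero, then solves the damped equation.
  set q := dualMultiplier (fun w => (g w)⁻¹) Θ with hq
  have h0 : ∀ w, g w ≠ 0 := fun w h => by
    have := hle w
    rw [h, norm_zero] at this
    linarith
  have e1 : dualMultiplier g q = Θ := dualMultiplier_dualMultiplier_inv hg hg' h0 Θ
  have e2 := hp.apply_cutoffExp hκ hκt hη q
  rw [← hgdef, e1] at e2
  have e3 : p θ = p (cutoffExp η hη.le Θ) := by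
    rw [← sub_eq_zero, ← map_sub]
    refine hp.apply_eq_zero one_pos fun z hz => ?_
    rw [sub_apply, cutoffExp_apply, timeCutoff_eq_one hz.le, one_mul, hΘ, expMul_apply,
      timeFunctional_apply, ← mul_assoc, ← Complex.ofReal_mul, ← Real.exp_add, neg_mul,
      neg_add_cancel, Real.exp_zero, Complex.ofReal_one, one_mul, sub_self]
  rw [e3, e2]
  congr 2
  funext x
  congr 1
  -- The derivative ends up on θ alone: ∂ₜ(e^{ηt}θ) - ηe^{ηt}θ = e^{ηt}∂ₜθ.
  have e4 : ∂_{timeDir} Θ = (η : ℂ) • Θ + expMul (timeFunctional η) b (∂_{timeDir} θ)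
      (lineDerivOp_ne_zero_imp_le hθ timeDir) := by
    rw [hΘ, lineDerivOp_expMul]
    congr 3
    rw [timeFunctional_apply]
    simp [timeDir]
  have e5 : expMul (timeFunctional η) b (∂_{timeDir} θ) (lineDerivOp_ne_zero_imp_le hθ timeDir) =
      ∂_{timeDir} Θ - (η : ℂ) • Θ := by
    rw [e4, add_sub_cancel_left]
  rw [e5, dualMultiplier_sub, dualMultiplier_smul, hq, lineDerivOp_dualMultiplier hg']
  rfl

/-- With a = 2π|ξ| and b = 2π⟨ξ, e⟩ this is the wave symbol with ξ moved by iy/(2π) along e; the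
move is harmless while y stays below Im k. The real part is (a² - (Re k)²) + ((Im k)² - y²), which
suffices if |Re k| ≤ |a|. Otherwise the imaginary part compensates, by the identity (xm - yb)² = (x²
- b²)(m² - y²) + (xy - bm)² with x = Re k and m = Im k. -/
theorem sub_sq_le_norm_sub_sq {a b y : ℝ} {k : ℂ} (hab : b ^ 2 ≤ a ^ 2) (hy : 0 ≤ y)
    (hk : y ≤ k.im) :
    k.im ^ 2 - y ^ 2 ≤ ‖((a ^ 2 - y ^ 2 : ℝ) : ℂ) + (2 * y * b : ℝ) * Complex.I - k ^ 2‖ := by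
  set W := ((a ^ 2 - y ^ 2 : ℝ) : ℂ) + (2 * y * b : ℝ) * Complex.I - k ^ 2 with hW
  have hre : W.re = a ^ 2 - y ^ 2 - (k.re ^ 2 - k.im ^ 2) := by
    simp [hW, sq]
  have him : W.im = 2 * y * b - 2 * k.re * k.im := by
    simp [hW, sq]
    ring
  have hd : 0 ≤ k.im ^ 2 - y ^ 2 := by nlinarith
  refine le_of_sq_le_sq ?_ (norm_nonneg _)
  rw [← Complex.normSq_eq_norm_sq, Complex.normSq_apply, hre, him]
  rcases le_total (k.re ^ 2) (a ^ 2) with h | h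
  · nlinarith [sq_nonneg (2 * y * b - 2 * k.re * k.im)]
  · have h1 : (k.re ^ 2 - b ^ 2) * (k.im ^ 2 - y ^ 2) ≤ (k.re * k.im - y * b) ^ 2 := by
      nlinarith [sq_nonneg (k.re * y - b * k.im)]
    have h2 : (k.re ^ 2 - a ^ 2) * (k.im ^ 2 - y ^ 2) ≤ (k.re ^ 2 - b ^ 2) * (k.im ^ 2 - y ^ 2) :=
      mul_le_mul_of_nonneg_right (by linarith) hd
    have h3 : 0 ≤ (k.re ^ 2 - a ^ 2) * (k.im ^ 2 - y ^ 2) := mul_nonneg (by linarith) hd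
    nlinarith [sq_nonneg (k.re ^ 2 - a ^ 2)]

/-- The symbol `4π²|ξ|² - K²`, with `ξ` shifted by `iy/(2π)` in the direction `e`. -/
def shiftedSymbol (K : ℝ → ℂ) (e : Space) (w : SpaceTime) (y : ℝ) : ℂ :=
  (((2 * Real.pi * ‖w.snd‖) ^ 2 - y ^ 2 : ℝ) : ℂ) +
    (2 * y * (2 * Real.pi * ⟪w.snd, e⟫) : ℝ) * Complex.I - K w.fst ^ 2

/-- The unit margin between the shift and Im K gives (T + 1)² - T² ≥ 1, a lower bound that does not
depend on T. -/
theorem one_le_norm_shiftedSymbol {K : ℝ → ℂ} {e : Space} (he : ‖e‖ = 1) {y T : ℝ}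
    (hy : y ∈ Set.Icc 0 T) (hK : ∀ ω, T + 1 ≤ (K ω).im) (w : SpaceTime) :
    1 ≤ ‖shiftedSymbol K e w y‖ := by
  have hyT := hy.2
  have hy0 := hy.1
  have h1 : (2 * Real.pi * ⟪w.snd, e⟫) ^ 2 ≤ (2 * Real.pi * ‖w.snd‖) ^ 2 := by
    have := abs_real_inner_le_norm w.snd e
    rw [he, mul_one] at this
    have h3 : ⟪w.snd, e⟫ ^ 2 ≤ ‖w.snd‖ ^ 2 := sq_le_sq.2 (by rwa [abs_norm])
    rw [mul_pow (2 * Real.pi), mul_pow (2 * Real.pi)]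
    exact mul_le_mul_of_nonneg_left h3 (sq_nonneg _)
  have h2 := hK w.fst
  refine le_trans ?_ (sub_sq_le_norm_sub_sq h1 hy0 (k := K w.fst) (by linarith))
  nlinarith

theorem shiftedSymbol_line (K : ℝ → ℂ) {e : Space} (he : ‖e‖ = 1) (w : SpaceTime) (ζ : ℂ) :
    shiftedSymbol K e (w + ζ.re • point 0 ((1 / (2 * Real.pi)) • e)) ζ.im =
      ((4 * Real.pi ^ 2 * ‖w.snd‖ ^ 2 : ℝ) : ℂ) + (4 * Real.pi * ⟪w.snd, e⟫ : ℝ) * ζ + ζ ^ 2 -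
        K w.fst ^ 2 := by
  have hpi := Real.pi_ne_zero
  have h1 : (w + ζ.re • point 0 ((1 / (2 * Real.pi)) • e)).fst = w.fst := by
    change w.fst + ζ.re * 0 = w.fst
    ring
  have h2 : (w + ζ.re • point 0 ((1 / (2 * Real.pi)) • e)).snd =
      w.snd + (ζ.re / (2 * Real.pi)) • e := by
    change w.snd + ζ.re • ((1 / (2 * Real.pi)) • e) = _
    rw [smul_smul, mul_one_div]
  have h3 : ‖w.snd + (ζ.re / (2 * Real.pi)) • e‖ ^ 2 =
      ‖w.snd‖ ^ 2 + 2 * (ζ.re / (2 * Real.pi)) * ⟪w.snd, e⟫ + (ζ.re / (2 * Real.pi)) ^ 2 := by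
    rw [norm_add_sq_real, real_inner_smul_right, norm_smul, he, mul_one, Real.norm_eq_abs, sq_abs]
    ring
  have h4 : ⟪w.snd + (ζ.re / (2 * Real.pi)) • e, e⟫ = ⟪w.snd, e⟫ + ζ.re / (2 * Real.pi) := by
    rw [inner_add_left, real_inner_smul_left, real_inner_self_eq_norm_sq, he]
    ring
  rw [shiftedSymbol, h1, h2, mul_pow, h3, h4]
  conv_rhs => rw [← Complex.re_add_im ζ]
  have hpi' : (Real.pi : ℂ) ≠ 0 := by exact_mod_cast hpi
  push_cast
  field_simp
  linear_combination (-(ζ.im : ℂ) ^ 2) * Complex.I_sq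

theorem shiftFunctional_space (e : Space) (T : ℝ) (z : SpaceTime) :
    shiftFunctional (point 0 ((1 / (2 * Real.pi)) • e)) T z = -T * ⟪e, z.snd⟫ := by
  have hpi := Real.pi_ne_zero
  rw [shiftFunctional_apply, spaceTime_inner, point_fst, point_snd, real_inner_smul_left]
  field_simp
  ring

theorem continuous_shiftedSymbol {K : ℝ → ℂ} (hK : Continuous K) (e : Space) (y : ℝ) :
    Continuous fun w => shiftedSymbol K e w y := by
  have h1 := continuous_fst_spaceTime
  have h2 := continuous_snd_spaceTime
  unfold shiftedSymbol
  fun_prop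

/-- The spatial shift by T costs e^{T⟨e, x⟩} at the point of evaluation and puts the weight e^{-T⟨e,
·⟩} on the test function. This is how distance in the direction e is turned into exponential
smallness. -/
theorem integral_inv_shiftedSymbol {K : ℝ → ℂ} (hK : Continuous K) {T : ℝ} (hT : 0 ≤ T)
    (hKT : ∀ ω, T + 1 ≤ (K ω).im) {e : Space} (he : ‖e‖ = 1) (z₀ : SpaceTime)
    (f : 𝓢(SpaceTime, ℂ)) {b : ℝ}
    (hf : ∀ z, f z ≠ 0 → shiftFunctional (point 0 ((1 / (2 * Real.pi)) • e)) T z ≤ b) :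
    ∫ w, ((shiftedSymbol K e w 0)⁻¹ * Complex.exp (-2 * Real.pi * Complex.I * ⟪w, z₀⟫)) *
        (𝓕⁻ f) w =
      (Real.exp (T * ⟪e, z₀.snd⟫) : ℂ) *
      ∫ w, ((shiftedSymbol K e w T)⁻¹ * Complex.exp (-2 * Real.pi * Complex.I * ⟪w, z₀⟫)) *
        (𝓕⁻ (expMul (shiftFunctional (point 0 ((1 / (2 * Real.pi)) • e)) T) b f hf)) w := by
  have hpi := Real.pi_pos
  set v : SpaceTime := point 0 ((1 / (2 * Real.pi)) • e) with hv
  have hvz : 2 * Real.pi * ⟪v, z₀⟫ = ⟪e, z₀.snd⟫ := by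
    rw [spaceTime_inner, hv, point_fst, point_snd, real_inner_smul_left]
    field_simp
    ring
  set M : SpaceTime → ℝ → ℂ := fun w y => (shiftedSymbol K e w y)⁻¹ *
    (Complex.exp (-2 * Real.pi * Complex.I * ⟪w, z₀⟫) *
      (Real.exp (2 * Real.pi * y * ⟪v, z₀⟫) : ℂ)) with hM
  have hone : ∀ y ∈ Set.Icc 0 T, ∀ w, 1 ≤ ‖shiftedSymbol K e w y‖ := fun y hy w =>
    one_le_norm_shiftedSymbol he hy hKT w
  have hne : ∀ y ∈ Set.Icc 0 T, ∀ w, shiftedSymbol K e w y ≠ 0 := fun y hy w h => by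
    have := hone y hy w
    rw [h, norm_zero] at this
    linarith
  have hline : ∀ w (ζ : ℂ), M (w + ζ.re • v) ζ.im =
      (((4 * Real.pi ^ 2 * ‖w.snd‖ ^ 2 : ℝ) : ℂ) + (4 * Real.pi * ⟪w.snd, e⟫ : ℝ) * ζ + ζ ^ 2 -
        K w.fst ^ 2)⁻¹ *
        Complex.exp (-2 * Real.pi * Complex.I * (⟪w, z₀⟫ + ζ * ⟪v, z₀⟫)) := fun w ζ => by
    simp only [hM]
    rw [IsCausalSymbol.phase_line, hv, shiftedSymbol_line K he]
  have hne' : ∀ w : SpaceTime, ∀ ζ : ℂ, ζ.im ∈ Set.Icc 0 T →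
      ((4 * Real.pi ^ 2 * ‖w.snd‖ ^ 2 : ℝ) : ℂ) + (4 * Real.pi * ⟪w.snd, e⟫ : ℝ) * ζ + ζ ^ 2 -
        K w.fst ^ 2 ≠ 0 := fun w ζ hζ => by
    rw [← shiftedSymbol_line K he]
    exact hne _ hζ _
  have key := integral_mul_fourierInv_eq_shift v hT (M := M)
    (C := Real.exp (T * |⟪e, z₀.snd⟫|)) (k := 0) ?_ ?_ ?_ ?_ ?_ f (b := b) hf
  · have e1 : (∫ w, M w 0 * (𝓕⁻ f) w) =
        ∫ w, ((shiftedSymbol K e w 0)⁻¹ * Complex.exp (-2 * Real.pi * Complex.I * ⟪w, z₀⟫)) *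
          (𝓕⁻ f) w := by
      simp [hM]
    rw [← e1, key, ← integral_const_mul]
    congr 1
    funext w
    have e4 : 2 * Real.pi * T * ⟪v, z₀⟫ = T * ⟪e, z₀.snd⟫ := by
      rw [← hvz]; ring
    simp only [hM, e4]
    ring
  · exact ((continuous_shiftedSymbol hK e 0).inv₀ (hne 0 ⟨le_rfl, hT⟩)).mul (by fun_prop)
  · exact ((continuous_shiftedSymbol hK e T).inv₀ (hne T ⟨hT, le_rfl⟩)).mul (by fun_prop)
  · intro w
    simp_rw [hline]
    refine ContinuousOn.mul (ContinuousOn.inv₀ (by fun_prop) fun ζ hζ => hne' w ζ hζ) (by fun_prop)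
  · intro w
    simp_rw [hline]
    refine DifferentiableOn.mul (DifferentiableOn.inv (by fun_prop)
      fun ζ hζ => hne' w ζ (Set.Ioo_subset_Icc_self hζ)) (by fun_prop)
  · intro w y hy
    simp only [hM]
    rw [norm_mul, norm_mul, IsCausalSymbol.norm_phase, one_mul, Complex.norm_real,
      Real.norm_of_nonneg (Real.exp_pos _).le, norm_inv, pow_zero, mul_one]
    have h1 : ‖shiftedSymbol K e w y‖⁻¹ ≤ 1 := inv_le_one_of_one_le₀ (hone y hy w)
    have h2 : 2 * Real.pi * y * ⟪v, z₀⟫ ≤ T * |⟪e, z₀.snd⟫| := by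
      have hy1 := hy.1
      have hy2 := hy.2
      calc 2 * Real.pi * y * ⟪v, z₀⟫ = y * ⟪e, z₀.snd⟫ := by rw [← hvz]; ring
        _ ≤ y * |⟪e, z₀.snd⟫| := by gcongr; exact le_abs_self _
        _ ≤ _ := by gcongr
    calc ‖shiftedSymbol K e w y‖⁻¹ * Real.exp (2 * Real.pi * y * ⟪v, z₀⟫)
        ≤ 1 * Real.exp (T * |⟪e, z₀.snd⟫|) := by gcongr
      _ = _ := one_mul _

theorem IsCausalSolution.apply_eq_zero_of_halfSpace (hκ : κ.HasTemperateGrowth)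
    (hκt : IsHolomorphicExtension κ κt) {A : ℝ} (hA : 0 < A)
    (hlow : ∀ z : ℂ, 0 < z.im → A * z.im ≤ (κt z).im) {h : Space → ℝ} {p : 𝓢'(SpaceTime, ℂ)}
    (hp : IsCausalSolution κ h p) (hint : Integrable h) {R : ℝ}
    (h0 : ∀ᵐ x, x ∉ Metric.ball (0 : Space) R → h x = 0) {e : Space} (he : ‖e‖ = 1) {t s : ℝ}
    (hts : t < A * (s - R)) {θ : 𝓢(SpaceTime, ℂ)}
    (hθ : ∀ z, θ z ≠ 0 → z.fst ≤ t ∧ s ≤ ⟪e, z.snd⟫) : p θ = 0 := by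
  have hpi := Real.pi_pos
  obtain ⟨n, D, hD, hdec⟩ := norm_integral_mul_fourierInv_expMul_le (∂_{timeDir} θ) 0
  set v : SpaceTime := point 0 ((1 / (2 * Real.pi)) • e) with hv
  have hcl : ∀ z, (∂_{timeDir} θ) z ≠ 0 → z.fst ≤ t ∧ s ≤ ⟪e, z.snd⟫ := fun z hz => by
    have h1 := continuous_fst_spaceTime
    have h2 := continuous_snd_spaceTime
    have h3 : tsupport θ ⊆ {z | z.fst ≤ t ∧ s ≤ ⟪e, z.snd⟫} :=
      closure_minimal hθ (IsClosed.inter (s₁ := {z : SpaceTime | z.fst ≤ t}) (s₂ := {z : SpaceTime | s ≤ ⟪e, z.snd⟫})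
        (isClosed_le h1 continuous_const) (isClosed_le continuous_const (continuous_const.inner h2)))
    exact h3 (SchwartzMap.tsupport_lineDerivOp_subset timeDir θ (subset_tsupport _ hz))
  have hbound : ∀ η : ℝ, 2 / A ≤ η → ‖p θ‖ ≤ (∫ x, ‖h x‖) *
      (D * Real.exp (s - R) * ((1 + A) * η) ^ n * Real.exp (-(A * (s - R) - t) * η)) := by
    intro η hη
    have hηA : 2 ≤ A * η := by rwa [div_le_iff₀' hA] at hη
    have hη0 : 0 < η := lt_of_lt_of_le (by positivity) hη
    -- The largest shift with unit margin below the bound Im κt ≥ Aη; η ≥ 2/A makes it nonnegative.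
    set T := A * η - 1 with hTdef
    have hT : 0 ≤ T := by linarith
    set K : ℝ → ℂ := fun ω => κt (((-(2 * Real.pi * ω) : ℝ) : ℂ) + η * Complex.I) with hK
    have hKc : Continuous K := hκt.continuousOn.comp_continuous (by fun_prop)
      (fun ω => by simpa using hη0.le)
    have hKT : ∀ ω, T + 1 ≤ (K ω).im := fun ω => by
      have := hlow (((-(2 * Real.pi * ω) : ℝ) : ℂ) + η * Complex.I) (by simpa using hη0)
      simp only [Complex.add_im, Complex.ofReal_im, Complex.mul_im, Complex.ofReal_re,
        Complex.I_im, Complex.I_re, mul_one, mul_zero, zero_add, add_zero] at this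
      simpa [hTdef, hK] using this
    have hsym : ∀ w, symbolAt (waveSymbol κt) η w = shiftedSymbol K e w 0 := fun w => by
      simp only [symbolAt, waveSymbol, shiftedSymbol, hK]
      push_cast
      ring
    have hle : ∀ w, 1 ≤ ‖symbolAt (waveSymbol κt) η w‖ := fun w => by
      rw [hsym]
      exact one_le_norm_shiftedSymbol he ⟨le_rfl, hT⟩ hKT w
    have hθη : ∀ z, θ z ≠ 0 → timeFunctional η z ≤ η * t := fun z hz => by
      rw [timeFunctional_apply]
      gcongr
      exact (hθ z hz).1
    rw [hp.apply_eq_integral hκ hκt hη0 one_pos hle hθη, norm_neg, ← integral_mul_const]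
    refine norm_integral_le_of_norm_le (hint.norm.mul_const _) ?_
    filter_upwards [h0] with x hx
    by_cases hxR : x ∈ Metric.ball (0 : Space) R
    swap
    · rw [hx hxR]; simp
    rw [norm_mul, Complex.norm_real]
    gcongr
    set f := expMul (timeFunctional η) (η * t) (∂_{timeDir} θ)
      (lineDerivOp_ne_zero_imp_le hθη timeDir) with hf
    have hfT : ∀ z, f z ≠ 0 → shiftFunctional v T z ≤ -T * s := fun z hz => by
      rw [hv, shiftFunctional_space]
      have h1 : (∂_{timeDir} θ) z ≠ 0 := fun h => hz (by rw [hf, expMul_apply, h, mul_zero])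
      have := (hcl z h1).2
      nlinarith
    have hLb : ∀ z, (∂_{timeDir} θ) z ≠ 0 →
        (shiftFunctional v T + timeFunctional η) z ≤ -T * s + η * t := fun z hz => by
      rw [add_apply, hv, shiftFunctional_space, timeFunctional_apply]
      have h1 := (hcl z hz).2
      have h2 := (hcl z hz).1
      nlinarith
    have hff : expMul (shiftFunctional v T) (-T * s) f hfT =
        expMul (shiftFunctional v T + timeFunctional η) (-T * s + η * t) (∂_{timeDir} θ) hLb := by
      ext z
      simp only [hf, expMul_apply, add_apply, Real.exp_add]
      push_cast
      ring
    rw [dualMultiplier_apply (hasTemperateGrowth_inv (hκt.hasTemperateGrowth_symbolAt hη0) one_pos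
      hle)]
    simp_rw [hsym]
    rw [integral_inv_shiftedSymbol hKc hT hKT he _ f hfT, hff, norm_mul, Complex.norm_real,
      Real.norm_of_nonneg (Real.exp_pos _).le, point_snd]
    have h1 := hdec (fun w => (shiftedSymbol K e w T)⁻¹ *
      Complex.exp (-2 * Real.pi * Complex.I * ⟪w, point 0 x⟫)) 1 (fun w => by
        rw [norm_mul, IsCausalSymbol.norm_phase, norm_inv, pow_zero, mul_one, mul_one]
        exact inv_le_one_of_one_le₀ (one_le_norm_shiftedSymbol he ⟨hT, le_rfl⟩ hKT w))
      _ _ hLb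
    have h2 : ‖shiftFunctional v T + timeFunctional η‖ ≤ T + η := by
      refine ContinuousLinearMap.opNorm_le_bound _ (by linarith) fun z => ?_
      rw [add_apply, hv, shiftFunctional_space, timeFunctional_apply]
      have h3 := abs_fst_le_norm z
      have h4 := (abs_real_inner_le_norm e z.snd).trans
        (mul_le_mul_of_nonneg_left (norm_snd_le_norm z) (norm_nonneg e))
      rw [he, one_mul] at h4
      refine (norm_add_le _ _).trans ?_
      rw [norm_mul, norm_mul, norm_neg, Real.norm_of_nonneg hT, Real.norm_of_nonneg hη0.le,
        Real.norm_eq_abs, Real.norm_eq_abs, add_mul]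
      gcongr
    have h3 : ⟪e, x⟫ ≤ R := by
      have := real_inner_le_norm e x
      rw [he, one_mul] at this
      have h5 : ‖x‖ < R := by simpa using hxR
      linarith
    -- The exponents add up to TR - Ts + ηt = (s - R) - (A(s - R) - t)η.
    calc Real.exp (T * ⟪e, x⟫) * _ ≤ Real.exp (T * R) * (1 * D *
          (1 + ‖shiftFunctional v T + timeFunctional η‖) ^ n * Real.exp (-T * s + η * t)) := by
          gcongr
      _ ≤ Real.exp (T * R) * (1 * D *
          (1 + (T + η)) ^ n * Real.exp (-T * s + η * t)) := by gcongr
      _ = D * ((1 + A) * η) ^ n * (Real.exp (T * R) * Real.exp (-T * s + η * t)) := by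
          rw [show 1 + (T + η) = (1 + A) * η by rw [hTdef]; ring]; ring
      _ = D * ((1 + A) * η) ^ n * (Real.exp (s - R) * Real.exp (-(A * (s - R) - t) * η)) := by
          rw [← Real.exp_add, ← Real.exp_add]
          congr 2
          rw [hTdef]; ring
      _ = _ := by ring
  have hδ : 0 < A * (s - R) - t := by linarith
  have hlim : Tendsto (fun η : ℝ => (∫ x, ‖h x‖) *
      (D * Real.exp (s - R) * ((1 + A) * η) ^ n * Real.exp (-(A * (s - R) - t) * η))) atTop
      (𝓝 0) := by
    have h1 := tendsto_rpow_mul_exp_neg_mul_atTop_nhds_zero n _ hδ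
    have h2 := h1.const_mul ((∫ x, ‖h x‖) * D * Real.exp (s - R) * (1 + A) ^ n)
    rw [mul_zero] at h2
    refine h2.congr fun η => ?_
    rw [Real.rpow_natCast, mul_pow]
    ring
  refine norm_le_zero_iff.1 (ge_of_tendsto hlim ?_)
  filter_upwards [eventually_ge_atTop (2 / A)] with η hη using hbound η hη

theorem propagatesWithSpeed_inv (hκ : IsAttenuationCoefficient κ)
    (hκt : IsHolomorphicExtension κ κt) {A : ℝ} (hA : 0 < A)
    (hlim : Tendsto (fun y : ℝ => (κt (Complex.I * y)).im / y) atTop (𝓝 A)) :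
    PropagatesWithSpeed κ A⁻¹ := by
  have hlow : ∀ z : ℂ, 0 < z.im → A * z.im ≤ (κt z).im := fun z hz =>
    hκt.mul_im_le_im hκ hA hlim hz
  refine ⟨inv_pos.2 hA, fun h hh _ p hp R hR hsupp z₀ hz₀ => ?_⟩
  have h1 := continuous_fst_spaceTime
  have h2 := continuous_snd_spaceTime
  rw [Set.mem_ofPred_eq]
  by_contra! hcon
  have ht : 0 ≤ z₀.fst := hp.causal hz₀
  have hx : 0 < ‖z₀.snd‖ := lt_of_le_of_lt (by positivity) hcon
  -- With e pointing towards z₀ and m, t slightly relaxed, z₀ lies in the open wedge {t' < t, ⟨e, x⟩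
  -- > m} with t < A(m - R), on which p vanishes.
  set e : Space := ‖z₀.snd‖⁻¹ • z₀.snd with he_def
  have he : ‖e‖ = 1 := by
    rw [he_def, norm_smul, norm_inv, norm_norm, inv_mul_cancel₀ hx.ne']
  have hez : ⟪e, z₀.snd⟫ = ‖z₀.snd‖ := by
    rw [he_def, real_inner_smul_left, real_inner_self_eq_norm_sq]
    field_simp
  obtain ⟨m, hm1, hm2⟩ := exists_between hcon
  have hm3 : z₀.fst < A * (m - R) := by
    have : A⁻¹ * z₀.fst < m - R := by linarith
    rwa [inv_mul_lt_iff₀ hA] at this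
  obtain ⟨t, ht1, ht2⟩ := exists_between hm3
  refine (Distribution.notMem_dsupport_iff z₀).2
    ⟨{z | z.fst < t ∧ m < ⟪e, z.snd⟫}, ?_, ?_, ht1, by rw [hez]; exact hm2⟩ hz₀
  · intro θ hθ
    refine hp.apply_eq_zero_of_halfSpace hκ.temperate hκt hA hlow
      (integrable_of_essSupport_subset_ball hh hsupp) (ae_eq_zero_of_le_norm hsupp) he ht2
      fun z hz => ?_
    have := hθ (subset_tsupport _ hz)
    exact ⟨this.1.le, this.2.le⟩
  · exact IsOpen.inter (s := {z : SpaceTime | z.fst < t}) (t := {z : SpaceTime | m < ⟪e, z.snd⟫})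
      (isOpen_lt h1 continuous_const) (isOpen_lt continuous_const (continuous_const.inner h2))

end AttenuatedWave
end

/-! ### Resolvent bounds that are uniform up to the real axis. -/

noncomputable section

namespace AttenuatedWave

theorem schwartzNorm_mono {V : Type*} [NormedAddCommGroup V] [NormedSpace ℝ V] {m n : ℕ}
    (hmn : m ≤ n) (f : 𝓢(V, ℂ)) : schwartzNorm m f ≤ schwartzNorm n f := by
  have hs : Finset.range (m + 1) ⊆ Finset.range (n + 1) := Finset.range_mono (by omega)
  refine (Finset.sum_le_sum fun k _ => Finset.sum_le_sum_of_subset_of_nonneg hs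
    fun _ _ _ => apply_nonneg _ _).trans (Finset.sum_le_sum_of_subset_of_nonneg hs
    fun _ _ _ => Finset.sum_nonneg fun _ _ => apply_nonneg _ _)

section Resolvent

theorem exists_integral_norm_le (V : Type*) [NormedAddCommGroup V] [InnerProductSpace ℝ V]
    [FiniteDimensional ℝ V] [MeasurableSpace V] [BorelSpace V] :
    ∃ (n : ℕ) (C : ℝ), 0 ≤ C ∧ ∀ f : 𝓢(V, ℂ),
      (∫ x, ‖f x‖) ≤ C * schwartzNorm n f ∧ (∫ x, ‖(𝓕⁻ f) x‖) ≤ C * schwartzNorm n f := by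
  have hint : ∀ q : 𝓢(V, ℂ) →L[ℂ] 𝓢(V, ℂ), ∃ (n : ℕ) (C : ℝ), 0 ≤ C ∧ ∀ f,
      (∫ x, ‖q f x‖) ≤ C * schwartzNorm n f := fun q => by
    obtain ⟨n, C, hC, h⟩ := exists_norm_apply_le
      ((SchwartzMap.toLpCLM ℂ ℂ 1 (volume : Measure V)).comp q)
    refine ⟨n, C, hC, fun f => le_trans (le_of_eq ?_) (h f)⟩
    rw [ContinuousLinearMap.comp_apply, L1.norm_eq_integral_norm]
    refine integral_congr_ae ?_
    filter_upwards [SchwartzMap.coeFn_toLp (q f) 1 (volume : Measure V)] with x hx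
    rw [← hx]
    rfl
  obtain ⟨n₁, C₁, hC₁, h₁⟩ := hint (ContinuousLinearMap.id ℂ _)
  obtain ⟨n₂, C₂, hC₂, h₂⟩ := hint (FourierTransform.fourierInvCLM ℂ 𝓢(V, ℂ))
  refine ⟨n₁ + n₂, C₁ + C₂, by positivity, fun f => ⟨(h₁ f).trans ?_, (h₂ f).trans ?_⟩⟩
  · exact mul_le_mul (by linarith) (schwartzNorm_mono (by omega) f) (schwartzNorm_nonneg _ _) (by positivity)
  · exact mul_le_mul (by linarith) (schwartzNorm_mono (by omega) f) (schwartzNorm_nonneg _ _) (by positivity)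

/-- Parseval's formula moves the Gaussian to its transform, of modulus at most (π/|b|)^{3/2}. The
bound uses |b|, so it survives when Re b is small. -/
theorem norm_integral_mul_gaussian_le (F : 𝓢(Space, ℂ)) {b : ℂ} (hb : 0 < b.re) :
    ‖∫ ξ, F ξ * Complex.exp (-b * ‖ξ‖ ^ 2)‖ ≤
      (Real.pi / ‖b‖) ^ (3 / 2 : ℝ) * ∫ x, ‖(𝓕⁻ F : 𝓢(Space, ℂ)) x‖ := by
  have hpi := Real.pi_pos
  have hb0 : b ≠ 0 := fun h => by simp [h] at hb
  have hbn : 0 < ‖b‖ := norm_pos_iff.2 hb0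
  have hg : Integrable fun ξ : Space => Complex.exp (-b * ‖ξ‖ ^ 2) := by
    simpa using GaussianFourier.integrable_cexp_neg_mul_sq_norm_add hb 0 (0 : Space)
  have h1 : ∫ ξ, F ξ * Complex.exp (-b * ‖ξ‖ ^ 2) =
      ∫ x, (𝓕⁻ F : 𝓢(Space, ℂ)) x * 𝓕 (fun ξ : Space => Complex.exp (-b * ‖ξ‖ ^ 2)) x := by
    have := VectorFourier.integral_fourierIntegral_smul_eq_flip (L := innerₗ Space)
      (μ := volume) (ν := volume) (e := Real.fourierChar) Real.continuous_fourierChar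
      continuous_inner (𝓕⁻ F : 𝓢(Space, ℂ)).integrable hg
    have e : (⇑F : Space → ℂ) = 𝓕 (⇑(𝓕⁻ F : 𝓢(Space, ℂ))) := by
      rw [← SchwartzMap.fourier_coe, FourierTransform.fourier_fourierInv_eq]
    rw [e]
    simpa using! this
  rw [h1, ← integral_const_mul]
  refine norm_integral_le_of_norm_le ((𝓕⁻ F : 𝓢(Space, ℂ)).integrable.norm.const_mul _)
    (Eventually.of_forall fun x => ?_)
  rw [norm_mul, mul_comm]
  gcongr
  rw [fourier_gaussian_innerProductSpace hb, norm_mul, Complex.norm_cpow_of_ne_zero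
    (div_ne_zero (by exact_mod_cast hpi.ne') hb0), Complex.norm_exp]
  have h2 : (-(Real.pi : ℂ) ^ 2 * ‖x‖ ^ 2 / b).re ≤ 0 := by
    have : (-(Real.pi : ℂ) ^ 2 * ‖x‖ ^ 2 / b) = ((-(Real.pi ^ 2 * ‖x‖ ^ 2) : ℝ) : ℂ) * b⁻¹ := by
      push_cast
      ring
    rw [this, Complex.re_ofReal_mul, Complex.inv_re]
    have : 0 ≤ b.re / Complex.normSq b := div_nonneg hb.le (Complex.normSq_nonneg _)
    have h3 : 0 ≤ Real.pi ^ 2 * ‖x‖ ^ 2 := by positivity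
    nlinarith
  have h4 := Real.exp_le_one_iff.2 h2
  have h5 : ((Module.finrank ℝ Space : ℂ) / 2) = ((3 / 2 : ℝ) : ℂ) := by
    simp [Space]
  rw [h5, Complex.ofReal_im, Complex.ofReal_re, mul_zero, Real.exp_zero, div_one, norm_div,
    Complex.norm_real, Real.norm_of_nonneg hpi.le]
  exact mul_le_of_le_one_right (by positivity) h4

/-- This is 1/σ = ∫₀^∞ a e^{-aστ} dτ followed by Fubini. The ray direction a is free, subject to
positivity of Re a and Re(ac), and is adapted to c afterwards. -/
theorem integral_div_eq_integral_gaussian (F : 𝓢(Space, ℂ)) {a c : ℂ} (ha : 0 < a.re)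
    (hac : 0 < (a * c).re) :
    IntegrableOn (fun τ : ℝ => a * Complex.exp (-(a * c) * τ) *
      ∫ ξ, F ξ * Complex.exp (-((4 * Real.pi ^ 2 * τ : ℝ) * a) * ‖ξ‖ ^ 2)) (Set.Ioi 0) ∧
    ∫ ξ, F ξ / (((4 * Real.pi ^ 2 * ‖ξ‖ ^ 2 : ℝ) : ℂ) + c) =
      ∫ τ in Set.Ioi (0 : ℝ), a * Complex.exp (-(a * c) * τ) *
        ∫ ξ, F ξ * Complex.exp (-((4 * Real.pi ^ 2 * τ : ℝ) * a) * ‖ξ‖ ^ 2) := by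
  have ha0 : a ≠ 0 := fun h => by simp [h] at ha
  set σ : Space → ℂ := fun ξ => ((4 * Real.pi ^ 2 * ‖ξ‖ ^ 2 : ℝ) : ℂ) + c with hσ
  have hre : ∀ ξ, (a * c).re ≤ (a * σ ξ).re := fun ξ => by
    simp only [hσ]
    rw [mul_add, Complex.add_re, Complex.re_mul_ofReal]
    have : 0 ≤ a.re * (4 * Real.pi ^ 2 * ‖ξ‖ ^ 2) := by positivity
    linarith
  have e1 : ∀ ξ, F ξ / σ ξ = ∫ τ in Set.Ioi (0 : ℝ), F ξ * (a * Complex.exp (-(a * σ ξ) * τ)) := by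
    intro ξ
    have h1 : (-(a * σ ξ)).re < 0 := by
      rw [Complex.neg_re]
      linarith [hre ξ]
    have h2 : σ ξ ≠ 0 := fun h => by simp [h] at h1
    rw [integral_const_mul, integral_const_mul, integral_exp_mul_complex_Ioi h1]
    simp only [Complex.ofReal_zero, mul_zero, Complex.exp_zero]
    field_simp
  have hprod : Integrable (Function.uncurry fun ξ (τ : ℝ) => F ξ * (a * Complex.exp (-(a * σ ξ) * τ)))
      (volume.prod (volume.restrict (Set.Ioi 0))) := by
    have hdom : Integrable (fun q : Space × ℝ => ‖F q.1‖ * (‖a‖ * Real.exp (-(a * c).re * q.2)))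
        (volume.prod (volume.restrict (Set.Ioi 0))) :=
      F.integrable.norm.mul_prod
        ((integrableOn_exp_mul_Ioi (a := -(a * c).re) (by linarith) 0).const_mul ‖a‖)
    refine hdom.mono' ?_ ?_
    · refine Continuous.aestronglyMeasurable ?_
      have := F.continuous
      simp only [Function.uncurry_def, hσ]
      fun_prop
    · have hr : (volume : Measure Space).prod ((volume : Measure ℝ).restrict (Set.Ioi 0)) =
          (volume.prod volume).restrict (Set.univ ×ˢ Set.Ioi 0) := by
        rw [← Measure.prod_restrict, Measure.restrict_univ]
      rw [hr]
      filter_upwards [ae_restrict_mem (MeasurableSet.univ.prod measurableSet_Ioi)] with q hq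
      have hq0 : 0 < q.2 := hq.2
      rw [Function.uncurry_def, norm_mul, norm_mul, Complex.norm_exp, neg_mul, Complex.neg_re,
        Complex.re_mul_ofReal, neg_mul]
      refine mul_le_mul_of_nonneg_left (mul_le_mul_of_nonneg_left (Real.exp_le_exp.2 ?_)
        (norm_nonneg _)) (norm_nonneg _)
      exact neg_le_neg (mul_le_mul_of_nonneg_right (hre q.1) hq0.le)
  have e3 : ∀ τ : ℝ, ∫ ξ, F ξ * (a * Complex.exp (-(a * σ ξ) * τ)) =
      a * Complex.exp (-(a * c) * τ) *
        ∫ ξ, F ξ * Complex.exp (-((4 * Real.pi ^ 2 * τ : ℝ) * a) * ‖ξ‖ ^ 2) := by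
    intro τ
    rw [← integral_const_mul]
    congr 1
    funext ξ
    have e2 : Complex.exp (-(a * σ ξ) * τ) = Complex.exp (-(a * c) * τ) *
        Complex.exp (-((4 * Real.pi ^ 2 * τ : ℝ) * a) * ‖ξ‖ ^ 2) := by
      rw [← Complex.exp_add]
      congr 1
      simp only [hσ]
      push_cast
      ring
    rw [e2]
    ring
  simp_rw [← e3]
  refine ⟨hprod.integral_prod_right, ?_⟩
  change ∫ ξ, F ξ / σ ξ = _
  simp_rw [e1]
  exact integral_integral_swap hprod

/-- A limiting absorption estimate: nothing on the right depends on k, although the denominator may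
vanish on a sphere in the limit of real k. -/
theorem norm_integral_div_le (F : 𝓢(Space, ℂ)) {k : ℂ} (hk : 0 < k.im) :
    ‖∫ ξ, F ξ / (((4 * Real.pi ^ 2 * ‖ξ‖ ^ 2 : ℝ) : ℂ) - k ^ 2)‖ ≤
      (∫ ξ, ‖F ξ‖) + 2 * ∫ x, ‖(𝓕⁻ F : 𝓢(Space, ℂ)) x‖ := by
  have hpi := Real.pi_pos
  have hk0 : k ≠ 0 := fun h => by simp [h] at hk
  have hkn : 0 < ‖k‖ := norm_pos_iff.2 hk0
  -- This unit vector makes both Re a = Im k/|k| and Re(-ak²) = |k| Im k positive.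
  set a : ℂ := Complex.I * (starRingEnd ℂ) k / ‖k‖ with ha
  have hkn' : (‖k‖ : ℂ) ≠ 0 := by exact_mod_cast hkn.ne'
  have hare : a.re = k.im / ‖k‖ := by
    rw [ha, Complex.div_ofReal_re]
    simp
  have han : ‖a‖ = 1 := by
    rw [ha, norm_div, norm_mul, Complex.norm_I, Complex.norm_conj, Complex.norm_real, norm_norm,
      one_mul, div_self hkn.ne']
  have hac : a * -k ^ 2 = -Complex.I * k * ‖k‖ := by
    have h1 : (starRingEnd ℂ) k * k = (‖k‖ : ℂ) ^ 2 := Complex.conj_mul' k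
    rw [ha, div_mul_eq_mul_div, div_eq_iff hkn']
    linear_combination (-Complex.I * k) * h1
  have hacre : (a * -k ^ 2).re = k.im * ‖k‖ := by
    rw [hac, Complex.re_mul_ofReal]
    simp
  have hare0 : 0 < a.re := by rw [hare]; positivity
  have hac0 : 0 < (a * -k ^ 2).re := by rw [hacre]; positivity
  simp_rw [sub_eq_add_neg]
  rw [(integral_div_eq_integral_gaussian F hare0 hac0).2]
  set N₁ := ∫ ξ, ‖F ξ‖ with hN₁
  set N₂ := ∫ x, ‖(𝓕⁻ F : 𝓢(Space, ℂ)) x‖ with hN₂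
  have hN₁0 : 0 ≤ N₁ := integral_nonneg fun _ => norm_nonneg _
  have hN₂0 : 0 ≤ N₂ := integral_nonneg fun _ => norm_nonneg _
  set G : ℝ → ℂ := fun τ => a * Complex.exp (-(a * -k ^ 2) * τ) *
    ∫ ξ, F ξ * Complex.exp (-((4 * Real.pi ^ 2 * τ : ℝ) * a) * ‖ξ‖ ^ 2) with hG
  have hbre : ∀ τ : ℝ, 0 < τ → 0 < (((4 * Real.pi ^ 2 * τ : ℝ) : ℂ) * a).re := fun τ hτ => by
    rw [Complex.re_ofReal_mul]
    positivity
  have hGle : ∀ τ : ℝ, 0 < τ → ‖G τ‖ ≤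
      ‖∫ ξ, F ξ * Complex.exp (-((4 * Real.pi ^ 2 * τ : ℝ) * a) * ‖ξ‖ ^ 2)‖ := fun τ hτ => by
    rw [hG, norm_mul, norm_mul, han, one_mul, Complex.norm_exp]
    refine mul_le_of_le_one_left (norm_nonneg _) (Real.exp_le_one_iff.2 ?_)
    rw [Complex.re_mul_ofReal, Complex.neg_re]
    nlinarith
  have hG1 : ∀ τ : ℝ, 0 < τ → ‖G τ‖ ≤ N₁ := fun τ hτ => by
    refine (hGle τ hτ).trans (norm_integral_le_of_norm_le F.integrable.norm
      (Eventually.of_forall fun ξ => ?_))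
    rw [norm_mul, Complex.norm_exp]
    refine mul_le_of_le_one_right (norm_nonneg _) (Real.exp_le_one_iff.2 ?_)
    rw [← Complex.ofReal_pow, Complex.re_mul_ofReal, Complex.neg_re]
    have := hbre τ hτ
    nlinarith [sq_nonneg ‖ξ‖]
  have hG2 : ∀ τ : ℝ, 0 < τ → ‖G τ‖ ≤ τ ^ (-(3 / 2) : ℝ) * N₂ := fun τ hτ => by
    refine (hGle τ hτ).trans ((norm_integral_mul_gaussian_le F (hbre τ hτ)).trans ?_)
    gcongr
    rw [norm_mul, han, mul_one, Complex.norm_real, Real.norm_of_nonneg (by positivity),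
      Real.rpow_neg hτ.le, ← Real.inv_rpow hτ.le]
    refine Real.rpow_le_rpow (by positivity) ?_ (by norm_num)
    rw [div_le_iff₀ (by positivity)]
    have : τ⁻¹ * (4 * Real.pi ^ 2 * τ) = 4 * Real.pi ^ 2 := by field_simp
    rw [this]
    nlinarith [Real.pi_gt_three]
  -- For small τ the trivial bound is used, for τ > 1 the dispersive one. In dimension three the
  -- latter decays like τ^{-3/2}, whose integral over (1, ∞) is 2.
  set g : ℝ → ℝ := fun τ => (Set.Ioc (0 : ℝ) 1).indicator (fun _ => N₁) τ +
    (Set.Ioi (1 : ℝ)).indicator (fun τ => τ ^ (-(3 / 2) : ℝ) * N₂) τ with hg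
  have hi1 : Integrable ((Set.Ioc (0 : ℝ) 1).indicator fun _ => N₁) :=
    (integrable_indicator_iff measurableSet_Ioc).2 (by simp)
  have hi2 : Integrable ((Set.Ioi (1 : ℝ)).indicator fun τ => τ ^ (-(3 / 2) : ℝ) * N₂) :=
    (integrable_indicator_iff measurableSet_Ioi).2
      ((integrableOn_Ioi_rpow_of_lt (by norm_num) one_pos).mul_const _)
  have hgint : ∫ τ, g τ = N₁ + 2 * N₂ := by
    rw [hg, integral_add hi1 hi2, integral_indicator measurableSet_Ioc,
      integral_indicator measurableSet_Ioi, integral_mul_const,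
      integral_Ioi_rpow_of_lt (by norm_num) one_pos]
    simp
    norm_num
  rw [← hgint]
  have hg0 : ∀ τ, 0 ≤ g τ := fun τ => by
    refine add_nonneg (Set.indicator_nonneg (fun _ _ => hN₁0) _)
      (Set.indicator_nonneg (fun τ hτ => ?_) _)
    have : (0 : ℝ) < τ := one_pos.trans hτ
    positivity
  refine (norm_integral_le_of_norm_le ((hi1.add hi2).integrableOn (s := Set.Ioi 0)) ?_).trans
    (setIntegral_le_integral (hi1.add hi2) (Eventually.of_forall hg0))
  filter_upwards [ae_restrict_mem measurableSet_Ioi] with τ hτ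
  have hτ0 : (0 : ℝ) < τ := hτ
  rcases le_or_gt τ 1 with h | h
  · have h1 : τ ∈ Set.Ioc (0 : ℝ) 1 := ⟨hτ0, h⟩
    have h2 : τ ∉ Set.Ioi (1 : ℝ) := not_lt.2 h
    refine (hG1 τ hτ0).trans (le_of_eq ?_)
    simp [h1, h2]
  · have h1 : τ ∉ Set.Ioc (0 : ℝ) 1 := fun h' => absurd h'.2 (not_le.2 h)
    have h2 : τ ∈ Set.Ioi (1 : ℝ) := h
    refine (hG2 τ hτ0).trans (le_of_eq ?_)
    simp [h1, h2]

end Resolvent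

end AttenuatedWave
end

/-! ### Slices of Schwartz functions at a fixed frequency in time. -/

noncomputable section

namespace AttenuatedWave

theorem one_add_pow_mul_norm_iteratedFDeriv_le {V : Type*} [NormedAddCommGroup V]
    [NormedSpace ℝ V] {n j k : ℕ} (hj : j ≤ n) (hk : k ≤ n) (f : 𝓢(V, ℂ)) (x : V) :
    (1 + ‖x‖) ^ k * ‖iteratedFDeriv ℝ j f x‖ ≤ 2 ^ n * schwartzNorm n f := by
  refine (SchwartzMap.one_add_le_sup_seminorm_apply (𝕜 := ℂ) (m := (n, n)) hk hj f x).trans ?_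
  gcongr
  refine Seminorm.finset_sup_apply_le (schwartzNorm_nonneg n f) fun i hi => ?_
  rw [Finset.mem_Iic] at hi
  exact seminorm_le_schwartzNorm hi.1 hi.2 f

theorem integrable_mul_schwartz {V : Type*} [NormedAddCommGroup V] [InnerProductSpace ℝ V]
    [FiniteDimensional ℝ V] [MeasurableSpace V] [BorelSpace V] {M : V → ℂ} (hM : Continuous M)
    {C : ℝ} {k : ℕ} (hb : ∀ w, ‖M w‖ ≤ C * (1 + ‖w‖) ^ k) (f : 𝓢(V, ℂ)) :
    Integrable fun w => M w * f w := by
  set d := Module.finrank ℝ V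
  have hC : 0 ≤ C := by
    have := (norm_nonneg _).trans (hb 0)
    simpa using this
  have hint : Integrable fun w : V => (1 + ‖w‖) ^ (-((d : ℝ) + 1)) :=
    integrable_one_add_norm (by linarith)
  refine (hint.const_mul (C * (2 ^ (k + (d + 1)) * schwartzNorm (k + (d + 1)) f))).mono'
    (hM.mul f.continuous).aestronglyMeasurable (Eventually.of_forall fun w => ?_)
  have hw : 0 < 1 + ‖w‖ := by positivity
  have e3 : (1 + ‖w‖) ^ (-((d : ℝ) + 1)) = ((1 + ‖w‖) ^ (d + 1))⁻¹ := by
    rw [Real.rpow_neg hw.le, ← Real.rpow_natCast]; norm_cast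
  rw [e3, ← div_eq_mul_inv, le_div_iff₀ (by positivity), norm_mul]
  have h1 := one_add_pow_mul_norm_iteratedFDeriv_le (n := k + (d + 1)) (Nat.zero_le _) le_rfl f w
  rw [norm_iteratedFDeriv_zero] at h1
  calc ‖M w‖ * ‖f w‖ * (1 + ‖w‖) ^ (d + 1)
      ≤ C * (1 + ‖w‖) ^ k * ‖f w‖ * (1 + ‖w‖) ^ (d + 1) := by
        gcongr
        exact hb w
    _ = C * ((1 + ‖w‖) ^ (k + (d + 1)) * ‖f w‖) := by rw [pow_add]; ring
    _ ≤ _ := by gcongr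

/-- The inclusion of space into space-time at time `0`. -/
def spaceInclusion : Space →L[ℝ] SpaceTime :=
  LinearMap.mkContinuous
    { toFun := fun ξ => point 0 ξ
      map_add' := fun ξ η => by
        rw [show point 0 ξ + point 0 η = point (0 + 0) (ξ + η) from rfl, add_zero]
      map_smul' := fun c ξ => by
        rw [show (RingHom.id ℝ) c • point 0 ξ = point (c * 0) (c • ξ) from rfl, mul_zero] } 1
    fun ξ => by
      rw [one_mul]
      exact (WithLp.norm_toLp_snd 2 ℝ Space ξ).le

theorem spaceInclusion_apply (ξ : Space) : spaceInclusion ξ = point 0 ξ := rfl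

theorem norm_spaceInclusion_le : ‖spaceInclusion‖ ≤ 1 :=
  LinearMap.mkContinuous_norm_le _ zero_le_one _

theorem point_eq_add (s : ℝ) (ξ : Space) : point s ξ = point s 0 + spaceInclusion ξ := by
  rw [spaceInclusion_apply, show point s 0 + point 0 ξ = point (s + 0) (0 + ξ) from rfl,
    add_zero, zero_add]

theorem contDiff_slice (s : ℝ) (Φ : 𝓢(SpaceTime, ℂ)) :
    ContDiff ℝ (⊤ : ℕ∞) fun ξ : Space => Φ (point s ξ) := by
  have h1 : (fun ξ : Space => Φ (point s ξ)) = fun ξ => Φ (point s 0 + spaceInclusion ξ) :=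
    funext fun ξ => by rw [← point_eq_add]
  rw [h1]
  have := Φ.smooth ⊤
  fun_prop

theorem norm_iteratedFDeriv_slice_le (s : ℝ) (Φ : 𝓢(SpaceTime, ℂ)) (j : ℕ) (ξ : Space) :
    ‖iteratedFDeriv ℝ j (fun ξ : Space => Φ (point s ξ)) ξ‖ ≤
      ‖iteratedFDeriv ℝ j Φ (point s ξ)‖ := by
  have h1 : (fun ξ : Space => Φ (point s ξ)) = (fun z => Φ (point s 0 + z)) ∘ spaceInclusion := by
    funext ξ
    simp only [Function.comp_apply]
    rw [← point_eq_add]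
  have h2 : ContDiff ℝ (⊤ : ℕ∞) fun z => Φ (point s 0 + z) := by
    have := Φ.smooth ⊤
    fun_prop
  rw [h1, spaceInclusion.iteratedFDeriv_comp_right h2 ξ (i := j) (mod_cast le_top),
    iteratedFDeriv_comp_add_left, ← point_eq_add]
  refine (ContinuousMultilinearMap.norm_compContinuousLinearMap_le _ _).trans ?_
  refine mul_le_of_le_one_right (norm_nonneg _) ?_
  rw [Finset.prod_const]
  exact pow_le_one₀ (norm_nonneg _) norm_spaceInclusion_le

theorem pow_mul_pow_mul_norm_iteratedFDeriv_slice_le {n m j k : ℕ} (hj : j ≤ n) (hk : k ≤ n)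
    (s : ℝ) (Φ : 𝓢(SpaceTime, ℂ)) (ξ : Space) :
    (1 + |s|) ^ m * (‖ξ‖ ^ k * ‖iteratedFDeriv ℝ j (fun ξ : Space => Φ (point s ξ)) ξ‖) ≤
      2 ^ (n + m) * schwartzNorm (n + m) Φ := by
  refine le_trans ?_ (one_add_pow_mul_norm_iteratedFDeriv_le (j := j) (k := m + k) (by omega)
    (by omega) Φ (point s ξ))
  rw [← mul_assoc, pow_add]
  have h1 := abs_fst_le_norm (point s ξ)
  have h2 := norm_snd_le_norm (point s ξ)
  rw [point_fst] at h1
  rw [point_snd] at h2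
  gcongr
  · linarith
  · exact norm_iteratedFDeriv_slice_le s Φ j ξ

/-- The restriction of a Schwartz function to a fixed time. -/
def slice (s : ℝ) (Φ : 𝓢(SpaceTime, ℂ)) : 𝓢(Space, ℂ) where
  toFun ξ := Φ (point s ξ)
  smooth' := contDiff_slice s Φ
  decay' k j := ⟨2 ^ (k + j + 0) * schwartzNorm (k + j + 0) Φ, fun ξ => by
    simpa using pow_mul_pow_mul_norm_iteratedFDeriv_slice_le (n := k + j) (m := 0) (j := j) (k := k)
      (by omega) (by omega) s Φ ξ⟩

theorem pow_mul_schwartzNorm_slice_le (n m : ℕ) (s : ℝ) (Φ : 𝓢(SpaceTime, ℂ)) :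
    (1 + |s|) ^ m * schwartzNorm n (slice s Φ) ≤
      (n + 1) ^ 2 * (2 ^ (n + m) * schwartzNorm (n + m) Φ) := by
  have hs : 0 < (1 + |s|) ^ m := by positivity
  set B := 2 ^ (n + m) * schwartzNorm (n + m) Φ with hB
  have hB0 : 0 ≤ B := mul_nonneg (by positivity) (schwartzNorm_nonneg _ _)
  have h1 : ∀ k ∈ Finset.range (n + 1), ∀ j ∈ Finset.range (n + 1),
      SchwartzMap.seminorm ℂ k j (slice s Φ) ≤ B / (1 + |s|) ^ m := by
    intro k hk j hj
    rw [Finset.mem_range] at hk hj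
    refine SchwartzMap.seminorm_le_bound ℂ k j _ (by positivity) fun ξ => ?_
    rw [le_div_iff₀' hs]
    exact pow_mul_pow_mul_norm_iteratedFDeriv_slice_le (by omega) (by omega) s Φ ξ
  have h2 : schwartzNorm n (slice s Φ) ≤ (n + 1) ^ 2 * (B / (1 + |s|) ^ m) := by
    refine (Finset.sum_le_sum fun k hk => Finset.sum_le_sum fun j hj => h1 k hk j hj).trans ?_
    simp only [Finset.sum_const, Finset.card_range, nsmul_eq_mul]
    push_cast
    exact le_of_eq (by ring)
  calc (1 + |s|) ^ m * schwartzNorm n (slice s Φ)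
      ≤ (1 + |s|) ^ m * ((n + 1) ^ 2 * (B / (1 + |s|) ^ m)) := by gcongr
    _ = _ := by field_simp

/-- The resolvent bound is applied on each slice, and seminorms of higher order of Φ pay for the
decay in s. -/
theorem exists_norm_integral_slice_div_le (m : ℕ) :
    ∃ (n : ℕ) (C : ℝ), 0 ≤ C ∧ ∀ (Φ : 𝓢(SpaceTime, ℂ)) (s : ℝ) (k : ℂ), 0 < k.im →
      ‖∫ ξ, Φ (point s ξ) / (((4 * Real.pi ^ 2 * ‖ξ‖ ^ 2 : ℝ) : ℂ) - k ^ 2)‖ ≤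
        C * schwartzNorm n Φ * ((1 + |s|) ^ m)⁻¹ := by
  obtain ⟨n, C, hC, h⟩ := exists_integral_norm_le Space
  refine ⟨n + m, 3 * C * ((n + 1) ^ 2 * 2 ^ (n + m)), by positivity, fun Φ s k hk => ?_⟩
  have h1 := norm_integral_div_le (slice s Φ) hk
  have h2 := h (slice s Φ)
  have h3 := pow_mul_schwartzNorm_slice_le n m s Φ
  rw [← div_eq_mul_inv, le_div_iff₀ (by positivity)]
  calc _ ≤ (3 * (C * schwartzNorm n (slice s Φ))) * (1 + |s|) ^ m := by
        gcongr
        refine h1.trans ?_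
        linarith [h2.1, h2.2]
    _ = 3 * C * ((1 + |s|) ^ m * schwartzNorm n (slice s Φ)) := by ring
    _ ≤ 3 * C * ((n + 1) ^ 2 * (2 ^ (n + m) * schwartzNorm (n + m) Φ)) := by gcongr
    _ = _ := by ring

theorem integral_spaceTime_eq {f : SpaceTime → ℂ} (hf : Integrable f) :
    ∫ w, f w = ∫ s : ℝ, ∫ ξ : Space, f (point s ξ) := by
  have hm := (WithLp.volume_preserving_symm_measurableEquiv_toLp_prod ℝ Space).symm
  have h1 := hm.integral_comp' f
  have h2 : Integrable (fun q : ℝ × Space => f (point q.1 q.2)) (volume.prod volume) := by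
    rw [← Measure.volume_eq_prod]
    exact (hm.integrable_comp_emb (MeasurableEquiv.measurableEmbedding _)).2 hf
  rw [← h1, Measure.volume_eq_prod]
  exact integral_prod _ h2

/-- A bound for a multiplier integral that is uniform in the distance of `k` to the real axis. -/
theorem exists_norm_integral_mul_div_le (m : ℕ) :
    ∃ (n : ℕ) (C : ℝ), 0 ≤ C ∧ ∀ (Φ : 𝓢(SpaceTime, ℂ)) (N k : ℝ → ℂ), (∀ s, 0 < (k s).im) →
      Integrable (fun w : SpaceTime => N w.fst *
        (Φ w / (((4 * Real.pi ^ 2 * ‖w.snd‖ ^ 2 : ℝ) : ℂ) - k w.fst ^ 2))) →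
      Integrable (fun s => ‖N s‖ * ((1 + |s|) ^ m)⁻¹) →
      ‖∫ w : SpaceTime, N w.fst *
        (Φ w / (((4 * Real.pi ^ 2 * ‖w.snd‖ ^ 2 : ℝ) : ℂ) - k w.fst ^ 2))‖ ≤
        C * schwartzNorm n Φ * ∫ s, ‖N s‖ * ((1 + |s|) ^ m)⁻¹ := by
  obtain ⟨n, C, hC, h⟩ := exists_norm_integral_slice_div_le m
  refine ⟨n, C, hC, fun Φ N k hk hint hint' => ?_⟩
  rw [integral_spaceTime_eq hint, ← integral_const_mul]
  refine norm_integral_le_of_norm_le (hint'.const_mul _) (Eventually.of_forall fun s => ?_)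
  simp only [point_fst, point_snd]
  rw [integral_const_mul, norm_mul]
  calc ‖N s‖ * _ ≤ ‖N s‖ * (C * schwartzNorm n Φ * ((1 + |s|) ^ m)⁻¹) := by
        gcongr
        exact h Φ s (k s) (hk s)
    _ = _ := by ring

end AttenuatedWave
end

/-! ### Limits of bounded families of functionals. -/

noncomputable section

namespace AttenuatedWave

theorem exists_schwartzNorm_apply_le {V W : Type*} [NormedAddCommGroup V] [NormedSpace ℝ V]
    [NormedAddCommGroup W] [NormedSpace ℝ W] (T : 𝓢(V, ℂ) →L[ℂ] 𝓢(W, ℂ)) (n : ℕ) :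
    ∃ (n' : ℕ) (C : ℝ), 0 ≤ C ∧ ∀ f, schwartzNorm n (T f) ≤ C * schwartzNorm n' f := by
  set q : Seminorm ℂ 𝓢(V, ℂ) := ∑ k ∈ Finset.range (n + 1), ∑ j ∈ Finset.range (n + 1),
    (SchwartzMap.seminorm ℂ k j).comp T.toLinearMap with hq
  have hqa : ∀ f, q f = schwartzNorm n (T f) := fun f => by
    rw [hq, sum_apply]
    refine Finset.sum_congr rfl fun k _ => ?_
    rw [sum_apply]
    rfl
  obtain ⟨n', C, hC, h⟩ := exists_le_schwartzNorm q (by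
    rw [show ⇑q = fun f => schwartzNorm n (T f) from funext hqa]
    refine continuous_finsetSum _ fun k _ => continuous_finsetSum _ fun j _ => ?_
    exact ((schwartz_withSeminorms ℂ W ℂ).continuous_seminorm (k, j)).comp T.continuous)
  exact ⟨n', C, hC, fun f => by rw [← hqa]; exact h f⟩

/-- A bounded family of functionals has a limit point in the space of tempered distributions. -/
theorem exists_limit_functional {V : Type*} [NormedAddCommGroup V] [NormedSpace ℝ V]
    (l : Filter ℝ) [l.NeBot] (P : ℝ → 𝓢(V, ℂ) → ℂ)
    (hadd : ∀ᶠ η in l, ∀ f g, P η (f + g) = P η f + P η g)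
    (hsmul : ∀ᶠ η in l, ∀ (c : ℂ) f, P η (c • f) = c * P η f) {n : ℕ} {C : ℝ} (hC : 0 ≤ C)
    (hb : ∀ᶠ η in l, ∀ f, ‖P η f‖ ≤ C * schwartzNorm n f) :
    ∃ (p : 𝓢'(V, ℂ)) (U : Filter ℝ), U.NeBot ∧ U ≤ l ∧
      ∀ f, Tendsto (fun η => P η f) U (𝓝 (p f)) := by
  -- For each test function the values eventually lie in a compact disc, so along an ultrafilter
  -- finer than l all of them converge simultaneously. Linearity and the Schwartz bound pass to the
  -- limit.
  set U : Ultrafilter ℝ := Ultrafilter.of l with hU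
  have hUl : (U : Filter ℝ) ≤ l := Ultrafilter.of_le l
  have hlim : ∀ f, ∃ z, Tendsto (fun η => P η f) U (𝓝 z) := fun f => by
    obtain ⟨z, -, hz⟩ := (isCompact_closedBall (0 : ℂ) (C * schwartzNorm n f)).ultrafilter_le_nhds
      (U.map fun η => P η f) (by
        rw [le_principal_iff]
        refine hUl (hb.mono fun η hη => ?_)
        simpa using hη f)
    exact ⟨z, hz⟩
  choose q hq using hlim
  refine ⟨ContinuousLinearMap.toPointwiseConvergenceCLM _ _ _ _ (SchwartzMap.mkCLMtoNormedSpace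
    (𝕜 := ℂ) (σ := RingHom.id ℂ) q ?_ ?_ ?_), U,
    inferInstance, hUl, fun f => hq f⟩
  · intro f g
    refine tendsto_nhds_unique (hq (f + g)) (((hq f).add (hq g)).congr' ?_)
    filter_upwards [hUl hadd] with η hη using (hη f g).symm
  · intro c f
    refine tendsto_nhds_unique (hq (c • f)) (((hq f).const_mul c).congr' ?_)
    filter_upwards [hUl hsmul] with η hη using (hη c f).symm
  · refine ⟨Finset.Iic (n, n), C * ((n + 1) ^ 2), by positivity, fun f => ?_⟩
    have h1 : ‖q f‖ ≤ C * schwartzNorm n f :=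
      le_of_tendsto (hq f).norm (hUl (hb.mono fun η hη => hη f))
    refine h1.trans ?_
    rw [mul_assoc]
    gcongr
    have h2 : ∀ k ∈ Finset.range (n + 1), ∀ j ∈ Finset.range (n + 1),
        SchwartzMap.seminorm ℂ k j f ≤
          (Finset.Iic (n, n)).sup (schwartzSeminormFamily ℂ V ℂ) f := by
      intro k hk j hj
      rw [Finset.mem_range] at hk hj
      have : (k, j) ∈ Finset.Iic (n, n) := Finset.mem_Iic.2 ⟨by simp; omega, by simp; omega⟩
      exact Finset.le_sup (f := schwartzSeminormFamily ℂ V ℂ) this f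
    refine (Finset.sum_le_sum fun k hk => Finset.sum_le_sum fun j hj => h2 k hk j hj).trans ?_
    simp only [Finset.sum_const, Finset.card_range, nsmul_eq_mul]
    push_cast
    exact le_of_eq (by ring)

theorem integrable_norm_mul_inv_pow {N : ℝ → ℂ} (hN : Continuous N) {B : ℝ} {k : ℕ}
    (hb : ∀ s, ‖N s‖ ≤ B * (1 + |s|) ^ k) :
    Integrable fun s => ‖N s‖ * ((1 + |s|) ^ (k + 2))⁻¹ := by
  have hint : Integrable fun s : ℝ => (1 + ‖s‖) ^ (-2 : ℝ) :=
    integrable_one_add_norm (by simp)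
  have hne : ∀ s : ℝ, (1 + |s|) ^ (k + 2) ≠ 0 := fun s => by positivity
  refine (hint.const_mul B).mono' (Continuous.aestronglyMeasurable (by fun_prop (disch := assumption)))
    (Eventually.of_forall fun s => ?_)
  have hs : 0 < 1 + |s| := by positivity
  rw [Real.norm_of_nonneg (by positivity), Real.norm_eq_abs, Real.rpow_neg hs.le,
    ← div_eq_mul_inv, div_le_iff₀ (by positivity)]
  refine (hb s).trans (le_of_eq ?_)
  rw [show ((2 : ℝ)) = ((2 : ℕ) : ℝ) by norm_num, Real.rpow_natCast, pow_add]
  field_simp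

/-- The restriction of the Fourier transform to source functions at time `0`. -/
theorem integral_mul_apply_point (g : 𝓢(Space, ℂ)) (Θ : 𝓢(SpaceTime, ℂ)) :
    ∫ x, g x * Θ (point 0 x) = ∫ w : SpaceTime, (𝓕 g : 𝓢(Space, ℂ)) w.snd * (𝓕⁻ Θ) w := by
  have h1 : ∀ x, g x * Θ (point 0 x) = ∫ w, g x *
      (Complex.exp (-2 * Real.pi * Complex.I * ⟪w, point 0 x⟫) * (𝓕⁻ Θ) w) := by
    intro x
    rw [integral_const_mul]
    congr 1
    conv_lhs => rw [← FourierTransform.fourier_fourierInv_eq (F := 𝓢(SpaceTime, ℂ)) Θ]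
    rw [SchwartzMap.fourier_coe, Real.fourier_eq']
    congr 1
    funext w
    rw [smul_eq_mul]
    congr 2
    push_cast
    ring
  have h2 : ∀ w : SpaceTime, (𝓕 g : 𝓢(Space, ℂ)) w.snd * (𝓕⁻ Θ) w = ∫ x, g x *
      (Complex.exp (-2 * Real.pi * Complex.I * ⟪w, point 0 x⟫) * (𝓕⁻ Θ) w) := by
    intro w
    simp_rw [← mul_assoc]
    rw [integral_mul_const, SchwartzMap.fourier_coe, Real.fourier_eq']
    congr 2
    funext x
    rw [smul_eq_mul, mul_comm, spaceTime_inner, point_fst, point_snd, mul_zero, zero_add,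
      real_inner_comm]
    congr 2
    push_cast
    ring
  simp_rw [h1, h2]
  refine integral_integral_swap ?_
  have hdom : Integrable (fun q : Space × SpaceTime => ‖g q.1‖ * ‖(𝓕⁻ Θ) q.2‖)
      (volume.prod volume) := g.integrable.norm.mul_prod (𝓕⁻ Θ).integrable.norm
  refine hdom.mono' ?_ (Eventually.of_forall fun q => ?_)
  · refine Continuous.aestronglyMeasurable ?_
    have h3 := g.continuous
    have h4 := (𝓕⁻ Θ).continuous
    have h5 : Continuous fun x : Space => point 0 x := spaceInclusion.continuous
    simp only [Function.uncurry_def]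
    fun_prop
  · rw [Function.uncurry_def, norm_mul, norm_mul, IsCausalSymbol.norm_phase, one_mul]

end AttenuatedWave
end

/-! ### The regularized solution operator. -/

noncomputable section

namespace AttenuatedWave

variable {κ : ℝ → ℂ} {κt : ℂ → ℂ}

/-- The symbol of the solution operator, regularized by moving the frequency off the real axis. -/
def solutionSymbol (κt : ℂ → ℂ) (g : Space → ℂ) (η : ℝ) (z : ℂ) (ξ : Space) : ℂ :=
  -(Complex.I * z) * g ξ * (waveSymbol κt (z + η * Complex.I) ξ)⁻¹

/-- The unshifted case of `sub_sq_le_norm_sub_sq`: the symbol is away from zero wherever κt z is off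
the real axis. -/
theorem im_sq_le_norm_waveSymbol {z : ℂ} (hz : 0 ≤ (κt z).im) (ξ : Space) :
    (κt z).im ^ 2 ≤ ‖waveSymbol κt z ξ‖ := by
  have h := sub_sq_le_norm_sub_sq (a := 2 * Real.pi * ‖ξ‖) (b := 0) (y := 0) (k := κt z)
    (by simpa using sq_nonneg (2 * Real.pi * ‖ξ‖)) le_rfl hz
  have e : (((2 * Real.pi * ‖ξ‖) ^ 2 - 0 ^ 2 : ℝ) : ℂ) + (2 * 0 * 0 : ℝ) * Complex.I - κt z ^ 2 =
      waveSymbol κt z ξ := by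
    rw [waveSymbol]
    push_cast
    ring
  rw [e] at h
  simpa using h

namespace IsHolomorphicExtension

theorem exists_le_norm_waveSymbol (hκ : IsAttenuationCoefficient κ)
    (hκt : IsHolomorphicExtension κ κt) {η : ℝ} (hη : 0 < η) :
    ∃ c : ℝ, 0 < c ∧ ∀ (z : ℂ) (ξ : Space), η ≤ z.im →
      c ≤ ‖waveSymbol κt z ξ‖ * (1 + ‖z‖) ^ 4 := by
  obtain ⟨c, hc, h⟩ := hκt.exists_le_im_mul hκ hη
  refine ⟨c ^ 2, by positivity, fun z ξ hz => ?_⟩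
  have h1 := im_sq_le_norm_waveSymbol (hκt.im_nonneg z (hη.le.trans hz)) ξ
  calc c ^ 2 ≤ ((κt z).im * (1 + ‖z‖) ^ 2) ^ 2 := by gcongr; exact h z hz
    _ = (κt z).im ^ 2 * (1 + ‖z‖) ^ 4 := by ring
    _ ≤ _ := by gcongr

theorem waveSymbol_ne_zero (hκ : IsAttenuationCoefficient κ)
    (hκt : IsHolomorphicExtension κ κt) {z : ℂ} (hz : 0 < z.im) (ξ : Space) :
    waveSymbol κt z ξ ≠ 0 := by
  obtain ⟨c, hc, h⟩ := hκt.exists_le_norm_waveSymbol hκ hz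
  intro h0
  have := h z ξ le_rfl
  rw [h0, norm_zero, zero_mul] at this
  linarith

/-- At height at least η the wave symbol decays no faster than the fourth power of 1/(1 + |z|), so
its reciprocal is polynomially bounded. The exponent 5 includes the factor z. -/
theorem isCausalSymbol_solutionSymbol (hκ : IsAttenuationCoefficient κ)
    (hκt : IsHolomorphicExtension κ κt) {g : Space → ℂ} (hg : Continuous g) {B : ℝ}
    (hB : ∀ ξ, ‖g ξ‖ ≤ B) {η : ℝ} (hη : 0 < η) : IsCausalSymbol (solutionSymbol κt g η) := by
  have hs := hκt.isCausalSymbol_waveSymbol.shift hη.le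
  have him : ∀ z : ℂ, 0 ≤ z.im → η ≤ (z + η * Complex.I).im := fun z hz => by
    simpa using hz
  refine ⟨?_, fun ξ => ?_, ?_⟩
  · refine ContinuousOn.mul (by fun_prop) (hs.continuousOn.inv₀ fun q hq => ?_)
    exact hκt.waveSymbol_ne_zero hκ (hη.trans_le (him q.1 hq)) q.2
  · refine DifferentiableOn.mul (by fun_prop) ((hs.differentiableOn ξ).inv fun z hz => ?_)
    exact hκt.waveSymbol_ne_zero hκ (hη.trans_le (him z (le_of_lt hz))) ξ
  · obtain ⟨c, hc, h⟩ := hκt.exists_le_norm_waveSymbol hκ hη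
    have hB0 : 0 ≤ B := (norm_nonneg _).trans (hB 0)
    refine ⟨B * ((1 + η) ^ 4 / c), 5, by positivity, fun z ξ hz => ?_⟩
    have h1 := h (z + η * Complex.I) ξ (him z hz)
    have h2 : 1 + ‖z + η * Complex.I‖ ≤ (1 + η) * (1 + ‖z‖) := by
      have := norm_add_le z (η * Complex.I)
      rw [norm_mul, Complex.norm_I, mul_one, Complex.norm_real, Real.norm_of_nonneg hη.le] at this
      nlinarith [norm_nonneg z, mul_nonneg hη.le (norm_nonneg z)]
    have h3 : ‖waveSymbol κt (z + η * Complex.I) ξ‖⁻¹ ≤ ((1 + η) * (1 + ‖z‖)) ^ 4 / c := by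
      have h4 : 0 < ‖waveSymbol κt (z + η * Complex.I) ξ‖ :=
        norm_pos_iff.2 (hκt.waveSymbol_ne_zero hκ (hη.trans_le (him z hz)) ξ)
      rw [inv_le_iff_one_le_mul₀' h4, mul_div_assoc', one_le_div hc]
      refine h1.trans ?_
      gcongr
    rw [solutionSymbol, norm_mul, norm_mul, norm_neg, norm_mul, Complex.norm_I, one_mul, norm_inv]
    calc ‖z‖ * ‖g ξ‖ * ‖waveSymbol κt (z + η * Complex.I) ξ‖⁻¹
        ≤ (1 + ‖z‖) * B * (((1 + η) * (1 + ‖z‖)) ^ 4 / c) := by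
          gcongr
          · linarith
          · exact hB ξ
      _ = B * ((1 + η) ^ 4 / c) * (1 + ‖z‖) ^ 5 * 1 := by ring
      _ ≤ _ := by
          gcongr
          exact one_le_pow₀ (by linarith [norm_nonneg ξ])

end IsHolomorphicExtension

/-- The attenuation coefficient along the line with imaginary part `η`, as a function of the
frequency. -/
def attenuationAt (κt : ℂ → ℂ) (η s : ℝ) : ℂ :=
  κt (((-(2 * Real.pi * s) : ℝ) : ℂ) + η * Complex.I)

theorem symbolAt_waveSymbol (κt : ℂ → ℂ) (η : ℝ) (w : SpaceTime) :
    symbolAt (waveSymbol κt) η w =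
      ((4 * Real.pi ^ 2 * ‖w.snd‖ ^ 2 : ℝ) : ℂ) - attenuationAt κt η w.fst ^ 2 := rfl

theorem symbolAt_solutionSymbol (κt : ℂ → ℂ) (g : Space → ℂ) (η : ℝ) (w : SpaceTime) :
    symbolAt (solutionSymbol κt g η) 0 w =
      (2 * Real.pi * w.fst * Complex.I) * g w.snd * (symbolAt (waveSymbol κt) η w)⁻¹ := by
  simp only [symbolAt, solutionSymbol, Complex.ofReal_zero, zero_mul, add_zero]
  push_cast
  ring

namespace IsHolomorphicExtension

theorem continuous_attenuationAt (hκt : IsHolomorphicExtension κ κt) {η : ℝ} (hη : 0 ≤ η) :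
    Continuous (attenuationAt κt η) :=
  hκt.continuousOn.comp_continuous (by fun_prop) fun s => by simpa using hη

theorem exists_norm_attenuationAt_le (hκt : IsHolomorphicExtension κ κt) :
    ∃ (C : ℝ) (N : ℕ), 0 ≤ C ∧ ∀ η s : ℝ, 0 ≤ η → η ≤ 1 →
      ‖attenuationAt κt η s‖ ≤ C * (1 + |s|) ^ N := by
  obtain ⟨C, N, hC, h⟩ := hκt.bound
  have hpi := Real.pi_pos
  refine ⟨C * (2 + 2 * Real.pi) ^ N, N, by positivity, fun η s hη hη1 => ?_⟩
  refine (h _ (by simpa using hη)).trans ?_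
  rw [mul_assoc C, ← mul_pow]
  gcongr
  have h1 : ‖((-(2 * Real.pi * s) : ℝ) : ℂ) + η * Complex.I‖ ≤ 2 * Real.pi * |s| + η := by
    refine (norm_add_le _ _).trans (le_of_eq ?_)
    rw [norm_mul, Complex.norm_I, mul_one, Complex.norm_real, Complex.norm_real,
      Real.norm_of_nonneg hη, norm_neg, norm_mul, Real.norm_of_nonneg (by positivity),
      Real.norm_eq_abs]
  nlinarith [abs_nonneg s]

theorem tendsto_attenuationAt (hκt : IsHolomorphicExtension κ κt) (s : ℝ) :
    Tendsto (fun η => attenuationAt κt η s) (𝓝[>] 0) (𝓝 (attenuationAt κt 0 s)) := by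
  have h1 : ContinuousOn (fun η => attenuationAt κt η s) (Set.Ici 0) :=
    hκt.continuousOn.comp (by fun_prop) fun η hη => by simpa using hη
  exact (h1 0 Set.self_mem_Ici).mono_left (nhdsWithin_mono _ Set.Ioi_subset_Ici_self)

end IsHolomorphicExtension

end AttenuatedWave
end

/-! ### Existence of causal solutions for smooth sources. -/

noncomputable section

namespace AttenuatedWave

variable {κ : ℝ → ℂ} {κt : ℂ → ℂ}

/-- The product of the Fourier transform of a source with the transform of a test function. -/
def sourceMul (g : 𝓢(Space, ℂ)) : 𝓢(SpaceTime, ℂ) →L[ℂ] 𝓢(SpaceTime, ℂ) :=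
  (SchwartzMap.smulLeftCLM ℂ fun w : SpaceTime => g w.snd).comp
    (FourierTransform.fourierInvCLM ℂ 𝓢(SpaceTime, ℂ))

theorem sourceMul_apply (g : 𝓢(Space, ℂ)) (θ : 𝓢(SpaceTime, ℂ)) (w : SpaceTime) :
    sourceMul g θ w = g w.snd * (𝓕⁻ θ) w := by
  have h : (fun w : SpaceTime => g (WithLp.sndL 2 ℝ ℝ Space w)).HasTemperateGrowth :=
    g.hasTemperateGrowth.comp (WithLp.sndL 2 ℝ ℝ Space).hasTemperateGrowth
  exact SchwartzMap.smulLeftCLM_apply_apply h _ w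

/-- The regularized solution. -/
def approxSolution (κt : ℂ → ℂ) (g : 𝓢(Space, ℂ)) (η : ℝ) (θ : 𝓢(SpaceTime, ℂ)) : ℂ :=
  ∫ w, symbolAt (solutionSymbol κt g η) 0 w * (𝓕⁻ θ) w

theorem integrable_approxSolution (hκ : IsAttenuationCoefficient κ)
    (hκt : IsHolomorphicExtension κ κt) (g : 𝓢(Space, ℂ)) {η : ℝ} (hη : 0 < η)
    (θ : 𝓢(SpaceTime, ℂ)) :
    Integrable fun w => symbolAt (solutionSymbol κt g η) 0 w * (𝓕⁻ θ) w := by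
  have hG := hκt.isCausalSymbol_solutionSymbol hκ g.continuous
    (fun ξ => SchwartzMap.norm_le_seminorm ℂ g ξ) hη
  obtain ⟨C, k, hC, hb⟩ := hG.norm_symbolAt_le
  exact integrable_mul_schwartz (hG.continuous_symbolAt le_rfl) (C := C) (k := k)
    (fun w => by simpa using hb 0 le_rfl w) _

theorem symbolAt_solutionSymbol_mul (κt : ℂ → ℂ) (g : 𝓢(Space, ℂ)) (η : ℝ)
    (θ : 𝓢(SpaceTime, ℂ)) (w : SpaceTime) :
    symbolAt (solutionSymbol κt g η) 0 w * (𝓕⁻ θ) w = (2 * Real.pi * w.fst * Complex.I) *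
      (sourceMul g θ w / (((4 * Real.pi ^ 2 * ‖w.snd‖ ^ 2 : ℝ) : ℂ) -
        attenuationAt κt η w.fst ^ 2)) := by
  rw [symbolAt_solutionSymbol, sourceMul_apply, symbolAt_waveSymbol]
  ring

theorem im_attenuationAt_pos (hκ : IsAttenuationCoefficient κ)
    (hκt : IsHolomorphicExtension κ κt) {η : ℝ} (hη : 0 < η) (s : ℝ) :
    0 < (attenuationAt κt η s).im :=
  hκt.im_pos hκ (by simpa using hη)

/-- The bound is uniform in η because the resolvent estimate ignores how close κt comes to the real
axis. The weight exponent 3 is one power for the factor s and two for integrability. -/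
theorem exists_norm_approxSolution_le (hκ : IsAttenuationCoefficient κ)
    (hκt : IsHolomorphicExtension κ κt) (g : 𝓢(Space, ℂ)) :
    ∃ (n : ℕ) (C : ℝ), 0 ≤ C ∧ ∀ η, 0 < η → ∀ θ,
      ‖approxSolution κt g η θ‖ ≤ C * schwartzNorm n θ := by
  obtain ⟨n, C, hC, h⟩ := exists_norm_integral_mul_div_le 3
  obtain ⟨n', C', hC', h'⟩ := exists_schwartzNorm_apply_le (sourceMul g) n
  set J := ∫ s : ℝ, ‖2 * Real.pi * s * Complex.I‖ * ((1 + |s|) ^ 3)⁻¹ with hJ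
  have hJ0 : 0 ≤ J := integral_nonneg fun s => by positivity
  have hJi : Integrable fun s : ℝ => ‖2 * Real.pi * s * Complex.I‖ * ((1 + |s|) ^ 3)⁻¹ :=
    integrable_norm_mul_inv_pow (k := 1) (B := 2 * Real.pi) (by fun_prop) fun s => by
      have := Real.pi_pos
      rw [norm_mul, norm_mul, norm_mul, Complex.norm_I, mul_one, Complex.norm_real,
        Complex.norm_real, Real.norm_of_nonneg this.le, Real.norm_eq_abs, pow_one,
        Complex.norm_ofNat]
      gcongr
      linarith
  refine ⟨n', C * C' * J, by positivity, fun η hη θ => ?_⟩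
  have hint := integrable_approxSolution hκ hκt g hη θ
  rw [approxSolution]
  simp_rw [symbolAt_solutionSymbol_mul] at hint ⊢
  refine (h (sourceMul g θ) (fun s => 2 * Real.pi * s * Complex.I) (attenuationAt κt η)
    (im_attenuationAt_pos hκ hκt hη) hint hJi).trans ?_
  calc C * schwartzNorm n (sourceMul g θ) * J ≤ C * (C' * schwartzNorm n' θ) * J := by
        gcongr
        exact h' θ
    _ = _ := by ring

theorem fourierInv_lineDerivOp_timeDir (ϑ : 𝓢(SpaceTime, ℂ)) (w : SpaceTime) :
    (𝓕⁻ (∂_{timeDir} ϑ) : 𝓢(SpaceTime, ℂ)) w =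
      -(2 * Real.pi * w.fst * Complex.I) * (𝓕⁻ ϑ) w := by
  have hin : (fun w : SpaceTime => (inner ℝ w timeDir : ℝ)).HasTemperateGrowth := by fun_prop
  rw [SchwartzMap.fourierInv_lineDerivOp_eq, smul_apply,
    SchwartzMap.smulLeftCLM_apply_apply hin, spaceTime_inner, timeDir, point_fst, point_snd,
    inner_zero_right, mul_one, add_zero, smul_eq_mul, Complex.real_smul]
  ring

theorem tendsto_approxSolution_dualMultiplier (hκ : IsAttenuationCoefficient κ)
    (hκt : IsHolomorphicExtension κ κt) (g : 𝓢(Space, ℂ)) (ϑ : 𝓢(SpaceTime, ℂ)) :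
    Tendsto (fun η => approxSolution κt (𝓕 g : 𝓢(Space, ℂ)) η
      (dualMultiplier (symbolAt (waveSymbol κt) 0) ϑ)) (𝓝[>] 0)
      (𝓝 (-∫ x, g x * (∂_{timeDir} ϑ) (point 0 x))) := by
  have hpi := Real.pi_pos
  have hσ := hκt.hasTemperateGrowth_symbolAt_zero hκ.temperate
  obtain ⟨C₁, N₁, hC₁, hK⟩ := hκt.exists_norm_attenuationAt_le
  set m := 2 * N₁ + 1 with hm
  obtain ⟨n, C, hC, h⟩ := exists_norm_integral_mul_div_le (m + 2)
  set ĝ : 𝓢(Space, ℂ) := 𝓕 g with hĝ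
  -- With σ_η the symbol at height η, σ₀/σ_η - 1 = (κ_η² - κ₀²)/σ_η. Thus the error in the equation
  -- has the regularized resolvent with coefficient N η, which tends to 0 by continuity of κt up to
  -- the real line and dominated convergence.
  set N : ℝ → ℝ → ℂ := fun η s => 2 * Real.pi * s * Complex.I *
    (attenuationAt κt η s ^ 2 - attenuationAt κt 0 s ^ 2) with hN
  set B : ℝ := 4 * Real.pi * C₁ ^ 2 with hB
  have hNc : ∀ η, 0 ≤ η → Continuous (N η) := fun η hη => by
    have h1 := hκt.continuous_attenuationAt hη
    have h2 := hκt.continuous_attenuationAt le_rfl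
    simp only [hN]
    fun_prop
  have hNle : ∀ η, 0 ≤ η → η ≤ 1 → ∀ s, ‖N η s‖ ≤ B * (1 + |s|) ^ m := by
    intro η hη hη1 s
    have h1 : ‖attenuationAt κt η s ^ 2 - attenuationAt κt 0 s ^ 2‖ ≤
        2 * (C₁ * (1 + |s|) ^ N₁) ^ 2 := by
      refine (norm_sub_le _ _).trans ?_
      rw [norm_pow, norm_pow, two_mul]
      gcongr
      · exact hK η s hη hη1
      · exact hK 0 s le_rfl zero_le_one
    simp only [hN]
    rw [norm_mul, norm_mul, norm_mul, norm_mul, Complex.norm_I, mul_one, Complex.norm_real,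
      Complex.norm_real, Real.norm_of_nonneg hpi.le, Real.norm_eq_abs, Complex.norm_ofNat]
    calc 2 * Real.pi * |s| * _ ≤ 2 * Real.pi * (1 + |s|) * (2 * (C₁ * (1 + |s|) ^ N₁) ^ 2) := by
          gcongr
          linarith
      _ = _ := by rw [hB, hm]; ring
  have hNi : ∀ η, 0 ≤ η → η ≤ 1 → Integrable fun s => ‖N η s‖ * ((1 + |s|) ^ (m + 2))⁻¹ :=
    fun η hη hη1 => integrable_norm_mul_inv_pow (hNc η hη) (hNle η hη hη1)
  have hlim : Tendsto (fun η => ∫ s, ‖N η s‖ * ((1 + |s|) ^ (m + 2))⁻¹) (𝓝[>] 0) (𝓝 0) := by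
    have hev : ∀ᶠ η : ℝ in 𝓝[>] 0, 0 < η ∧ η ≤ 1 := by
      filter_upwards [self_mem_nhdsWithin, nhdsWithin_le_nhds (eventually_le_nhds one_pos)]
        with η h1 h2 using ⟨h1, h2⟩
    have hbi : Integrable fun s : ℝ => ‖((B * (1 + |s|) ^ m : ℝ) : ℂ)‖ *
        ((1 + |s|) ^ (m + 2))⁻¹ :=
      integrable_norm_mul_inv_pow (B := B) (k := m) (by fun_prop) fun s => by
        rw [Complex.norm_real, Real.norm_of_nonneg (by positivity)]
    have := tendsto_integral_filter_of_dominated_convergence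
      (μ := (volume : Measure ℝ)) (l := 𝓝[>] (0 : ℝ))
      (F := fun η s => ‖N η s‖ * ((1 + |s|) ^ (m + 2))⁻¹) (f := fun _ => 0) _ ?_ ?_ hbi ?_
    · simpa using this
    · filter_upwards [hev] with η hη using (hNi η hη.1.le hη.2).aestronglyMeasurable
    · filter_upwards [hev] with η hη
      refine Eventually.of_forall fun s => ?_
      rw [Real.norm_of_nonneg (by positivity), Complex.norm_real,
        Real.norm_of_nonneg (by positivity)]
      gcongr
      exact hNle η hη.1.le hη.2 s
    · refine Eventually.of_forall fun s => ?_
      have h1 : Tendsto (fun η => N η s) (𝓝[>] 0) (𝓝 0) := by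
        have h2 := (((hκt.tendsto_attenuationAt s).pow 2).sub_const
          (attenuationAt κt 0 s ^ 2)).const_mul (2 * Real.pi * s * Complex.I)
        simpa using h2
      simpa using h1.norm.mul_const ((1 + |s|) ^ (m + 2))⁻¹
  have hF₂ : Integrable fun w : SpaceTime =>
      (2 * Real.pi * w.fst * Complex.I * ĝ w.snd) * (𝓕⁻ ϑ) w := by
    have h1 := continuous_fst_spaceTime
    have h2 := continuous_snd_spaceTime
    have h3 := ĝ.continuous
    refine integrable_mul_schwartz (k := 1)
      (C := 2 * Real.pi * SchwartzMap.seminorm ℂ 0 0 ĝ) (by fun_prop) (fun w => ?_) _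
    rw [norm_mul, norm_mul, norm_mul, norm_mul, Complex.norm_I, mul_one, Complex.norm_real,
      Complex.norm_real, Real.norm_of_nonneg hpi.le, Real.norm_eq_abs, Complex.norm_ofNat, pow_one]
    have h4 := abs_fst_le_norm w
    have h5 := SchwartzMap.norm_le_seminorm ℂ ĝ w.snd
    calc 2 * Real.pi * |w.fst| * ‖ĝ w.snd‖
        ≤ 2 * Real.pi * (1 + ‖w‖) * SchwartzMap.seminorm ℂ 0 0 ĝ := by
          gcongr
          linarith
      _ = _ := by ring
  have hrhs : -∫ x, g x * (∂_{timeDir} ϑ) (point 0 x) =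
      ∫ w : SpaceTime, (2 * Real.pi * w.fst * Complex.I * ĝ w.snd) * (𝓕⁻ ϑ) w := by
    rw [integral_mul_apply_point, ← integral_neg]
    congr 1
    funext w
    rw [fourierInv_lineDerivOp_timeDir]
    ring
  rw [hrhs, tendsto_iff_norm_sub_tendsto_zero]
  have hlim' := hlim.const_mul (C * schwartzNorm n (sourceMul ĝ ϑ))
  rw [mul_zero] at hlim'
  refine squeeze_zero' (Eventually.of_forall fun η => norm_nonneg _) ?_ hlim'
  filter_upwards [self_mem_nhdsWithin, nhdsWithin_le_nhds (eventually_le_nhds one_pos)] with η h1 h2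
  have hη : 0 < η := h1
  have hF₁ := integrable_approxSolution hκ hκt ĝ hη
    (dualMultiplier (symbolAt (waveSymbol κt) 0) ϑ)
  have hdiff : ∀ w : SpaceTime, symbolAt (solutionSymbol κt ĝ η) 0 w *
        (𝓕⁻ (dualMultiplier (symbolAt (waveSymbol κt) 0) ϑ)) w -
      (2 * Real.pi * w.fst * Complex.I * ĝ w.snd) * (𝓕⁻ ϑ) w =
      N η w.fst * (sourceMul ĝ ϑ w / (((4 * Real.pi ^ 2 * ‖w.snd‖ ^ 2 : ℝ) : ℂ) -
        attenuationAt κt η w.fst ^ 2)) := by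
    intro w
    have hne : ((4 * Real.pi ^ 2 * ‖w.snd‖ ^ 2 : ℝ) : ℂ) - attenuationAt κt η w.fst ^ 2 ≠ 0 :=
      hκt.waveSymbol_ne_zero hκ (z := ((-(2 * Real.pi * w.fst) : ℝ) : ℂ) + η * Complex.I)
        (by simpa using hη) w.snd
    rw [dualMultiplier, FourierTransform.fourierInv_fourier_eq,
      SchwartzMap.smulLeftCLM_apply_apply hσ, symbolAt_solutionSymbol, sourceMul_apply,
      symbolAt_waveSymbol, symbolAt_waveSymbol, smul_eq_mul]
    simp only [hN]
    field_simp
    ring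
  have hint := hF₁.sub hF₂
  rw [approxSolution, ← integral_sub hF₁ hF₂]
  have hint' : Integrable fun w : SpaceTime => N η w.fst * (sourceMul ĝ ϑ w /
      (((4 * Real.pi ^ 2 * ‖w.snd‖ ^ 2 : ℝ) : ℂ) - attenuationAt κt η w.fst ^ 2)) :=
    hint.congr (Eventually.of_forall hdiff)
  simp_rw [hdiff]
  exact h (sourceMul ĝ ϑ) (N η) (attenuationAt κt η) (im_attenuationAt_pos hκ hκt hη) hint'
    (hNi η hη.le h2)

/-- Existence of causal solutions for smooth sources. -/
theorem exists_isCausalSolution (hκ : IsAttenuationCoefficient κ)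
    (hκt : IsHolomorphicExtension κ κt) {h : Space → ℝ} {g : 𝓢(Space, ℂ)}
    (hg : ∀ x, g x = h x) : ∃ p, IsCausalSolution κ h p := by
  set ĝ : 𝓢(Space, ℂ) := 𝓕 g with hĝ
  obtain ⟨n, C, hC, hb⟩ := exists_norm_approxSolution_le hκ hκt ĝ
  have hpos : ∀ᶠ η : ℝ in 𝓝[>] 0, 0 < η := self_mem_nhdsWithin
  -- Any limit point works: on test functions of the form σ₀ϑ the full limit is known, and causality
  -- holds already for every η > 0.
  obtain ⟨p, U, hU, hUl, hp⟩ := exists_limit_functional (𝓝[>] (0 : ℝ)) (approxSolution κt ĝ)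
    (by
      filter_upwards [hpos] with η hη f₁ f₂
      simp only [approxSolution]
      rw [← integral_add (integrable_approxSolution hκ hκt ĝ hη f₁)
        (integrable_approxSolution hκ hκt ĝ hη f₂)]
      congr 1
      funext w
      rw [FourierTransform.fourierInv_add, add_apply]
      ring)
    (Eventually.of_forall fun η c f => by
      simp only [approxSolution]
      rw [← integral_const_mul]
      congr 1
      funext w
      rw [FourierTransform.fourierInv_smul, smul_apply, smul_eq_mul]
      ring) hC (hpos.mono fun η hη => hb η hη)
  refine ⟨p, ⟨fun ϑ => ?_, fun z hz => ?_⟩⟩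
  · rw [← apply_dualMultiplier_waveSymbol hκ.temperate hκt]
    refine tendsto_nhds_unique (hp _) ?_
    simp_rw [← hg]
    exact (tendsto_approxSolution_dualMultiplier hκ hκt g ϑ).mono_left hUl
  · rw [Set.mem_ofPred_eq]
    by_contra! hcon
    refine (Distribution.notMem_dsupport_iff z).2
      ⟨{z' | z'.fst < z.fst / 2}, fun θ hθ => ?_,
        isOpen_lt continuous_fst_spaceTime continuous_const, ?_⟩ hz
    · refine tendsto_nhds_unique (hp θ) (tendsto_const_nhds.congr' ?_)
      filter_upwards [hUl hpos] with η hη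
      have hG := hκt.isCausalSymbol_solutionSymbol hκ ĝ.continuous
        (fun ξ => SchwartzMap.norm_le_seminorm ℂ ĝ ξ) hη
      -- The regularized functional is the value at the origin of a causal multiplier applied to θ,
      -- and θ lives at times before z.fst / 2 < 0.
      have h0 := hG.integral_eq_zero (ε := -z.fst / 2) θ (fun z' hz' => by
        by_contra hne
        have h1 : z'.fst < z.fst / 2 := hθ (subset_tsupport _ hne)
        linarith) (z₀ := 0) (by
          have : (0 : SpaceTime).fst = 0 := rfl
          rw [this]; linarith)
      rw [approxSolution]
      simpa using h0.symm
    · change z.fst < z.fst / 2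
      linarith

end AttenuatedWave
end

/-! ### Tensor products and truncated exponentials in time. -/

noncomputable section

namespace AttenuatedWave

section Tensor

theorem norm_iteratedFDeriv_comp_le {V W : Type*} [NormedAddCommGroup V] [NormedSpace ℝ V]
    [NormedAddCommGroup W] [NormedSpace ℝ W] (f : 𝓢(W, ℂ)) (A : V →L[ℝ] W) (hA : ‖A‖ ≤ 1) (j : ℕ)
    (x : V) : ‖iteratedFDeriv ℝ j (fun x => f (A x)) x‖ ≤ ‖iteratedFDeriv ℝ j f (A x)‖ := by
  rw [show (fun x => f (A x)) = f ∘ A from rfl,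
    A.iteratedFDeriv_comp_right (f.smooth ⊤) x (i := j) (mod_cast le_top)]
  refine (ContinuousMultilinearMap.norm_compContinuousLinearMap_le _ _).trans ?_
  refine mul_le_of_le_one_right (norm_nonneg _) ?_
  rw [Finset.prod_const]
  exact pow_le_one₀ (norm_nonneg _) hA

theorem norm_fstL_le : ‖WithLp.fstL 2 ℝ ℝ Space‖ ≤ 1 :=
  ContinuousLinearMap.opNorm_le_bound _ zero_le_one fun z => by
    rw [one_mul]; exact abs_fst_le_norm z

theorem norm_sndL_le : ‖WithLp.sndL 2 ℝ ℝ Space‖ ≤ 1 :=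
  ContinuousLinearMap.opNorm_le_bound _ zero_le_one fun z => by
    rw [one_mul]; exact norm_snd_le_norm z

theorem norm_le_norm_fst_add_norm_snd (z : SpaceTime) : ‖z‖ ≤ |z.fst| + ‖z.snd‖ := by
  have h : z = point z.fst 0 + point 0 z.snd := by
    rw [show point z.fst 0 + point 0 z.snd = point (z.fst + 0) (0 + z.snd) from rfl, add_zero,
      zero_add]
    rfl
  calc ‖z‖ = ‖point z.fst 0 + point 0 z.snd‖ := by rw [← h]
    _ ≤ _ := norm_add_le _ _
    _ = _ := by
      rw [point, point, WithLp.norm_toLp_fst 2 ℝ Space, WithLp.norm_toLp_snd 2 ℝ Space,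
        Real.norm_eq_abs]

/-- The tensor product of Schwartz functions in time and in space. -/
def tensor (φ : 𝓢(ℝ, ℂ)) (ψ : 𝓢(Space, ℂ)) : 𝓢(SpaceTime, ℂ) where
  toFun z := φ (WithLp.fstL 2 ℝ ℝ Space z) * ψ (WithLp.sndL 2 ℝ ℝ Space z)
  smooth' := by
    have h1 := φ.smooth ⊤
    have h2 := ψ.smooth ⊤
    fun_prop
  decay' k n := by
    set N := k + n with hN
    refine ⟨∑ i ∈ Finset.range (n + 1), (n.choose i : ℝ) *
      ((2 ^ N * schwartzNorm N φ) * (2 ^ N * schwartzNorm N ψ)), fun z => ?_⟩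
    have h1 := φ.smooth ⊤
    have h2 := ψ.smooth ⊤
    refine (mul_le_mul_of_nonneg_left (norm_iteratedFDeriv_mul_le (n := n) (N := ((⊤ : ℕ∞) : WithTop ℕ∞))
      (f := fun z => φ (WithLp.fstL 2 ℝ ℝ Space z)) (g := fun z => ψ (WithLp.sndL 2 ℝ ℝ Space z))
      (by fun_prop) (by fun_prop) z (mod_cast le_top)) (by positivity)).trans ?_
    rw [Finset.mul_sum]
    refine Finset.sum_le_sum fun i hi => ?_
    have hi' : i ≤ n := Nat.lt_succ_iff.1 (Finset.mem_range.1 hi)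
    have e1 := norm_iteratedFDeriv_comp_le φ _ norm_fstL_le i z
    have e2 := norm_iteratedFDeriv_comp_le ψ _ norm_sndL_le (n - i) z
    have e3 := one_add_pow_mul_norm_iteratedFDeriv_le (n := N) (j := i) (k := k) (by omega)
      (by omega) φ (WithLp.fstL 2 ℝ ℝ Space z)
    have e4 := one_add_pow_mul_norm_iteratedFDeriv_le (n := N) (j := n - i) (k := k) (by omega)
      (by omega) ψ (WithLp.sndL 2 ℝ ℝ Space z)
    have e5 : ‖z‖ ≤ (1 + ‖WithLp.fstL 2 ℝ ℝ Space z‖) * (1 + ‖WithLp.sndL 2 ℝ ℝ Space z‖) := by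
      have := norm_le_norm_fst_add_norm_snd z
      have h3 : ‖WithLp.fstL 2 ℝ ℝ Space z‖ = |z.fst| := rfl
      have h4 : ‖WithLp.sndL 2 ℝ ℝ Space z‖ = ‖z.snd‖ := rfl
      rw [h3, h4]
      nlinarith [mul_nonneg (abs_nonneg z.fst) (norm_nonneg z.snd)]
    calc ‖z‖ ^ k * ((n.choose i : ℝ) *
          ‖iteratedFDeriv ℝ i (fun z => φ (WithLp.fstL 2 ℝ ℝ Space z)) z‖ *
          ‖iteratedFDeriv ℝ (n - i) (fun z => ψ (WithLp.sndL 2 ℝ ℝ Space z)) z‖)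
        ≤ ((1 + ‖WithLp.fstL 2 ℝ ℝ Space z‖) * (1 + ‖WithLp.sndL 2 ℝ ℝ Space z‖)) ^ k *
          ((n.choose i : ℝ) * ‖iteratedFDeriv ℝ i φ (WithLp.fstL 2 ℝ ℝ Space z)‖ *
          ‖iteratedFDeriv ℝ (n - i) ψ (WithLp.sndL 2 ℝ ℝ Space z)‖) := by gcongr
      _ = (n.choose i : ℝ) *
          (((1 + ‖WithLp.fstL 2 ℝ ℝ Space z‖) ^ k *
            ‖iteratedFDeriv ℝ i φ (WithLp.fstL 2 ℝ ℝ Space z)‖) *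
          ((1 + ‖WithLp.sndL 2 ℝ ℝ Space z‖) ^ k *
            ‖iteratedFDeriv ℝ (n - i) ψ (WithLp.sndL 2 ℝ ℝ Space z)‖)) := by
          rw [mul_pow]; ring
      _ ≤ _ := by
          gcongr
          exact mul_nonneg (by positivity) (schwartzNorm_nonneg _ _)

theorem tensor_apply (φ : 𝓢(ℝ, ℂ)) (ψ : 𝓢(Space, ℂ)) (z : SpaceTime) :
    tensor φ ψ z = φ z.fst * ψ z.snd := rfl

end Tensor

section TimeExp

theorem contDiff_cutoff_exp (η T : ℝ) :
    ContDiff ℝ (⊤ : ℕ∞) fun t : ℝ => Real.smoothTransition (t - T + 2) * Real.exp (-η * t) := by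
  have h : ContDiff ℝ (⊤ : ℕ∞) Real.smoothTransition := Real.smoothTransition.contDiff
  fun_prop

/-- Outside a compact interval the function is zero on the left and a pure decaying exponential on
the right. -/
theorem exists_pow_mul_norm_iteratedFDeriv_cutoff_exp_le {η : ℝ} (hη : 0 < η) (T : ℝ) (k n : ℕ) :
    ∃ C : ℝ, ∀ t : ℝ, ‖t‖ ^ k * ‖iteratedFDeriv ℝ n
      (fun t : ℝ => Real.smoothTransition (t - T + 2) * Real.exp (-η * t)) t‖ ≤ C := by
  set f : ℝ → ℝ := fun t => Real.smoothTransition (t - T + 2) * Real.exp (-η * t) with hf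
  have hcont : Continuous fun t : ℝ => ‖t‖ ^ k * ‖iteratedFDeriv ℝ n f t‖ := by
    have := (contDiff_cutoff_exp η T).continuous_iteratedFDeriv (m := n) (mod_cast le_top)
    fun_prop
  obtain ⟨C, hC⟩ := isCompact_Icc.exists_bound_of_continuousOn (s := Set.Icc (T - 2) (max T 0))
    hcont.continuousOn
  have hC0 : ∀ t ∈ Set.Icc (T - 2) (max T 0), ‖t‖ ^ k * ‖iteratedFDeriv ℝ n f t‖ ≤ C :=
    fun t ht => (le_abs_self _).trans (hC t ht)
  refine ⟨max (max C 0) (k.factorial / η ^ k * η ^ n), fun t => ?_⟩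
  rcases lt_or_ge t (T - 2) with h1 | h1
  · have : f =ᶠ[𝓝 t] fun _ => 0 := by
      filter_upwards [eventually_lt_nhds h1] with s hs
      rw [hf]
      simp only
      rw [Real.smoothTransition.zero_of_nonpos (by linarith), zero_mul]
    rw [(this.iteratedFDeriv ℝ n).eq_of_nhds]
    have h0 : iteratedFDeriv ℝ n (fun _ : ℝ => (0 : ℝ)) t = 0 := by
      rw [iteratedFDeriv_fun_zero]; rfl
    rw [h0, norm_zero, mul_zero]
    exact (le_max_right _ _).trans (le_max_left _ _)
  rcases le_or_gt t (max T 0) with h2 | h2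
  · exact (hC0 t ⟨h1, h2⟩).trans ((le_max_left _ _).trans (le_max_left _ _))
  · have hT : T < t := (le_max_left _ _).trans_lt h2
    have h0 : 0 < t := (le_max_right _ _).trans_lt h2
    set L : ℝ →L[ℝ] ℝ := (-η) • ContinuousLinearMap.id ℝ ℝ with hL
    have : f =ᶠ[𝓝 t] fun s => Real.exp (L s) := by
      filter_upwards [eventually_gt_nhds hT] with s hs
      rw [hf]
      simp only
      rw [Real.smoothTransition.one_of_one_le (by linarith), one_mul]
      rfl
    rw [(this.iteratedFDeriv ℝ n).eq_of_nhds]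
    refine le_trans ?_ (le_max_right _ _)
    have h3 := norm_iteratedFDeriv_exp_le L n t
    have h4 : ‖L‖ ≤ η := by
      refine ContinuousLinearMap.opNorm_le_bound _ hη.le fun s => ?_
      change ‖-η * s‖ ≤ _
      rw [norm_mul, norm_neg, Real.norm_of_nonneg hη.le]
    have h5 : (η * t) ^ k / k.factorial ≤ Real.exp (η * t) :=
      Real.pow_div_factorial_le_exp (η * t) (by positivity) k
    have h6 : t ^ k * Real.exp (L t) ≤ k.factorial / η ^ k := by
      change t ^ k * Real.exp (-η * t) ≤ _
      rw [neg_mul, Real.exp_neg, ← div_eq_mul_inv, div_le_div_iff₀ (Real.exp_pos _) (by positivity)]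
      rw [div_le_iff₀ (by positivity), mul_pow] at h5
      linarith
    rw [Real.norm_of_nonneg h0.le]
    calc t ^ k * ‖iteratedFDeriv ℝ n (fun s => Real.exp (L s)) t‖
        ≤ t ^ k * (η ^ n * Real.exp (L t)) := by
          gcongr
          exact h3.trans (by gcongr)
      _ = (t ^ k * Real.exp (L t)) * η ^ n := by ring
      _ ≤ _ := by gcongr

/-- The function `χ(t - T) e^{-ηt}`. -/
def timeExp (η : ℝ) (hη : 0 < η) (T : ℝ) : 𝓢(ℝ, ℂ) where
  toFun t := ((Real.smoothTransition (t - T + 2) * Real.exp (-η * t) : ℝ) : ℂ)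
  smooth' := Complex.ofRealCLM.contDiff.comp (contDiff_cutoff_exp η T)
  decay' k n := by
    obtain ⟨C, hC⟩ := exists_pow_mul_norm_iteratedFDeriv_cutoff_exp_le hη T k n
    refine ⟨C, fun t => le_of_eq_of_le ?_ (hC t)⟩
    congr 1
    exact Complex.ofRealLI.norm_iteratedFDeriv_comp_left
      (contDiff_cutoff_exp η T).contDiffAt (i := n) (mod_cast le_top)

theorem timeExp_apply {η : ℝ} (hη : 0 < η) (T t : ℝ) :
    timeExp η hη T t = (Real.smoothTransition (t - T + 2) * Real.exp (-η * t) : ℝ) := rfl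

theorem timeExp_of_le {η : ℝ} (hη : 0 < η) {T t : ℝ} (ht : T - 1 ≤ t) :
    timeExp η hη T t = (Real.exp (-η * t) : ℝ) := by
  rw [timeExp_apply, Real.smoothTransition.one_of_one_le (by linarith), one_mul]

theorem timeExp_eq_zero {η : ℝ} (hη : 0 < η) {T t : ℝ} (ht : t ≤ T - 2) :
    timeExp η hη T t = 0 := by
  rw [timeExp_apply, Real.smoothTransition.zero_of_nonpos (by linarith), zero_mul,
    Complex.ofReal_zero]

end TimeExp

end AttenuatedWave
end

/-! ### The Laplace transform in time of a causal solution. -/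

noncomputable section

namespace AttenuatedWave

variable {κ : ℝ → ℂ} {κt : ℂ → ℂ}

/-- The difference quotient of κt² at iη is holomorphic because the singularity is removable. It is
bounded near iη by compactness and polynomially bounded elsewhere because the denominator exceeds
η/2. Up to a factor i, z - iη is the symbol of ∂ₜ + η, which annihilates e^{-ηt}. -/
theorem IsHolomorphicExtension.exists_isCausalSymbol_sub (hκt : IsHolomorphicExtension κ κt)
    {η : ℝ} (hη : 0 < η) :
    ∃ r : ℂ → ℂ, IsCausalSymbol (fun z (_ : Space) => r z) ∧
      ∀ z, κt z ^ 2 = κt (Complex.I * η) ^ 2 + (z - Complex.I * η) * r z := by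
  set a : ℂ := Complex.I * η with ha
  have haim : a.im = η := by simp [ha]
  have hopen : IsOpen {z : ℂ | 0 < z.im} := isOpen_lt continuous_const Complex.continuous_im
  have hmem : {z : ℂ | 0 < z.im} ∈ 𝓝 a := hopen.mem_nhds (by
    rw [Set.mem_ofPred_eq, haim]; exact hη)
  have hmem' : {z : ℂ | 0 ≤ z.im} ∈ 𝓝 a := mem_of_superset hmem fun z hz =>
    (le_of_lt (show 0 < z.im from hz) : 0 ≤ z.im)
  set f : ℂ → ℂ := fun z => κt z ^ 2 with hf
  have hfc : ContinuousOn f {z | 0 ≤ z.im} := hκt.continuousOn.pow 2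
  have hfd : DifferentiableOn ℂ f {z | 0 < z.im} := hκt.differentiableOn.pow 2
  have hc : ContinuousOn (dslope f a) {z | 0 ≤ z.im} :=
    (continuousOn_dslope hmem').2 ⟨hfc, hfd.differentiableAt hmem⟩
  have hid : ∀ z, f z = f a + (z - a) * dslope f a z := fun z => by
    have := sub_smul_dslope f a z
    rw [smul_eq_mul] at this
    rw [this]
    ring
  refine ⟨dslope f a, ⟨?_, fun _ => (Complex.differentiableOn_dslope hmem).2 hfd, ?_⟩, hid⟩
  · exact hc.comp (f := fun q : ℂ × Space => q.1) (by fun_prop) fun q hq => hq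
  · obtain ⟨C, N, hC, hb⟩ := hκt.bound
    have hsub : Metric.closedBall a (η / 2) ⊆ {z : ℂ | 0 ≤ z.im} := fun z hz => by
      have h1 : |(z - a).im| ≤ η / 2 := (Complex.abs_im_le_norm _).trans (by
        rwa [← dist_eq_norm])
      rw [Complex.sub_im, haim, abs_le] at h1
      rw [Set.mem_ofPred_eq]
      linarith [h1.1]
    obtain ⟨B, hB⟩ := (isCompact_closedBall a (η / 2)).exists_bound_of_continuousOn (hc.mono hsub)
    have hB0 : 0 ≤ B := (norm_nonneg _).trans (hB a (Metric.mem_closedBall_self (by positivity)))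
    set D := B + 2 / η * (C ^ 2 + ‖f a‖) with hD
    have hD0 : 0 ≤ D := by positivity
    refine ⟨D, 2 * N, hD0, fun z ξ hz => ?_⟩
    have hz1 : 1 ≤ (1 + ‖z‖) ^ (2 * N) := one_le_pow₀ (by linarith [norm_nonneg z])
    have hξ1 : 1 ≤ (1 + ‖ξ‖) ^ (2 * N) := one_le_pow₀ (by linarith [norm_nonneg ξ])
    refine le_trans ?_ (le_mul_of_one_le_right (by positivity) hξ1)
    by_cases hza : z ∈ Metric.closedBall a (η / 2)
    · calc ‖dslope f a z‖ ≤ B := hB z hza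
        _ ≤ D := by
          rw [hD]
          have : 0 ≤ 2 / η * (C ^ 2 + ‖f a‖) := by positivity
          linarith
        _ ≤ _ := le_mul_of_one_le_right hD0 hz1
    · have hdist : η / 2 < ‖z - a‖ := by
        rw [← dist_eq_norm]
        simpa using hza
      have h1 : (z - a) * dslope f a z = f z - f a := by rw [hid z]; ring
      have h2 : ‖z - a‖ * ‖dslope f a z‖ ≤ (C ^ 2 + ‖f a‖) * (1 + ‖z‖) ^ (2 * N) := by
        rw [← norm_mul, h1]
        refine (norm_sub_le _ _).trans ?_
        have h3 : ‖f z‖ ≤ C ^ 2 * (1 + ‖z‖) ^ (2 * N) := by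
          rw [hf, norm_pow]
          calc ‖κt z‖ ^ 2 ≤ (C * (1 + ‖z‖) ^ N) ^ 2 := by gcongr; exact hb z hz
            _ = _ := by rw [mul_pow, ← pow_mul, mul_comm N]
        have h4 : ‖f a‖ ≤ ‖f a‖ * (1 + ‖z‖) ^ (2 * N) := le_mul_of_one_le_right (norm_nonneg _) hz1
        linarith
      have h3 : η / 2 * ‖dslope f a z‖ ≤ (C ^ 2 + ‖f a‖) * (1 + ‖z‖) ^ (2 * N) :=
        le_trans (by gcongr) h2
      calc ‖dslope f a z‖ = 2 / η * (η / 2 * ‖dslope f a z‖) := by field_simp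
        _ ≤ 2 / η * ((C ^ 2 + ‖f a‖) * (1 + ‖z‖) ^ (2 * N)) := by gcongr
        _ = 2 / η * (C ^ 2 + ‖f a‖) * (1 + ‖z‖) ^ (2 * N) := by ring
        _ ≤ _ := by
          gcongr
          rw [hD]
          linarith

theorem hasTemperateGrowth_norm_sq_add (c : ℝ) :
    (fun ξ : Space => ((4 * Real.pi ^ 2 * ‖ξ‖ ^ 2 + c : ℝ) : ℂ)).HasTemperateGrowth := by
  have h1 : (fun ξ : Space => 4 * Real.pi ^ 2 * ‖ξ‖ ^ 2 + c).HasTemperateGrowth :=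
    ((Function.HasTemperateGrowth.const (4 * Real.pi ^ 2)).mul
      (Function.hasTemperateGrowth_norm_sq Space)).add (Function.HasTemperateGrowth.const c)
  exact Complex.ofRealCLM.hasTemperateGrowth.comp h1

theorem hasTemperateGrowth_inv_norm_sq_add {c : ℝ} (hc : 0 < c) :
    (fun ξ : Space => (((4 * Real.pi ^ 2 * ‖ξ‖ ^ 2 + c : ℝ) : ℂ))⁻¹).HasTemperateGrowth :=
  hasTemperateGrowth_inv (hasTemperateGrowth_norm_sq_add c) hc fun ξ => by
    have : 0 ≤ 4 * Real.pi ^ 2 * ‖ξ‖ ^ 2 := by positivity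
    rw [Complex.norm_real, Real.norm_of_nonneg (by linarith)]
    linarith

/-- The resolvent `(c - Δ)⁻¹` of the Laplacian. -/
def laplaceResolvent (c : ℝ) (ψ : 𝓢(Space, ℂ)) : 𝓢(Space, ℂ) :=
  dualMultiplier (fun ξ : Space => (((4 * Real.pi ^ 2 * ‖ξ‖ ^ 2 + c : ℝ) : ℂ))⁻¹) ψ

theorem fourierInv_laplaceResolvent {c : ℝ} (hc : 0 < c) (ψ : 𝓢(Space, ℂ)) (ξ : Space) :
    (𝓕⁻ (laplaceResolvent c ψ) : 𝓢(Space, ℂ)) ξ =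
      (((4 * Real.pi ^ 2 * ‖ξ‖ ^ 2 + c : ℝ) : ℂ))⁻¹ * (𝓕⁻ ψ : 𝓢(Space, ℂ)) ξ := by
  rw [laplaceResolvent, dualMultiplier, FourierTransform.fourierInv_fourier_eq,
    SchwartzMap.smulLeftCLM_apply_apply (hasTemperateGrowth_inv_norm_sq_add hc), smul_eq_mul]

theorem hasDerivAt_line (q : 𝓢(SpaceTime, ℂ)) (z : SpaceTime) :
    HasDerivAt (fun t : ℝ => q (point t z.snd)) ((∂_{timeDir} q) z) z.fst := by
  have h1 := ((q.differentiableAt (x := z)).lineDifferentiableAt (v := timeDir)).hasLineDerivAt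
  rw [← SchwartzMap.lineDerivOp_apply] at h1
  have h2 : HasDerivAt (fun t : ℝ => q (z + t • timeDir)) ((∂_{timeDir} q) z) (z.fst - z.fst) := by
    rw [sub_self]; exact h1
  have h3 := h2.comp_sub_const z.fst z.fst
  refine h3.congr_of_eventuallyEq (Eventually.of_forall fun t => ?_)
  simp only
  congr 1
  apply (WithLp.equiv 2 (ℝ × Space)).injective
  refine Prod.ext ?_ ?_
  · change t = z.fst + (t - z.fst) * 1
    ring
  · change z.snd = z.snd + (t - z.fst) • (0 : Space)
    simp

theorem lineDerivOp_tensor_timeExp {η : ℝ} (hη : 0 < η) (u : 𝓢(Space, ℂ)) {z : SpaceTime}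
    (hz : -1 < z.fst) :
    (∂_{timeDir} (tensor (timeExp η hη 0) u)) z = -η * tensor (timeExp η hη 0) u z := by
  have h1 := hasDerivAt_line (tensor (timeExp η hη 0) u) z
  have h2 : HasDerivAt (fun t : ℝ => (Real.exp (-η * t) : ℂ) * u z.snd)
      (((Real.exp (-η * z.fst) * (-η) : ℝ) : ℂ) * u z.snd) z.fst := by
    have : HasDerivAt (fun t : ℝ => Real.exp (-η * t)) (Real.exp (-η * z.fst) * (-η)) z.fst := by
      simpa using ((hasDerivAt_id z.fst).const_mul (-η)).exp
    exact this.ofReal_comp.mul_const _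
  have h3 : (fun t : ℝ => tensor (timeExp η hη 0) u (point t z.snd)) =ᶠ[𝓝 z.fst]
      fun t : ℝ => (Real.exp (-η * t) : ℂ) * u z.snd := by
    filter_upwards [eventually_gt_nhds hz] with t ht
    rw [tensor_apply, point_fst, point_snd, timeExp_of_le hη (by linarith)]
  rw [h1.unique (h2.congr_of_eventuallyEq h3), tensor_apply, timeExp_of_le hη (by linarith)]
  push_cast
  ring

/-- With κt(iη) = iμ the symbol splits as (4π²|ξ|² + μ²) - (z - iη)r(z). The first term undoes the
resolvent. The second applies the causal symbol r to (∂ₜ + η)(e^{-ηt}u), cut off in the past, which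
vanishes for t > -1, and so does its image. -/
theorem dualMultiplier_tensor_timeExp (hκ : IsAttenuationCoefficient κ)
    (hκt : IsHolomorphicExtension κ κt) {η : ℝ} (hη : 0 < η) (ψ : 𝓢(Space, ℂ)) {z : SpaceTime}
    (hz : -1 < z.fst) :
    dualMultiplier (symbolAt (waveSymbol κt) 0) (tensor (timeExp η hη 0)
      (laplaceResolvent ((κt (Complex.I * η)).im ^ 2) ψ)) z = tensor (timeExp η hη 0) ψ z := by
  set μ := (κt (Complex.I * η)).im with hμ
  have hμ0 : 0 < μ := hκt.im_pos hκ (by simpa using hη)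
  set φ := timeExp η hη 0 with hφ
  set u := laplaceResolvent (μ ^ 2) ψ with hu
  obtain ⟨r, hr, hrid⟩ := hκt.exists_isCausalSymbol_sub hη
  have hκη : κt (Complex.I * η) ^ 2 = -(μ : ℂ) ^ 2 := by
    rw [hκt.apply_I_mul hκ hη.le, ← hμ, mul_pow, Complex.I_sq]
    ring
  set ϕ := ∂_{timeDir} (tensor φ u) + (η : ℂ) • tensor φ u with hϕ
  have hsplit : ∀ w, (symbolAt (waveSymbol κt) 0 w *
      Complex.exp (-2 * Real.pi * Complex.I * ⟪w, z⟫)) * (𝓕⁻ (tensor φ u)) w =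
      (Complex.exp (-2 * Real.pi * Complex.I * ⟪w, z⟫)) * (𝓕⁻ (tensor φ ψ)) w +
      Complex.I * ((symbolAt (fun z (_ : Space) => r z) 0 w *
        Complex.exp (-2 * Real.pi * Complex.I * ⟪w, z⟫)) * (𝓕⁻ ϕ) w) := by
    intro w
    have h1 : (𝓕⁻ ϕ) w = -(2 * Real.pi * w.fst * Complex.I) * (𝓕⁻ (tensor φ u)) w +
        η * (𝓕⁻ (tensor φ u)) w := by
      rw [hϕ, FourierTransform.fourierInv_add, FourierTransform.fourierInv_smul, add_apply,
        smul_apply, fourierInv_lineDerivOp_timeDir, smul_eq_mul]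
    rw [h1, fourierInv_tensor φ u (tensor φ u) (tensor_apply φ u),
      fourierInv_tensor φ ψ (tensor φ ψ) (tensor_apply φ ψ), hu,
      fourierInv_laplaceResolvent (by positivity)]
    have h2 : symbolAt (waveSymbol κt) 0 w = ((4 * Real.pi ^ 2 * ‖w.snd‖ ^ 2 + μ ^ 2 : ℝ) : ℂ) -
        (((-(2 * Real.pi * w.fst) : ℝ) : ℂ) - Complex.I * η) *
          symbolAt (fun z (_ : Space) => r z) 0 w := by
      simp only [symbolAt, waveSymbol, Complex.ofReal_zero, zero_mul, add_zero]
      rw [hrid, hκη]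
      push_cast
      ring
    have h3 : ((4 * Real.pi ^ 2 * ‖w.snd‖ ^ 2 + μ ^ 2 : ℝ) : ℂ) ≠ 0 := by
      have : 0 < 4 * Real.pi ^ 2 * ‖w.snd‖ ^ 2 + μ ^ 2 := by positivity
      exact_mod_cast this.ne'
    rw [h2]
    generalize ((4 * Real.pi ^ 2 * ‖w.snd‖ ^ 2 + μ ^ 2 : ℝ) : ℂ) = s at h3 ⊢
    field_simp
    push_cast
    linear_combination ((2 * Real.pi * w.fst) * symbolAt (fun z (_ : Space) => r z) 0 w *
      (𝓕⁻ φ) w.fst * (𝓕⁻ ψ) w.snd) * Complex.I_sq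
  have hint₁ : Integrable fun w => (Complex.exp (-2 * Real.pi * Complex.I * ⟪w, z⟫)) *
      (𝓕⁻ (tensor φ ψ)) w :=
    integrable_mul_schwartz (by fun_prop) (C := 1) (k := 0)
      (fun w => by rw [IsCausalSymbol.norm_phase]; simp) _
  have hint₂ : Integrable fun w => (symbolAt (fun z (_ : Space) => r z) 0 w *
      Complex.exp (-2 * Real.pi * Complex.I * ⟪w, z⟫)) * (𝓕⁻ ϕ) w := by
    obtain ⟨C, k, hC, hb⟩ := hr.norm_symbolAt_le
    refine integrable_mul_schwartz (M := fun w => symbolAt (fun z (_ : Space) => r z) 0 w *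
      Complex.exp (-2 * Real.pi * Complex.I * ⟪w, z⟫)) ((hr.continuous_symbolAt le_rfl).mul (by fun_prop)) (C := C)
      (k := k) (fun w => ?_) _
    rw [norm_mul, IsCausalSymbol.norm_phase, mul_one]
    simpa using hb 0 le_rfl w
  rw [dualMultiplier_apply (hκt.hasTemperateGrowth_symbolAt_zero hκ.temperate)]
  simp_rw [hsplit]
  rw [integral_add hint₁ (hint₂.const_mul _), integral_const_mul,
    hr.integral_eq_zero (ε := 1) ϕ (fun z' hz' => ?_) hz, mul_zero, add_zero]
  · conv_rhs => rw [← FourierTransform.fourier_fourierInv_eq (F := 𝓢(SpaceTime, ℂ)) (tensor φ ψ)]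
    rw [SchwartzMap.fourier_coe, Real.fourier_eq']
    congr 1
    funext w
    rw [smul_eq_mul]
    congr 2
    push_cast
    ring
  · rw [hϕ, add_apply, smul_apply, hφ, lineDerivOp_tensor_timeExp hη u hz', smul_eq_mul]
    ring

/-- An exact formula for the Laplace transform of p at η: the time variable disappears and only the
elliptic resolvent at μ(η)² remains. -/
theorem IsCausalSolution.apply_tensor_timeExp (hκ : IsAttenuationCoefficient κ)
    (hκt : IsHolomorphicExtension κ κt) {h : Space → ℝ} {p : 𝓢'(SpaceTime, ℂ)}
    (hp : IsCausalSolution κ h p) {η : ℝ} (hη : 0 < η) (ψ : 𝓢(Space, ℂ)) :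
    p (tensor (timeExp η hη 0) ψ) =
      η * ∫ x, (h x : ℂ) * laplaceResolvent ((κt (Complex.I * η)).im ^ 2) ψ x := by
  rw [hp.apply_eq hκ.temperate hκt one_pos fun z hz =>
    dualMultiplier_tensor_timeExp hκ hκt hη ψ hz, ← integral_neg, ← integral_const_mul]
  congr 1
  funext x
  rw [lineDerivOp_tensor_timeExp hη _ (by simp), tensor_apply, point_fst, point_snd,
    timeExp_of_le hη (by norm_num)]
  simp
  ring

end AttenuatedWave
end

/-! ### Lower bounds for the Laplace resolvent by heat kernels. -/

noncomputable section

namespace AttenuatedWave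

section GaussianLowerBound

theorem integral_fourier_mul_eq {f g : Space → ℂ} (hf : Integrable f) (hg : Integrable g) :
    ∫ ξ, 𝓕 f ξ * g ξ = ∫ x, f x * 𝓕 g x := by
  simpa using! VectorFourier.integral_fourierIntegral_smul_eq_flip (L := innerₗ Space)
    (μ := volume) (ν := volume) (e := Real.fourierChar) Real.continuous_fourierChar
    continuous_inner hf hg

/-- With b = 4π²τ the kernel on the right is the heat kernel at time τ; its positivity is what the
lower bound exploits. -/
theorem integral_fourier_mul_fourierInv_mul_gaussian (g ψ : 𝓢(Space, ℂ)) {b : ℝ} (hb : 0 < b) :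
    ∫ ξ, 𝓕 g ξ * 𝓕⁻ ψ ξ * Complex.exp (-b * ‖ξ‖ ^ 2) =
      ∫ x, g x * ∫ y, ψ y *
        (((Real.pi / b) ^ (3 / 2 : ℝ) * Real.exp (-Real.pi ^ 2 * ‖x - y‖ ^ 2 / b) : ℝ) : ℂ) := by
  have hb' : 0 < (b : ℂ).re := hb
  have hgauss : ∀ x : Space, Integrable fun ξ : Space =>
      Complex.exp (-b * ‖ξ‖ ^ 2 + 2 * Real.pi * Complex.I * ⟪x, ξ⟫) := fun x =>
    GaussianFourier.integrable_cexp_neg_mul_sq_norm_add hb' _ x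
  have hG : Integrable fun ξ : Space => 𝓕⁻ ψ ξ * Complex.exp (-b * ‖ξ‖ ^ 2) := by
    refine (𝓕⁻ ψ).integrable.mul_bdd (c := 1) (by fun_prop) (Eventually.of_forall fun ξ => ?_)
    rw [show (-b * ‖ξ‖ ^ 2 : ℂ) = ((-(b * ‖ξ‖ ^ 2) : ℝ) : ℂ) by push_cast; ring,
      Complex.norm_exp_ofReal, Real.exp_le_one_iff, neg_nonpos]
    positivity
  simp_rw [mul_assoc]
  rw [SchwartzMap.fourier_coe, integral_fourier_mul_eq g.integrable hG]
  congr 1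
  funext x
  congr 1
  rw [Real.fourier_eq', ← integral_neg_eq_self]
  have h1 : ∀ ξ : Space, Complex.exp (((-2 * Real.pi * ⟪-ξ, x⟫ : ℝ) : ℂ) * Complex.I) •
      (𝓕⁻ ψ (-ξ) * Complex.exp (-b * ‖-ξ‖ ^ 2)) =
      𝓕 (⇑ψ) ξ * Complex.exp (-b * ‖ξ‖ ^ 2 + 2 * Real.pi * Complex.I * ⟪x, ξ⟫) := fun ξ => by
    rw [SchwartzMap.fourierInv_coe, Real.fourierInv_eq_fourier_neg, neg_neg, norm_neg,
      inner_neg_left, real_inner_comm, smul_eq_mul, Complex.exp_add]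
    push_cast
    rw [show (-2 * Real.pi * -(⟪x, ξ⟫ : ℂ) * Complex.I) = 2 * Real.pi * Complex.I * ⟪x, ξ⟫ by ring]
    ring
  simp_rw [h1]
  rw [integral_fourier_mul_eq ψ.integrable (hgauss x)]
  congr 1
  funext y
  congr 1
  have h2 : ((Module.finrank ℝ Space : ℂ) / 2) = ((3 / 2 : ℝ) : ℂ) := by
    simp [Space]
  rw [fourier_gaussian_innerProductSpace' hb', h2, Complex.ofReal_mul,
    Complex.ofReal_cpow (by positivity)]
  push_cast
  rfl

/-- Replacing the exponent 3/2 by 2 costs nothing that matters and keeps the final bound rational in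
μ. -/
theorem sq_le_rpow_three_halves {s t : ℝ} (hs : 0 < s) (hs1 : s ≤ 1) (hst : s ≤ t) :
    s ^ 2 ≤ t ^ (3 / 2 : ℝ) := by
  calc s ^ 2 = s ^ (2 : ℝ) := (Real.rpow_two s).symm
    _ ≤ s ^ (3 / 2 : ℝ) := Real.rpow_le_rpow_of_exponent_ge hs hs1 (by norm_num)
    _ ≤ t ^ (3 / 2 : ℝ) := by gcongr

variable {g ψ : 𝓢(Space, ℂ)} {h k : Space → ℝ} {D : ℝ}

theorem integral_mul_integral_mul_ge (hg : ∀ x, g x = h x) (hψ : ∀ x, ψ x = k x)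
    (hh : ∀ x, 0 ≤ h x) (hk : ∀ x, 0 ≤ k x) {K : Space → Space → ℝ}
    (hK : Continuous fun q : Space × Space => K q.1 q.2) {B m : ℝ} (hK0 : ∀ x y, 0 ≤ K x y)
    (hKB : ∀ x y, K x y ≤ B) (hm : ∀ x y, h x ≠ 0 → k y ≠ 0 → m ≤ K x y) :
    m * ((∫ x, h x) * ∫ y, k y) ≤ ∫ x, h x * ∫ y, k y * K x y := by
  have hhi : Integrable h := by
    have := g.integrable (μ := volume).re
    exact this.congr (Eventually.of_forall fun x => by simp [hg])
  have hki : Integrable k := by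
    have := ψ.integrable (μ := volume).re
    exact this.congr (Eventually.of_forall fun x => by simp [hψ])
  have hbd : ∀ x y, ‖K x y‖ ≤ B := fun x y => by
    rw [Real.norm_of_nonneg (hK0 x y)]; exact hKB x y
  have hin : ∀ x, Integrable fun y => k y * K x y := fun x =>
    hki.mul_bdd (c := B) ((hK.comp (by fun_prop : Continuous fun y : Space => (x, y)))
      |>.aestronglyMeasurable) (Eventually.of_forall fun y => hbd x y)
  have hout : Integrable fun x => h x * ∫ y, k y * K x y := by
    have h1 : Integrable fun q : Space × Space => (h q.1 * k q.2) * K q.1 q.2 :=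
      (hhi.mul_prod hki).mul_bdd (c := B) hK.aestronglyMeasurable
        (Eventually.of_forall fun q => hbd q.1 q.2)
    refine h1.integral_prod_left.congr (Eventually.of_forall fun x => ?_)
    simp only
    rw [← integral_const_mul]
    simp_rw [mul_assoc]
  have e : m * ((∫ x, h x) * ∫ y, k y) = ∫ x, h x * (m * ∫ y, k y) := by
    rw [integral_mul_const]; ring
  rw [e]
  refine integral_mono (hhi.mul_const _) hout fun x => ?_
  by_cases hx : h x = 0
  · simp [hx]
  refine mul_le_mul_of_nonneg_left ?_ (hh x)
  rw [← integral_const_mul]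
  refine integral_mono (hki.const_mul m) (hin x) fun y => ?_
  by_cases hy : k y = 0
  · simp [hy]
  simp only
  rw [mul_comm]
  exact mul_le_mul_of_nonneg_left (hm x y hx hy) (hk y)

/-- The resolvent is ∫₀^∞ e^{-μ²τ} e^{τΔ} dτ with positive kernels, so restricting τ to a short
interval gives a lower bound. All that matters later is the rate e^{-μD}; the other factors are
algebraic in μ. -/
theorem le_norm_integral_mul_laplaceResolvent (hg : ∀ x, g x = h x) (hψ : ∀ x, ψ x = k x)
    (hh : ∀ x, 0 ≤ h x) (hk : ∀ x, 0 ≤ k x) (hD : 0 < D)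
    (hdist : ∀ x y, h x ≠ 0 → k y ≠ 0 → ‖x - y‖ ≤ D) {μ : ℝ} (hμ : 0 < μ) :
    Real.exp (-μ * D - 1) * ((1 + 4 * Real.pi * (D / (2 * μ) + (μ ^ 2)⁻¹))⁻¹) ^ 2 * (μ ^ 2)⁻¹ *
      ((∫ x, h x) * ∫ y, k y) ≤ ‖∫ x, (h x : ℂ) * laplaceResolvent (μ ^ 2) ψ x‖ := by
  have hpi := Real.pi_pos
  -- The minimum of μ²τ + D²/(4τ), equal to μD, is attained at this time. On the interval of length
  -- μ⁻² after it, e^{-μ²τ} loses at most a further factor e⁻¹.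
  set τ₀ := D / (2 * μ) with hτ₀
  set τ₁ := τ₀ + (μ ^ 2)⁻¹ with hτ₁
  have hτ₀0 : 0 < τ₀ := by positivity
  have hτ₁0 : 0 < τ₁ := by positivity
  set s := (1 + 4 * Real.pi * τ₁)⁻¹ with hs
  set F : 𝓢(Space, ℂ) := SchwartzMap.smulLeftCLM ℂ (⇑(𝓕 g : 𝓢(Space, ℂ))) (𝓕⁻ ψ) with hF
  have hFapp : ∀ ξ, F ξ = 𝓕 g ξ * 𝓕⁻ ψ ξ := fun ξ =>
    SchwartzMap.smulLeftCLM_apply_apply (𝓕 g : 𝓢(Space, ℂ)).hasTemperateGrowth _ ξ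
  set K : ℝ → Space → Space → ℝ := fun τ x y =>
    (Real.pi / (4 * Real.pi ^ 2 * τ)) ^ (3 / 2 : ℝ) *
      Real.exp (-Real.pi ^ 2 * ‖x - y‖ ^ 2 / (4 * Real.pi ^ 2 * τ)) with hK
  set J : ℝ → ℝ := fun τ => ∫ x, h x * ∫ y, k y * K τ x y with hJ
  have hJ0 : ∀ τ, 0 < τ → 0 ≤ J τ := fun τ hτ => integral_nonneg fun x =>
    mul_nonneg (hh x) (integral_nonneg fun y => mul_nonneg (hk y) (by positivity))
  have h1 : ∫ x, (h x : ℂ) * laplaceResolvent (μ ^ 2) ψ x =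
      ∫ ξ, F ξ / (((4 * Real.pi ^ 2 * ‖ξ‖ ^ 2 : ℝ) : ℂ) + ((μ ^ 2 : ℝ) : ℂ)) := by
    calc ∫ x, (h x : ℂ) * laplaceResolvent (μ ^ 2) ψ x
        = ∫ x, g x * (𝓕 (𝓕⁻ (laplaceResolvent (μ ^ 2) ψ)) : 𝓢(Space, ℂ)) x := by
          simp_rw [FourierTransform.fourier_fourierInv_eq, hg]
      _ = _ := by
        rw [← SchwartzMap.integral_fourier_mul_eq]
        congr 1
        funext ξ
        rw [fourierInv_laplaceResolvent (by positivity), hFapp, Complex.ofReal_add]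
        ring
  have hre : 0 < ((1 : ℂ) * ((μ ^ 2 : ℝ) : ℂ)).re := by
    rw [one_mul, Complex.ofReal_re]; positivity
  obtain ⟨hint, heq⟩ := integral_div_eq_integral_gaussian F (a := 1) (by simp) hre
  have h2 : ∀ τ ∈ Set.Ioi (0 : ℝ), (1 : ℂ) * Complex.exp (-(1 * ((μ ^ 2 : ℝ) : ℂ)) * τ) *
      ∫ ξ, F ξ * Complex.exp (-((4 * Real.pi ^ 2 * τ : ℝ) * 1) * ‖ξ‖ ^ 2) =
      ((Real.exp (-μ ^ 2 * τ) * J τ : ℝ) : ℂ) := by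
    intro τ hτ
    have hτ' : 0 < τ := hτ
    simp_rw [hFapp, mul_one, one_mul]
    rw [integral_fourier_mul_fourierInv_mul_gaussian g ψ (by positivity)]
    simp_rw [hg, hψ, ← Complex.ofReal_mul, integral_complex_ofReal, ← Complex.ofReal_mul,
      integral_complex_ofReal]
    rw [Complex.ofReal_mul]
    push_cast
    rw [neg_mul]
  have hint' : IntegrableOn (fun τ => Real.exp (-μ ^ 2 * τ) * J τ) (Set.Ioi 0) := by
    have := (hint.congr_fun h2 measurableSet_Ioi).re
    exact this.congr (Eventually.of_forall fun τ => Complex.ofReal_re _)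
  rw [h1, heq, setIntegral_congr_fun measurableSet_Ioi h2, integral_complex_ofReal]
  rw [Complex.norm_real]
  refine le_trans ?_ (le_abs_self _)
  have hsub : Set.Icc τ₀ τ₁ ⊆ Set.Ioi 0 := fun τ hτ => hτ₀0.trans_le hτ.1
  refine le_trans ?_ (setIntegral_mono_set hint' ?_ hsub.eventuallyLE)
  swap
  · refine (ae_restrict_mem measurableSet_Ioi).mono fun τ hτ => ?_
    exact mul_nonneg (Real.exp_pos _).le (hJ0 τ hτ)
  have hvol : volume.real (Set.Icc τ₀ τ₁) = (μ ^ 2)⁻¹ := by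
    rw [Real.volume_real_Icc_of_le (by rw [hτ₁]; linarith [inv_pos.2 (pow_pos hμ 2)]), hτ₁]
    ring
  have hlow : ∀ τ ∈ Set.Icc τ₀ τ₁, Real.exp (-μ * D - 1) * s ^ 2 * ((∫ x, h x) * ∫ y, k y) ≤
      Real.exp (-μ ^ 2 * τ) * J τ := by
    intro τ hτ
    have hτ0 : 0 < τ := hsub hτ
    have hmul : s ^ 2 * Real.exp (-(μ * D / 2)) * ((∫ x, h x) * ∫ y, k y) ≤ J τ := by
      refine integral_mul_integral_mul_ge hg hψ hh hk (K := K τ) ?_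
        (B := (Real.pi / (4 * Real.pi ^ 2 * τ)) ^ (3 / 2 : ℝ)) (fun x y => by positivity) ?_ ?_
      · simp only [hK]; fun_prop
      · intro x y
        refine mul_le_of_le_one_right (by positivity) (Real.exp_le_one_iff.2 ?_)
        rw [neg_mul, neg_div, neg_nonpos]
        positivity
      · intro x y hx hy
        refine mul_le_mul ?_ ?_ (Real.exp_pos _).le (by positivity)
        · refine sq_le_rpow_three_halves (by positivity) ?_ ?_
          · exact inv_le_one_of_one_le₀ (by
              have : 0 ≤ 4 * Real.pi * τ₁ := by positivity
              linarith)
          · rw [show Real.pi / (4 * Real.pi ^ 2 * τ) = (4 * Real.pi * τ)⁻¹ by field_simp, hs]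
            refine inv_anti₀ (by positivity) ?_
            have : 4 * Real.pi * τ ≤ 4 * Real.pi * τ₁ := by gcongr; exact hτ.2
            linarith
        · rw [Real.exp_le_exp, show -Real.pi ^ 2 * ‖x - y‖ ^ 2 / (4 * Real.pi ^ 2 * τ) =
            -(‖x - y‖ ^ 2 / (4 * τ)) by field_simp, neg_le_neg_iff, div_le_iff₀ (by positivity)]
          have h3 : ‖x - y‖ ^ 2 ≤ D ^ 2 := by
            have := hdist x y hx hy
            gcongr
          have h4 : D ≤ τ * (2 * μ) := (div_le_iff₀ (by positivity)).1 hτ.1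
          nlinarith
    have hI : 0 ≤ (∫ x, h x) * ∫ y, k y :=
      mul_nonneg (integral_nonneg hh) (integral_nonneg hk)
    have hexp : Real.exp (-μ * D - 1) ≤ Real.exp (-μ ^ 2 * τ) * Real.exp (-(μ * D / 2)) := by
      rw [← Real.exp_add, Real.exp_le_exp]
      have h5 : μ ^ 2 * τ ≤ μ ^ 2 * τ₁ := by gcongr; exact hτ.2
      have h6 : μ ^ 2 * τ₁ = μ * D / 2 + 1 := by
        rw [hτ₁, hτ₀]; field_simp
      linarith
    calc Real.exp (-μ * D - 1) * s ^ 2 * ((∫ x, h x) * ∫ y, k y)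
        ≤ (Real.exp (-μ ^ 2 * τ) * Real.exp (-(μ * D / 2))) * s ^ 2 *
          ((∫ x, h x) * ∫ y, k y) := by gcongr
      _ = Real.exp (-μ ^ 2 * τ) *
          (s ^ 2 * Real.exp (-(μ * D / 2)) * ((∫ x, h x) * ∫ y, k y)) := by ring
      _ ≤ _ := by gcongr
  have := setIntegral_ge_of_const_le_real measurableSet_Icc (by simp) hlow (hint'.mono_set hsub)
  rw [hvol] at this
  linarith

end GaussianLowerBound

end AttenuatedWave
end

/-! ### Necessity: a finite speed c forces 1/c ≤ A. -/

noncomputable section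

namespace AttenuatedWave

section Necessity

variable {κ : ℝ → ℂ} {κt : ℂ → ℂ}

/-- If E exceeded AD, the exponent would eventually lie below -δη with δ > 0, and the exponential
would beat the polynomial factor. -/
theorem le_of_exp_lower_bound {A D E K c₀ : ℝ} {m : ℕ} {μ : ℝ → ℝ} (hc₀ : 0 < c₀) (hK : 0 ≤ K)
    (hμ : Tendsto (fun y => μ y / y) atTop (𝓝 A))
    (hb : ∀ η : ℝ, 1 ≤ η → c₀ ≤ K * (1 + η) ^ m * Real.exp (μ η * D - E * η)) : E ≤ A * D := by
  by_contra! hlt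
  set δ := (E - A * D) / 2 with hδ
  have hδ0 : 0 < δ := by rw [hδ]; linarith
  have h1 : ∀ᶠ y in atTop, μ y / y * D < A * D + δ :=
    (hμ.mul_const D).eventually_lt_const (by linarith)
  have h2 : Tendsto (fun y : ℝ => K * Real.exp δ *
      ((1 + y) ^ (m : ℝ) * Real.exp (-δ * (1 + y)))) atTop (𝓝 0) := by
    have := ((tendsto_rpow_mul_exp_neg_mul_atTop_nhds_zero m δ hδ0).comp
      (tendsto_atTop_add_const_left atTop 1 tendsto_id)).const_mul (K * Real.exp δ)
    rw [mul_zero] at this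
    exact this
  obtain ⟨y, hy1, hy2, hy3⟩ := (h1.and ((h2.eventually_lt_const hc₀).and
    (eventually_ge_atTop 1))).exists
  have hy0 : 0 < y := by linarith
  have h3 : μ y * D - E * y ≤ -δ * y := by
    have : μ y * D = μ y / y * D * y := by field_simp
    rw [this]
    have h4 : μ y / y * D * y ≤ (A * D + δ) * y := by gcongr
    have h5 : (A * D + δ) * y - E * y = -δ * y := by rw [hδ]; ring
    linarith
  have h4 : c₀ ≤ K * (1 + y) ^ m * Real.exp (-δ * y) := (hb y hy3).trans (by gcongr)
  have h5 : K * Real.exp δ * ((1 + y) ^ (m : ℝ) * Real.exp (-δ * (1 + y))) =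
      K * (1 + y) ^ m * Real.exp (-δ * y) := by
    rw [Real.rpow_natCast, show -δ * y = δ + -δ * (1 + y) by ring, Real.exp_add]
    ring
  linarith

/-- Splitting e^{-ηt} = e^{-(η-1)t}e^{-t} leaves a fixed Schwartz function with an exponential
weight. The cutoff starts at T - 2, which gives the rate. -/
theorem exists_norm_apply_tensor_timeExp_le (p : 𝓢'(SpaceTime, ℂ)) (ψ : 𝓢(Space, ℂ)) (T : ℝ) :
    ∃ (n : ℕ) (K : ℝ), 0 ≤ K ∧ ∀ η : ℝ, 1 ≤ η → ∀ hη : 0 < η,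
      ‖p (tensor (timeExp η hη T) ψ)‖ ≤ K * (1 + η) ^ n * Real.exp (-(η - 1) * (T - 2)) := by
  obtain ⟨n, C, hC, hp⟩ : ∃ (n : ℕ) (C : ℝ), 0 ≤ C ∧ ∀ f, ‖p f‖ ≤ C * schwartzNorm n f :=
    exists_norm_apply_le (F := ℂ) p
  obtain ⟨C', hC', h'⟩ := schwartzNorm_expMul_le n (tensor (timeExp 1 one_pos T) ψ)
  refine ⟨n, C * C', by positivity, fun η h1 hη => ?_⟩
  have hsupp : ∀ z, tensor (timeExp 1 one_pos T) ψ z ≠ 0 →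
      timeFunctional (-(η - 1)) z ≤ -(η - 1) * (T - 2) := fun z hz => by
    have : T - 2 ≤ z.fst := by
      by_contra! hcon
      rw [tensor_apply, timeExp_eq_zero one_pos hcon.le, zero_mul] at hz
      exact hz rfl
    rw [timeFunctional_apply]
    nlinarith
  have heq : tensor (timeExp η hη T) ψ = expMul (timeFunctional (-(η - 1)))
      (-(η - 1) * (T - 2)) (tensor (timeExp 1 one_pos T) ψ) hsupp := by
    ext z
    rw [expMul_apply, tensor_apply, tensor_apply, timeExp_apply, timeExp_apply,
      timeFunctional_apply, show -η * z.fst = -(η - 1) * z.fst + -1 * z.fst by ring, Real.exp_add]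
    push_cast
    ring
  have hL : ‖timeFunctional (-(η - 1))‖ ≤ η := by
    rw [timeFunctional, norm_smul, norm_neg, Real.norm_of_nonneg (by linarith)]
    have := mul_le_mul_of_nonneg_left norm_fstL_le (show 0 ≤ η - 1 by linarith)
    linarith
  calc ‖p (tensor (timeExp η hη T) ψ)‖ ≤ C * schwartzNorm n (tensor (timeExp η hη T) ψ) := hp _
    _ ≤ C * (C' * (1 + ‖timeFunctional (-(η - 1))‖) ^ n * Real.exp (-(η - 1) * (T - 2))) := by
      rw [heq]
      gcongr
      exact h' _ _ _
    _ ≤ C * (C' * (1 + η) ^ n * Real.exp (-(η - 1) * (T - 2))) := by gcongr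
    _ = _ := by ring

/-- The two cutoff exponentials agree for t ≥ T - 1, and before that time the cone has not reached
the support of ψ. -/
theorem apply_tensor_timeExp_eq {p : 𝓢'(SpaceTime, ℂ)} {ψ : 𝓢(Space, ℂ)} {c r R T : ℝ}
    (hc : 0 < c) (hp : Distribution.dsupport p ⊆ {z | ‖z.snd‖ ≤ c * z.fst + R})
    (hψ : ∀ x, ψ x ≠ 0 → r ≤ ‖x‖) (hT : 0 ≤ T) (hr : c * (T - 1) + R < r) {η : ℝ} (hη : 0 < η) :
    p (tensor (timeExp η hη 0) ψ) = p (tensor (timeExp η hη T) ψ) := by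
  rw [← sub_eq_zero, ← map_sub]
  refine apply_eq_zero_of_disjoint_dsupport (Set.disjoint_left.2 fun z hz hzp => ?_)
  have hcl : IsClosed {z : SpaceTime | z.fst ≤ T - 1 ∧ r ≤ ‖z.snd‖} :=
    (isClosed_le (WithLp.fstL 2 ℝ ℝ Space).continuous continuous_const).inter
      (isClosed_le continuous_const (WithLp.sndL 2 ℝ ℝ Space).continuous.norm)
  have hsub : tsupport (tensor (timeExp η hη 0) ψ - tensor (timeExp η hη T) ψ) ⊆
      {z : SpaceTime | z.fst ≤ T - 1 ∧ r ≤ ‖z.snd‖} := by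
    refine closure_minimal (fun w hw => ?_) hcl
    have hw' : (timeExp η hη 0 w.fst - timeExp η hη T w.fst) * ψ w.snd ≠ 0 := by
      rw [sub_mul]
      exact hw
    refine ⟨?_, hψ _ (right_ne_zero_of_mul hw')⟩
    by_contra! hcon
    refine left_ne_zero_of_mul hw' ?_
    rw [timeExp_of_le hη (by linarith), timeExp_of_le hη hcon.le, sub_self]
  obtain ⟨h1, h2⟩ := hsub hz
  have h3 : ‖z.snd‖ ≤ c * z.fst + R := hp hzp
  have h4 : c * z.fst ≤ c * (T - 1) := by gcongr
  linarith

/-- The Laplace transform of p against ψ is at least about e^{-μ(η)D} by positivity of the resolvent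
and at most about e^{-η(T-2)} by late arrival. Comparison of the exponents with μ(η)/η → A gives the
claim. -/
theorem IsCausalSolution.sub_two_le_mul (hκ : IsAttenuationCoefficient κ)
    (hκt : IsHolomorphicExtension κ κt) {A : ℝ}
    (hA : Tendsto (fun y : ℝ => (κt (Complex.I * y)).im / y) atTop (𝓝 A))
    {g ψ : 𝓢(Space, ℂ)} {h k : Space → ℝ} (hg : ∀ x, g x = h x) (hψ : ∀ x, ψ x = k x)
    (hh : ∀ x, 0 ≤ h x) (hk : ∀ x, 0 ≤ k x) (hhk : 0 < (∫ x, h x) * ∫ x, k x) {D : ℝ} (hD : 0 < D)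
    (hdist : ∀ x y, h x ≠ 0 → k y ≠ 0 → ‖x - y‖ ≤ D) {p : 𝓢'(SpaceTime, ℂ)}
    (hp : IsCausalSolution κ h p) {c r R T : ℝ} (hc : 0 < c)
    (hsupp : Distribution.dsupport p ⊆ {z | ‖z.snd‖ ≤ c * z.fst + R})
    (hr : ∀ x, k x ≠ 0 → r ≤ ‖x‖) (hT : 0 ≤ T) (hTr : c * (T - 1) + R < r) : T - 2 ≤ A * D := by
  have hpi := Real.pi_pos
  obtain ⟨n, K, hK, hb⟩ := exists_norm_apply_tensor_timeExp_le p ψ T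
  obtain ⟨c₁, hc₁, hlow⟩ := hκt.exists_le_im_mul hκ one_pos
  set μ : ℝ → ℝ := fun y => (κt (Complex.I * y)).im with hμ
  set I := (∫ x, h x) * ∫ x, k x with hI
  set S := 1 + 4 * Real.pi * (D / (2 * c₁) + (c₁ ^ 2)⁻¹) with hS
  have hS0 : 0 < S := by positivity
  have hμ1 : 0 < μ 1 := hκt.im_pos hκ (by simp)
  -- The exponent n + 10 collects n from the continuity of p, 8 from the algebraic prefactor of the
  -- resolvent bound, where 1/μ grows at most quadratically, and 2 from μ² ≤ μ(1)²(1 + η)².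
  refine le_of_exp_lower_bound (c₀ := Real.exp (-1) * I)
    (K := K * Real.exp (T - 2) * (S ^ 2 * μ 1 ^ 2)) (m := n + 10) (by positivity) (by positivity)
    hA fun η h1 => ?_
  have hη : 0 < η := by linarith
  have hμ0 : 0 < μ η := hκt.im_pos hκ (by simpa using hη)
  have hup : μ η ≤ μ 1 * (1 + η) := by
    have := hκt.im_div_antitoneOn hκ one_pos h1
    rw [Complex.ofReal_one, div_one, div_le_iff₀ hη] at this
    have e : μ 1 = (κt (Complex.I * 1)).im := by simp [hμ]
    calc μ η ≤ μ 1 * η := by rw [e]; exact this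
      _ ≤ _ := by gcongr; linarith
  have hdn : c₁ ≤ μ η * (1 + η) ^ 2 := by
    have := hlow (Complex.I * η) (by simpa using h1)
    rwa [norm_mul, Complex.norm_I, one_mul, Complex.norm_real, Real.norm_of_nonneg hη.le] at this
  set q := (1 + η) ^ 2 with hq
  have hq1 : 1 ≤ q := one_le_pow₀ (by linarith)
  have hinv : (μ η)⁻¹ ≤ q / c₁ := by
    rw [inv_le_comm₀ hμ0 (by positivity), inv_div, div_le_iff₀ (by positivity)]
    exact hdn
  have hSle : 1 + 4 * Real.pi * (D / (2 * μ η) + (μ η ^ 2)⁻¹) ≤ S * q ^ 2 := by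
    have e1 : D / (2 * μ η) ≤ D / (2 * c₁) * q ^ 2 := by
      calc D / (2 * μ η) = D / 2 * (μ η)⁻¹ := by field_simp
        _ ≤ D / 2 * (q / c₁) := by gcongr
        _ = D / (2 * c₁) * q := by field_simp
        _ ≤ _ := by gcongr; nlinarith
    have e2 : (μ η ^ 2)⁻¹ ≤ (c₁ ^ 2)⁻¹ * q ^ 2 := by
      calc (μ η ^ 2)⁻¹ = (μ η)⁻¹ ^ 2 := by rw [inv_pow]
        _ ≤ (q / c₁) ^ 2 := by gcongr
        _ = _ := by field_simp
    have e3 : 1 ≤ q ^ 2 := one_le_pow₀ hq1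
    have e4 : 4 * Real.pi * (D / (2 * μ η) + (μ η ^ 2)⁻¹) ≤
        4 * Real.pi * (D / (2 * c₁) * q ^ 2 + (c₁ ^ 2)⁻¹ * q ^ 2) := by gcongr
    rw [hS]
    linarith
  have hgauss := le_norm_integral_mul_laplaceResolvent hg hψ hh hk hD hdist hμ0
  set s := 1 + 4 * Real.pi * (D / (2 * μ η) + (μ η ^ 2)⁻¹) with hs
  have hs0 : 0 < s := by positivity
  have hpn : ‖∫ x, (h x : ℂ) * laplaceResolvent (μ η ^ 2) ψ x‖ ≤
      K * (1 + η) ^ n * Real.exp (-(η - 1) * (T - 2)) := by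
    have e1 := hb η h1 hη
    rw [← apply_tensor_timeExp_eq hc hsupp (fun x hx => hr x fun hx0 => hx (by simp [hψ, hx0]))
      hT hTr hη, hp.apply_tensor_timeExp hκ hκt hη, norm_mul, Complex.norm_real,
      Real.norm_of_nonneg hη.le] at e1
    exact (le_mul_of_one_le_left (norm_nonneg _) h1).trans e1
  have hmain := hgauss.trans hpn
  have e5 : Real.exp (-μ η * D - 1) * I ≤
      K * (1 + η) ^ n * Real.exp (-(η - 1) * (T - 2)) * (s ^ 2 * μ η ^ 2) := by
    calc Real.exp (-μ η * D - 1) * I = Real.exp (-μ η * D - 1) * s⁻¹ ^ 2 * (μ η ^ 2)⁻¹ * I *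
          (s ^ 2 * μ η ^ 2) := by field_simp
      _ ≤ _ := by gcongr
  have e6 : s ^ 2 * μ η ^ 2 ≤ (S * q ^ 2) ^ 2 * (μ 1 * (1 + η)) ^ 2 := by gcongr
  calc Real.exp (-1) * I = Real.exp (μ η * D) * (Real.exp (-μ η * D - 1) * I) := by
        rw [show Real.exp (-1) = Real.exp (μ η * D) * Real.exp (-μ η * D - 1) by
          rw [← Real.exp_add]; congr 1; ring, mul_assoc]
    _ ≤ Real.exp (μ η * D) * (K * (1 + η) ^ n * Real.exp (-(η - 1) * (T - 2)) *
        ((S * q ^ 2) ^ 2 * (μ 1 * (1 + η)) ^ 2)) :=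
        mul_le_mul_of_nonneg_left (e5.trans (mul_le_mul_of_nonneg_left e6 (by positivity)))
          (Real.exp_pos _).le
    _ = K * Real.exp (T - 2) * (S ^ 2 * μ 1 ^ 2) * (1 + η) ^ (n + 10) *
        Real.exp (μ η * D - (T - 2) * η) := by
        have e7 : Real.exp (μ η * D) * Real.exp (-(η - 1) * (T - 2)) =
            Real.exp (T - 2) * Real.exp (μ η * D - (T - 2) * η) := by
          rw [← Real.exp_add, ← Real.exp_add]; congr 1; ring
        rw [hq, pow_add]
        linear_combination K * (1 + η) ^ n * (S ^ 2 * (1 + η) ^ 8 * (μ 1 ^ 2 * (1 + η) ^ 2)) * e7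

theorem isCompact_essSupport_of_hasCompactSupport {h : Space → ℝ} (hh : HasCompactSupport h) :
    essSupport h ⊆ tsupport h ∧ IsCompact (essSupport h) := by
  have hsub : essSupport h ⊆ tsupport h := fun x hx => by
    by_contra hcon
    refine hx (tsupport h)ᶜ ((isClosed_tsupport h).isOpen_compl.mem_nhds hcon) ?_
    refine ae_restrict_of_forall_mem (isClosed_tsupport h).measurableSet.compl fun y hy => ?_
    exact image_eq_zero_of_notMem_tsupport hy
  refine ⟨hsub, hh.isCompact.of_isClosed_subset ?_ hsub⟩
  rw [← isOpen_compl_iff, isOpen_iff_mem_nhds]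
  intro x hx
  simp only [essSupport, Set.mem_compl_iff, Set.mem_ofPred_eq, not_forall, not_not] at hx
  obtain ⟨U, hU, h0⟩ := hx
  filter_upwards [eventually_mem_nhds_iff.2 hU] with y hy
  exact fun hcon => hcon U hy h0

theorem PropagatesWithSpeed.inv_le (hκ : IsAttenuationCoefficient κ)
    (hκt : IsHolomorphicExtension κ κt) {A c : ℝ}
    (hA : Tendsto (fun y : ℝ => (κt (Complex.I * y)).im / y) atTop (𝓝 A))
    (hprop : PropagatesWithSpeed κ c) : c⁻¹ ≤ A := by
  obtain ⟨hc, hprop⟩ := hprop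
  have bump : ∀ x : Space, ∃ f : ContDiffBump x, f.rOut = 1 := fun x =>
    ⟨⟨1 / 2, 1, by norm_num, by norm_num⟩, rfl⟩
  obtain ⟨f, hf⟩ := bump 0
  obtain ⟨hess, hcomp⟩ := isCompact_essSupport_of_hasCompactSupport f.hasCompactSupport
  obtain ⟨p, hp⟩ := exists_isCausalSolution hκ hκt (h := f) (g := bumpSchwartz f)
    (bumpSchwartz_apply f)
  have hsupp := hprop f (f.continuous.memLp_of_hasCompactSupport f.hasCompactSupport) hcomp p hp 2
    two_pos (hess.trans (by
      rw [f.tsupport_eq, hf]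
      exact Metric.closedBall_subset_ball (by norm_num)))
  -- The source is a unit bump at 0, inside the ball of radius 2, and the test bump sits at distance
  -- ρ. Hence r = ρ - 1, D = ρ + 2, and T = (ρ - 3)/c satisfies c(T - 1) + 2 < ρ - 1. The constants
  -- disappear as ρ grows.
  have main : ∀ ρ : ℝ, 3 ≤ ρ → (ρ - 3) / c - 2 ≤ A * (ρ + 2) := by
    intro ρ hρ
    set x₀ : Space := EuclideanSpace.single 0 ρ with hx₀
    have hnx : ‖x₀‖ = ρ := by
      rw [hx₀, PiLp.norm_single, Real.norm_of_nonneg (by linarith)]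
    obtain ⟨k, hk⟩ := bump x₀
    have hkx : ∀ x, k x ≠ 0 → ‖x - x₀‖ < 1 := fun x hx => by
      have : x ∈ Function.support k := hx
      rwa [k.support_eq, hk, mem_ball_iff_norm] at this
    have hfx : ∀ x, f x ≠ 0 → ‖x‖ < 1 := fun x hx => by
      have : x ∈ Function.support f := hx
      rwa [f.support_eq, hf, mem_ball_zero_iff] at this
    refine IsCausalSolution.sub_two_le_mul hκ hκt hA (bumpSchwartz_apply f) (bumpSchwartz_apply k)
      (fun _ => f.nonneg) (fun _ => k.nonneg) (mul_pos f.integral_pos k.integral_pos)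
      (by linarith) (fun x y hx hy => ?_) hp hc hsupp (r := ρ - 1) (fun x hx => ?_)
      (div_nonneg (by linarith) hc.le) ?_
    · have h1 := norm_sub_le_norm_sub_add_norm_sub x x₀ y
      have h2 := norm_sub_le x x₀
      rw [norm_sub_rev x₀ y] at h1
      linarith [hkx y hy, hfx x hx]
    · have h1 := norm_sub_norm_le x₀ x
      rw [norm_sub_rev] at h1
      linarith [hkx x hx]
    · rw [mul_sub, mul_div_cancel₀ _ hc.ne']
      linarith
  by_contra! hlt
  set δ := c⁻¹ - A with hδ
  have hδ0 : 0 < δ := by rw [hδ]; linarith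
  set B := 3 * c⁻¹ + 2 + 2 * A with hB
  have h1 := main (max 3 (B / δ + 1)) (le_max_left _ _)
  set ρ := max 3 (B / δ + 1) with hρ
  have h2 : B / δ < ρ := lt_of_lt_of_le (by linarith) (le_max_right 3 (B / δ + 1))
  rw [div_lt_iff₀ hδ0] at h2
  rw [div_eq_mul_inv] at h1
  rw [hδ, hB] at h2
  linarith

end Necessity

end AttenuatedWave
end

/-! ### The characterization of finite speed and its optimal value. -/

theorem mainTheorem7 (κ : ℝ → ℂ) (κt : ℂ → ℂ)
    (hκ : AttenuatedWave.IsAttenuationCoefficient κ)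
    (hκt : AttenuatedWave.IsHolomorphicExtension κ κt) :
    ∃ A : ℝ,
      Tendsto (fun ω : ℝ => κt (Complex.I * ω) / (Complex.I * ω)) atTop (𝓝 (A : ℂ)) ∧
      ((∃ c : ℝ, AttenuatedWave.PropagatesWithSpeed κ c) ↔ 0 < A) ∧
      (0 < A → ∃ c : ℝ,
        Tendsto (fun ω : ℝ => Complex.I * ω / κt (Complex.I * ω)) atTop (𝓝 (c : ℂ)) ∧
        IsLeast {c' : ℝ | AttenuatedWave.PropagatesWithSpeed κ c'} c) := by
  obtain ⟨A, -, hA, -⟩ := hκt.exists_tendsto_im_div hκ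
  have hlim := hκt.tendsto_div hκ hA
  refine ⟨A, hlim, ⟨?_, fun h0 => ⟨A⁻¹, AttenuatedWave.propagatesWithSpeed_inv hκ hκt h0 hA⟩⟩,
    fun h0 => ⟨A⁻¹, ?_, AttenuatedWave.propagatesWithSpeed_inv hκ hκt h0 hA, fun c' hc' => ?_⟩⟩
  · rintro ⟨c, hc⟩
    exact (inv_pos.2 hc.1).trans_le (hc.inv_le hκ hκt hA)
  · rw [Complex.ofReal_inv]
    refine (hlim.inv₀ (by exact_mod_cast h0.ne')).congr fun ω => inv_div _ _
  · exact inv_le_of_inv_le₀ hc'.1 (hc'.inv_le hκ hκt hA)
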